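/- Let $\mathcal H$ be a separable complex Hilbert space, $\mathcal L(\mathcal H)$ its bounded operators and $\mathcal T(\mathcal H)$ its trace class operators. A state on $\mathcal H$ is a positive operator in $\mathcal T(\mathcal H)$ of trace one. A POVM is a map $M$ from the Borel sets $\mathcal B(\Omega_M)$ of a standard Borel space $\Omega_M$ to the positive operators in $\mathcal L(\mathcal H)$ such that $X\mapsto \mathrm{tr}[\rho M(X)]$ is a probability measure for every state $\rho$. A quantum channel is a completely positive, trace preserving linear map between trace classes. A channel $\Lambda:\mathcal T(\mathcal H)\to\mathcal T(\mathcal H)$ is entanglement breaking if for every separable Hilbert space $\mathcal K$ and every state $\omega$ on $\mathcal K\otimes\mathcal H$ the state $(\mathrm{id}\otimes\Lambda)(\omega)$ is separable, i.e. lies in the trace norm closure of the convex hull of the product states $\alpha\otimes\beta$. **Theorem.** Let $\mathcal S$ be a set of states on $\mathcal H$. The following are equivalent. 1. $\mathcal S$ is (normal) contextuality non-confirming: there are a POVM $G:\mathcal B(\Omega)\to\mathcal L(\mathcal H)$ on a standard Borel space $\Omega$ and a family of states $\{\sigma_\lambda\}_{\lambda\in\Omega}$, weakly measurable in the sense that $\lambda\mapsto\mathrm{tr}[\sigma_\lambda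 A]$ is measurable for every $A\in\mathcal L(\mathcal H)$, such that $$\mathrm{tr}[\rho M(X)]=\int_\Omega \mathrm{tr}[M(X)\sigma_\lambda]\,d\bigl(\mathrm{tr}[\rho G(\lambda)]\bigr)$$ for all $\rho\in\mathcal S$, all POVMs $M$ and all $X\in\mathcal B(\Omega_M)$; here the integral is with respect to the probability measure $Y\mapsto\mathrm{tr}[\rho G(Y)]$. 2. There is an entanglement breaking channel $\Lambda:\mathcal T(\mathcal H)\to\mathcal T(\mathcal H)$ with $\Lambda(\rho)=\rho$ for all $\rho\in\mathcal S$. 3. $\mathcal S$ is broadcastable: there is a quantum channel $\Lambda:\mathcal T(\mathcal H)\to\mathcal T(\mathcal H\otimes\mathcal H)$ such that for all $\rho\in\mathcal S$, all POVMs $A,B$ and all $X\in\mathcal B(\Omega_A)$, $Y\in\mathcal B(\Omega_B)$, $$\mathrm{tr}[A(X)\,\mathrm{tr}_2\Lambda(\rho)]=\mathrm{tr}[A(X)\rho],\qquad \mathrm{tr}[B(Y)\,\mathrm{tr}_1\Lambda(\rho)]=\mathrm{tr}[B(Y)\rho].$$ 4. $\mathcal S$ is commutative: $\rho\tau=\tau\rho$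 for all $\rho,\tau\in\mathcal S$. -/

import Mathlib

open MeasureTheory Filter Topology
open scoped InnerProductSpace TensorProduct ComplexOrder ENNReal

namespace QStates

universe u v

section Trace

variable (H : Type u) [NormedAddCommGroup H] [InnerProductSpace ℂ H] [CompleteSpace H]

/-- Index set of a fixed orthonormal basis of `H`. -/
noncomputable def basisIndex : Set H := (exists_hilbertBasis ℂ H).choose

/-- A fixed orthonormal basis of `H`; traces do not depend on this choice. -/
noncomputable def onb : HilbertBasis (basisIndex H) ℂ H :=
  (exists_hilbertBasis ℂ H).choose_spec.choose

/-- The positive bounded operators with finite trace. -/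
def positiveFiniteTrace : Set (H →L[ℂ] H) :=
  {T | 0 ≤ T ∧ Summable fun i => ⟪onb H i, T (onb H i)⟫_ℂ}

/-- The trace class of `H`: the linear span of the positive operators with finite trace
(equivalently, the operators `T` for which `tr |T|` is finite). -/
def traceClass : Submodule ℂ (H →L[ℂ] H) := Submodule.span ℂ (positiveFiniteTrace H)

variable {H}

/-- The trace `∑ᵢ ⟨eᵢ, T eᵢ⟩`, an absolutely convergent sum for trace class `T`. -/
noncomputable def trace (T : H →L[ℂ] H) : ℂ := ∑' i, ⟪onb H i, T (onb H i)⟫_ℂ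

/-- The trace norm `tr |T|`, where `|T| = (T† T)^(1/2)`. -/
noncomputable def traceNorm (T : H →L[ℂ] H) : ℝ := (trace (CFC.abs T)).re

end Trace

section Compression

variable {H : Type u} [NormedAddCommGroup H] [InnerProductSpace ℂ H] [CompleteSpace H]
variable {K : Type v} [NormedAddCommGroup K] [InnerProductSpace ℂ K] [CompleteSpace K]

theorem onb_parseval (x : H) : ∑' i, ‖⟪onb H i, x⟫_ℂ‖ₑ ^ 2 = ‖x‖ₑ ^ 2 := by
  have h1 : HasSum (fun i => ‖⟪onb H i, x⟫_ℂ‖ ^ 2) (‖x‖ ^ 2) := by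
    have h2 := Complex.hasSum_re ((onb H).hasSum_inner_mul_inner x x)
    have e : (⟪x, x⟫_ℂ).re = ‖x‖ ^ 2 := inner_self_eq_norm_sq (𝕜 := ℂ) x
    rw [e] at h2
    convert h2 using 2 with i
    have h4 := inner_mul_symm_re_eq_norm (𝕜 := ℂ) x (onb H i)
    rw [norm_mul, norm_inner_symm x, ← sq] at h4
    exact h4.symm
  have h3 := (ENNReal.ofReal_tsum_of_nonneg (fun i => by positivity) h1.summable)
  rw [h1.tsum_eq] at h3
  simpa [ENNReal.ofReal_pow, ofReal_norm] using h3.symm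

theorem tsum_enorm_sq_le (A : K →L[ℂ] H) :
    ∑' j, ‖A (onb K j)‖ₑ ^ 2 = ∑' i, ‖A.adjoint (onb H i)‖ₑ ^ 2 := by
  calc ∑' j, ‖A (onb K j)‖ₑ ^ 2
      = ∑' j, ∑' i, ‖⟪onb H i, A (onb K j)⟫_ℂ‖ₑ ^ 2 := by
        simp only [onb_parseval]
    _ = ∑' i, ∑' j, ‖⟪onb H i, A (onb K j)⟫_ℂ‖ₑ ^ 2 := ENNReal.tsum_comm
    _ = ∑' i, ‖A.adjoint (onb H i)‖ₑ ^ 2 := by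
        refine tsum_congr fun i => ?_
        rw [← onb_parseval (A.adjoint (onb H i))]
        refine tsum_congr fun j => ?_
        rw [← ContinuousLinearMap.adjoint_inner_left, ← ofReal_norm, ← ofReal_norm,
          norm_inner_symm]

theorem summable_sq_iff (A : K →L[ℂ] H) :
    (Summable fun j => ⟪onb K j, (A.adjoint ∘L A) (onb K j)⟫_ℂ) ↔
      ∑' j, ‖A (onb K j)‖ₑ ^ 2 ≠ ∞ := by
  have e : (fun j => ⟪onb K j, (A.adjoint ∘L A) (onb K j)⟫_ℂ) =
      fun j => ((‖A (onb K j)‖ ^ 2 : ℝ) : ℂ) := by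
    funext j
    rw [ContinuousLinearMap.comp_apply, ContinuousLinearMap.adjoint_inner_right,
      inner_self_eq_norm_sq_to_K]
    simp
  rw [e, Complex.summable_ofReal]
  have e2 : ∀ j, ‖A (onb K j)‖ₑ ^ 2 = ENNReal.ofReal (‖A (onb K j)‖ ^ 2) := by
    intro j
    rw [ENNReal.ofReal_pow (norm_nonneg _), ofReal_norm]
  simp only [e2]
  constructor
  · intro h
    exact h.tsum_ofReal_ne_top
  · intro h
    have := ENNReal.summable_toReal h
    refine this.congr fun j => ?_
    rw [ENNReal.toReal_ofReal (by positivity)]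

/-- `V† T V` is positive with finite trace if `T` is. -/
theorem positiveFiniteTrace_compress {T : H →L[ℂ] H} (hT : T ∈ positiveFiniteTrace H)
    (V : K →L[ℂ] H) : V.adjoint ∘L T ∘L V ∈ positiveFiniteTrace K := by
  obtain ⟨h0, hs⟩ := hT
  refine ⟨?_, ?_⟩
  · rw [ContinuousLinearMap.nonneg_iff_isPositive] at h0 ⊢
    exact h0.adjoint_conj V
  · set S : H →L[ℂ] H := CFC.sqrt T with hS
    have hSa : S.adjoint = S := (IsSelfAdjoint.of_nonneg (CFC.sqrt_nonneg T)).star_eq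
    have hSS : S.adjoint ∘L S = T := by
      rw [hSa]; exact CFC.sqrt_mul_sqrt_self T h0
    have e : V.adjoint ∘L T ∘L V = (S ∘L V).adjoint ∘L (S ∘L V) := by
      rw [← hSS, ContinuousLinearMap.adjoint_comp]; rfl
    rw [e, summable_sq_iff, tsum_enorm_sq_le, ContinuousLinearMap.adjoint_comp, hSa]
    rw [← hSS, summable_sq_iff] at hs
    refine ne_top_of_le_ne_top (ENNReal.mul_ne_top (a := ‖V.adjoint‖ₑ ^ 2) (by simp) hs) ?_
    rw [← ENNReal.tsum_mul_left]
    refine ENNReal.tsum_le_tsum fun i => ?_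
    rw [← mul_pow]
    gcongr
    exact ContinuousLinearMap.le_opENorm _ _

/-- `V† T W` is trace class if `T` is. -/
theorem traceClass_compress {T : H →L[ℂ] H} (hT : T ∈ traceClass H) (V W : K →L[ℂ] H) :
    V.adjoint ∘L T ∘L W ∈ traceClass K := by
  induction hT using Submodule.span_induction with
  | mem T hT =>
    have key : V.adjoint ∘L T ∘L W = (4⁻¹ : ℂ) •
        ((V + W).adjoint ∘L T ∘L (V + W) - (V - W).adjoint ∘L T ∘L (V - W)
        - Complex.I • ((V + Complex.I • W).adjoint ∘L T ∘L (V + Complex.I • W))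
        + Complex.I • ((V - Complex.I • W).adjoint ∘L T ∘L (V - Complex.I • W))) := by
      ext x
      refine ext_inner_left ℂ fun y => ?_
      simp only [ContinuousLinearMap.comp_apply, ContinuousLinearMap.adjoint_inner_right,
        smul_apply, sub_apply, add_apply,
        inner_smul_right, inner_add_right, inner_sub_right,
        inner_smul_left, map_add, map_sub, map_smul, Complex.conj_I]
      ring_nf
      simp only [Complex.I_sq]
      ring
    rw [key]
    have h := fun U : K →L[ℂ] H =>
      Submodule.subset_span (R := ℂ) (positiveFiniteTrace_compress hT U)
    exact (traceClass K).smul_mem _ ((traceClass K).add_mem ((traceClass K).sub_mem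
      ((traceClass K).sub_mem (h _) (h _)) ((traceClass K).smul_mem _ (h _)))
      ((traceClass K).smul_mem _ (h _)))
  | zero => simp
  | add S T _ _ hS hT =>
    have : V.adjoint ∘L (S + T) ∘L W = V.adjoint ∘L S ∘L W + V.adjoint ∘L T ∘L W := by
      ext x; simp
    rw [this]; exact (traceClass K).add_mem hS hT
  | smul c T _ hT =>
    have : V.adjoint ∘L (c • T) ∘L W = c • (V.adjoint ∘L T ∘L W) := by
      ext x; simp
    rw [this]; exact (traceClass K).smul_mem c hT

end Compression

section Basic

variable (H : Type u) [NormedAddCommGroup H] [InnerProductSpace ℂ H] [CompleteSpace H]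

/-- A quantum state on `H`: a positive trace class operator of trace `1`. -/
structure State where
  op : traceClass H
  nonneg : 0 ≤ (op : H →L[ℂ] H)
  trace_eq_one : trace (op : H →L[ℂ] H) = 1

variable {H} in
/-- The density operator of a state, as a bounded operator. -/
abbrev State.val (ρ : State H) : H →L[ℂ] H := (ρ.op : H →L[ℂ] H)

/-- A positive-operator-valued measure (observable) on `H` with outcomes in `Ω`: for every
state `ρ`, the map `X ↦ tr (ρ M(X))` is a probability measure. The values of `effect` on
non-measurable sets play no role. -/
structure POVM (Ω : Type) [MeasurableSpace Ω] where
  effect : Set Ω → H →L[ℂ] H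
  nonneg : ∀ X, MeasurableSet X → 0 ≤ effect X
  exists_prob : ∀ ρ : State H, ∃ μ : Measure Ω, IsProbabilityMeasure μ ∧
    ∀ X, MeasurableSet X → trace (ρ.val ∘L effect X) = ((μ X).toReal : ℂ)

variable {H}

/-- The outcome distribution `X ↦ tr (ρ M(X))` of the observable `M` in the state `ρ`. -/
noncomputable def POVM.prob {Ω : Type} [MeasurableSpace Ω] (M : POVM H Ω) (ρ : State H) :
    Measure Ω :=
  (M.exists_prob ρ).choose

/-- A set of states is (normally) contextuality non-confirming: one observable `G` on a standard
Borel space and one weakly measurable family of states `σ` reproduce the statistics of every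
observable in every state of the set. -/
def ContextualityNonConfirming (S : Set (State H)) : Prop :=
  ∃ (Ω : Type) (_ : MeasurableSpace Ω) (_ : StandardBorelSpace Ω) (G : POVM H Ω)
    (σ : Ω → State H),
    (∀ A : H →L[ℂ] H, Measurable fun l => trace ((σ l).val ∘L A)) ∧
    ∀ ρ ∈ S, ∀ (Ω' : Type) (_ : MeasurableSpace Ω') (_ : StandardBorelSpace Ω')
      (M : POVM H Ω') (X : Set Ω'), MeasurableSet X →
      trace (ρ.val ∘L M.effect X) =
        ∫ l, trace (M.effect X ∘L (σ l).val) ∂(G.prob ρ)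

/-- A set of states is commutative if its members commute pairwise. -/
def Commutative (S : Set (State H)) : Prop :=
  ∀ ρ ∈ S, ∀ τ ∈ S, ρ.val ∘L τ.val = τ.val ∘L ρ.val

end Basic

section Channel

variable (H : Type u) [NormedAddCommGroup H] [InnerProductSpace ℂ H] [CompleteSpace H]
variable (K : Type v) [NormedAddCommGroup K] [InnerProductSpace ℂ K] [CompleteSpace K]

/-- A quantum channel: a completely positive, trace preserving linear map between trace classes.
Complete positivity says that applying the map entrywise sends positive `n × n` block operators
with trace class entries to positive block operators, for all `n`. -/
structure Channel where
  map : traceClass H →ₗ[ℂ] traceClass K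
  completelyPositive : ∀ (n : ℕ) (T : Fin n → Fin n → traceClass H),
    (∀ x : Fin n → H, 0 ≤ ∑ i, ∑ j, ⟪x i, (T i j : H →L[ℂ] H) (x j)⟫_ℂ) →
    ∀ y : Fin n → K, 0 ≤ ∑ i, ∑ j, ⟪y i, (map (T i j) : K →L[ℂ] K) (y j)⟫_ℂ
  trace_map : ∀ T : traceClass H, trace (map T : K →L[ℂ] K) = trace (T : H →L[ℂ] H)

variable {H}

/-- The trace class operators fixed by a channel from `H` to `H`. -/
def Channel.fix (Λ : Channel H H) : Set (traceClass H) := {T | Λ.map T = T}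

end Channel

section Tensor

variable (H : Type u) [NormedAddCommGroup H] [InnerProductSpace ℂ H] [CompleteSpace H]
variable (K : Type v) [NormedAddCommGroup K] [InnerProductSpace ℂ K] [CompleteSpace K]

/-- The Hilbert space tensor product: the completion of the algebraic tensor product for the inner
product with `⟪x ⊗ y, x' ⊗ y'⟫ = ⟪x, x'⟫ ⟪y, y'⟫`. -/
abbrev HTensor : Type max u v := UniformSpace.Completion (H ⊗[ℂ] K)

variable {H K}

/-- The elementary tensor `x ⊗ y`. -/
noncomputable def tmul (x : H) (y : K) : HTensor H K := ((x ⊗ₜ[ℂ] y : H ⊗[ℂ] K) : HTensor H K)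

variable (K) in
/-- The bounded operator `y ↦ x ⊗ y`. -/
noncomputable def tensorLeft (x : H) : K →L[ℂ] HTensor H K :=
  UniformSpace.Completion.toComplL ∘L TensorProduct.mkL ℂ H K x

variable (H) in
/-- The bounded operator `x ↦ x ⊗ y`. -/
noncomputable def tensorRight (y : K) : H →L[ℂ] HTensor H K :=
  UniformSpace.Completion.toComplL ∘L (TensorProduct.mkL ℂ H K).flip y

/-- The partial trace over the first factor, `⟪y, (tr₁ T) y'⟫ = ∑ᵢ ⟪eᵢ ⊗ y, T (eᵢ ⊗ y')⟫`; the
series of operators converges absolutely in norm for trace class `T`. -/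
noncomputable def partialTrace₁ (T : HTensor H K →L[ℂ] HTensor H K) : K →L[ℂ] K :=
  ∑' i, (tensorLeft K (onb H i)).adjoint ∘L T ∘L tensorLeft K (onb H i)

/-- The partial trace over the second factor, `⟪x, (tr₂ T) x'⟫ = ∑ᵢ ⟪x ⊗ eᵢ, T (x' ⊗ eᵢ)⟫`. -/
noncomputable def partialTrace₂ (T : HTensor H K →L[ℂ] HTensor H K) : H →L[ℂ] H :=
  ∑' i, (tensorRight H (onb K i)).adjoint ∘L T ∘L tensorRight H (onb K i)

/-- The set of states `S` is broadcastable: some channel from `H` to `H ⊗ H` produces, from every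
state in `S`, a state both of whose marginals have the statistics of the original state for all
observables. -/
def Broadcastable (S : Set (State H)) : Prop :=
  ∃ Λ : Channel H (HTensor H H), ∀ ρ ∈ S,
    ∀ (Ω₁ : Type) (_ : MeasurableSpace Ω₁) (_ : StandardBorelSpace Ω₁) (A : POVM H Ω₁)
      (Ω₂ : Type) (_ : MeasurableSpace Ω₂) (_ : StandardBorelSpace Ω₂) (B : POVM H Ω₂)
      (X : Set Ω₁) (Y : Set Ω₂), MeasurableSet X → MeasurableSet Y →
      trace (A.effect X ∘L partialTrace₂ (Λ.map ρ.op).1) = trace (A.effect X ∘L ρ.val) ∧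
      trace (B.effect Y ∘L partialTrace₁ (Λ.map ρ.op).1) = trace (B.effect Y ∘L ρ.val)

/-- The product operators `α ⊗ β` of states `α` on `H` and `β` on `K`. -/
def productStates (H : Type u) [NormedAddCommGroup H] [InnerProductSpace ℂ H] [CompleteSpace H]
    (K : Type v) [NormedAddCommGroup K] [InnerProductSpace ℂ K] [CompleteSpace K] :
    Set (HTensor H K →L[ℂ] HTensor H K) :=
  {τ | ∃ (α : State H) (β : State K), ∀ x y,
    τ (tmul x y) = tmul (α.val x) (β.val y)}

/-- A state on `H ⊗ K` is separable if it lies in the trace norm closure of the convex hull of the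
product states. -/
def State.Separable (ω : State (HTensor H K)) : Prop :=
  ∀ ε : ℝ, 0 < ε → ∃ τ ∈ convexHull ℝ (productStates H K),
    traceNorm (ω.val - τ) < ε

/-- The `(x, x')` matrix entry of a trace class operator on `H ⊗ K` in the first factor: the
operator `T_{x,x'}` on `K` with `⟪y, T_{x,x'} y'⟫ = ⟪x ⊗ y, T (x' ⊗ y')⟫`. -/
noncomputable def slice (T : traceClass (HTensor H K)) (x x' : H) : traceClass K :=
  ⟨(tensorLeft K x).adjoint ∘L (T : HTensor H K →L[ℂ] HTensor H K) ∘L tensorLeft K x',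
    traceClass_compress T.2 _ _⟩

end Tensor

section EntanglementBreaking

variable {H : Type u} [NormedAddCommGroup H] [InnerProductSpace ℂ H] [CompleteSpace H]

/-- `T' = (id ⊗ Λ) T`: the matrix entries of `T'` in the first factor are the images under `Λ` of
those of `T`. -/
def Channel.IsAmpliation (Λ : Channel H H) {K : Type v} [NormedAddCommGroup K]
    [InnerProductSpace ℂ K] [CompleteSpace K] (T T' : traceClass (HTensor K H)) : Prop :=
  ∀ k k' : K, slice T' k k' = Λ.map (slice T k k')

/-- A channel `Λ` is entanglement breaking if for every separable ancilla Hilbert space `K` and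
every state `ω` on `K ⊗ H` the state `(id ⊗ Λ) ω` is separable. -/
def Channel.EntanglementBreaking (Λ : Channel H H) : Prop :=
  ∀ (K : Type u) [NormedAddCommGroup K] [InnerProductSpace ℂ K] [CompleteSpace K]
    [TopologicalSpace.SeparableSpace K] (ω : State (HTensor K H)),
    ∃ ω' : State (HTensor K H), Λ.IsAmpliation ω.op ω'.op ∧ ω'.Separable

end EntanglementBreaking

end QStates

/-! Commutativity is the hub. Commuting states are compact and self-adjoint, so they are diagonal in
one orthonormal basis `b` (`exists_joint_eigenbasis`), and measuring in `b` loses nothing about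
them. Preparing `b i` after outcome `i` gives an entanglement breaking channel that fixes them,
preparing `b i ⊗ b i` broadcasts them, and the sharp observable of `b` with the pure states of the
`b i` is a noncontextual model.

Conversely, each of the other conditions saturates a monotonicity inequality of Fisher information.
For `ρ`, `τ` in the set put `ω = (ρ + τ) / 2` and let `X` be the symmetric logarithmic derivative, a
bounded self-adjoint solution of `ω X + X ω = 2 ρ` (`exists_sld`). If `X` commutes with `ω`, then `ρ
= X ω` commutes with `ω`, hence with `τ = 2 ω - ρ` (`commute_of_sld`). So it suffices that `tr ([X,
M] ω) = 0` for all `M` (`comm_of_trace`). The equation also gives `tr (X ρ) = tr (X² ω)`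
(`trace_sld`); call this number `J`.

Broadcasting: both marginals retain `J`. Testing `Channel.sld_inequality` with the average of `X ⊗
1` and `1 ⊗ X` forces these two operators to agree on the image `Ω` of `ω`. Since `1 ⊗ X` commutes
with every `M ⊗ 1`, the commutator has zero expectation.

In the other two cases the expectation of `[X, M]` is controlled by the variance of `X`
(`norm_trace_commutator_le`), and saturation makes the relevant average variance vanish. In a
noncontextual model, `f l = tr (X σ_l)` satisfies `J ≤ ∫ f²` (`two_mul_integral_le`), while `tr (X²
σ_l)` integrates to `J`. For an entanglement breaking channel, a state on qubit ⊗ `H` with blocks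
proportional to `ω`, `ωX`, `Xω`, `XωX` is sent to a separable state in which `varianceOp` has
expectation zero; on product states that expectation dominates a weighted variance of `X`. -/

namespace QStates

universe u v w

set_option linter.unusedSectionVars false

/-! ### Hilbert-Schmidt operators and cyclicity of the trace of their products. -/

section HilbertSchmidt

variable {H : Type u} [NormedAddCommGroup H] [InnerProductSpace ℂ H] [CompleteSpace H]
variable {K : Type v} [NormedAddCommGroup K] [InnerProductSpace ℂ K] [CompleteSpace K]
variable {L : Type w} [NormedAddCommGroup L] [InnerProductSpace ℂ L] [CompleteSpace L]
variable {ι κ : Type*}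

theorem nonneg_iff_inner {T : H →L[ℂ] H} : 0 ≤ T ↔ ∀ x, 0 ≤ ⟪x, T x⟫_ℂ := by
  rw [ContinuousLinearMap.nonneg_iff_isPositive]
  refine ⟨fun h x => h.inner_nonneg_right x, fun h => ?_⟩
  rw [ContinuousLinearMap.isPositive_iff_complex]
  intro x
  have h1 := h x
  rw [← inner_conj_symm] at h1
  obtain ⟨h2, h3⟩ := Complex.nonneg_iff.1 h1
  simp only [Complex.conj_re, Complex.conj_im] at h2 h3
  refine ⟨Complex.ext ?_ ?_, h2⟩ <;> simp
  linarith

/-- Parseval's identity for the squared norm. -/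
theorem hasSum_norm_inner_sq (b : HilbertBasis ι ℂ H) (x : H) :
    HasSum (fun i => ‖⟪b i, x⟫_ℂ‖ ^ 2) (‖x‖ ^ 2) := by
  have h2 := Complex.hasSum_re (b.hasSum_inner_mul_inner x x)
  have e : (⟪x, x⟫_ℂ).re = ‖x‖ ^ 2 := inner_self_eq_norm_sq (𝕜 := ℂ) x
  rw [e] at h2
  convert h2 using 2 with i
  have h4 := inner_mul_symm_re_eq_norm (𝕜 := ℂ) x (b i)
  rw [norm_mul, norm_inner_symm x, ← sq] at h4
  exact h4.symm

/-- An operator is Hilbert-Schmidt if its matrix entries in some bases are square summable. -/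
def IsHS (A : H →L[ℂ] K) : Prop :=
  Summable fun i => ‖A (onb H i)‖ ^ 2

theorem summable_matrix_of_summable (b : HilbertBasis ι ℂ H) (c : HilbertBasis κ ℂ K)
    {A : H →L[ℂ] K} (hA : Summable fun i => ‖A (b i)‖ ^ 2) :
    Summable fun p : ι × κ => ‖⟪c p.2, A (b p.1)⟫_ℂ‖ ^ 2 := by
  rw [summable_prod_of_nonneg (fun p => by positivity)]
  refine ⟨fun i => (hasSum_norm_inner_sq c (A (b i))).summable, ?_⟩
  simpa only [(hasSum_norm_inner_sq c (A (b _))).tsum_eq] using hA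

theorem summable_of_summable_matrix (b : HilbertBasis ι ℂ H) (c : HilbertBasis κ ℂ K)
    {A : H →L[ℂ] K} (hA : Summable fun p : ι × κ => ‖⟪c p.2, A (b p.1)⟫_ℂ‖ ^ 2) :
    Summable fun i => ‖A (b i)‖ ^ 2 := by
  rw [summable_prod_of_nonneg (fun p => by positivity)] at hA
  simpa only [(hasSum_norm_inner_sq c (A (b _))).tsum_eq] using hA.2

/-- The same squared matrix entries are summed by rows or by columns. Applied twice, this makes
`IsHS` independent of the basis. -/
theorem summable_adjoint (b : HilbertBasis ι ℂ H) (c : HilbertBasis κ ℂ K)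
    {A : H →L[ℂ] K} (hA : Summable fun i => ‖A (b i)‖ ^ 2) :
    Summable fun j => ‖A.adjoint (c j)‖ ^ 2 := by
  refine summable_of_summable_matrix c b ?_
  rw [← (Equiv.prodComm ι κ).summable_iff]
  refine (summable_matrix_of_summable b c hA).congr fun p => ?_
  simp only [Function.comp_apply, Equiv.prodComm_apply, Prod.fst_swap, Prod.snd_swap]
  rw [← ContinuousLinearMap.adjoint_inner_left,
    norm_inner_symm]

theorem IsHS.summable {A : H →L[ℂ] K} (hA : IsHS A) (b : HilbertBasis ι ℂ H) :
    Summable fun i => ‖A (b i)‖ ^ 2 := by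
  simpa using summable_adjoint (onb K) b (summable_adjoint (onb H) (onb K) hA)

theorem IsHS.adjoint {A : H →L[ℂ] K} (hA : IsHS A) : IsHS A.adjoint :=
  summable_adjoint _ _ hA

theorem IsHS.comp_left {A : H →L[ℂ] K} (hA : IsHS A) (B : K →L[ℂ] L) : IsHS (B ∘L A) := by
  refine Summable.of_nonneg_of_le (fun i => by positivity) (fun i => ?_) (hA.mul_left (‖B‖ ^ 2))
  rw [← mul_pow]
  gcongr
  exact B.le_opNorm _

theorem IsHS.comp_right {A : K →L[ℂ] L} (hA : IsHS A) (B : H →L[ℂ] K) : IsHS (A ∘L B) := by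
  have := (hA.adjoint.comp_left B.adjoint).adjoint
  rwa [← ContinuousLinearMap.adjoint_comp, ContinuousLinearMap.adjoint_adjoint] at this

theorem summable_inner_of_sq {f g : ι → H} (hf : Summable fun i => ‖f i‖ ^ 2)
    (hg : Summable fun i => ‖g i‖ ^ 2) : Summable fun i => ‖f i‖ * ‖g i‖ := by
  refine Summable.of_nonneg_of_le (fun i => by positivity) (fun i => ?_) (hf.add hg)
  nlinarith [sq_nonneg (‖f i‖ - ‖g i‖), sq_nonneg (‖f i‖), sq_nonneg (‖g i‖)]

/-- The trace of a product of two Hilbert-Schmidt operators may be computed in any basis, after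
a cyclic permutation. -/
theorem exists_hasSum_hs {A : K →L[ℂ] H} {B : H →L[ℂ] K} (hA : IsHS A) (hB : IsHS B)
    (b : HilbertBasis ι ℂ H) (c : HilbertBasis κ ℂ K) :
    ∃ t : ℂ, HasSum (fun i => ⟪b i, A (B (b i))⟫_ℂ) t ∧
      HasSum (fun j => ⟪c j, B (A (c j))⟫_ℂ) t := by
  -- The double series is dominated by a sum of two square summable families, so it converges
  -- absolutely, and the two traces are its iterated sums.
  have hs : Summable fun p : ι × κ => ⟪b p.1, A (c p.2)⟫_ℂ * ⟪c p.2, B (b p.1)⟫_ℂ := by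
    have h1 := summable_matrix_of_summable c b (hA.summable c)
    have h2 := summable_matrix_of_summable b c (hB.summable b)
    rw [← (Equiv.prodComm ι κ).summable_iff] at h1
    refine Summable.of_norm (Summable.of_nonneg_of_le (fun i => norm_nonneg _) (fun p => ?_)
      (summable_inner_of_sq h1 h2))
    simp
  refine ⟨_, hs.hasSum.prod_fiberwise fun i => ?_, ?_⟩
  · have := c.hasSum_inner_mul_inner (A.adjoint (b i)) (B (b i))
    simpa only [ContinuousLinearMap.adjoint_inner_left] using this
  · have h3 := (Equiv.prodComm κ ι).hasSum_iff.2 hs.hasSum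
    refine h3.prod_fiberwise fun j => ?_
    have := b.hasSum_inner_mul_inner (B.adjoint (c j)) (A (c j))
    simp only [ContinuousLinearMap.adjoint_inner_left] at this
    simp only [mul_comm ⟪c j, B (b _)⟫_ℂ] at this
    exact this

end HilbertSchmidt

/-! ### Trace class operators, the trace, and series of positive operators. -/

section TraceClass

variable {H : Type u} [NormedAddCommGroup H] [InnerProductSpace ℂ H] [CompleteSpace H]
variable {K : Type v} [NormedAddCommGroup K] [InnerProductSpace ℂ K] [CompleteSpace K]
variable {ι κ : Type*}

theorem adjoint_sqrt (P : H →L[ℂ] H) : (CFC.sqrt P).adjoint = CFC.sqrt P :=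
  (IsSelfAdjoint.of_nonneg (CFC.sqrt_nonneg P)).star_eq

theorem sqrt_comp_sqrt {P : H →L[ℂ] H} (hP : 0 ≤ P) : CFC.sqrt P ∘L CFC.sqrt P = P :=
  CFC.sqrt_mul_sqrt_self P hP

theorem adjoint_eq_of_nonneg {P : H →L[ℂ] H} (hP : 0 ≤ P) : P.adjoint = P :=
  (IsSelfAdjoint.of_nonneg hP).star_eq

theorem inner_eq_norm_sqrt_sq {P : H →L[ℂ] H} (hP : 0 ≤ P) (x : H) :
    ⟪x, P x⟫_ℂ = ((‖CFC.sqrt P x‖ ^ 2 : ℝ) : ℂ) := by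
  conv_lhs => rw [← sqrt_comp_sqrt hP]
  rw [ContinuousLinearMap.comp_apply, ← ContinuousLinearMap.adjoint_inner_left, adjoint_sqrt,
    inner_self_eq_norm_sq_to_K]
  simp

theorem isHS_sqrt_iff {P : H →L[ℂ] H} (hP : 0 ≤ P) :
    IsHS (CFC.sqrt P) ↔ Summable fun i => ⟪onb H i, P (onb H i)⟫_ℂ := by
  simp only [inner_eq_norm_sqrt_sq hP, Complex.summable_ofReal]
  rfl

theorem isHS_sqrt {P : H →L[ℂ] H} (hP : P ∈ positiveFiniteTrace H) : IsHS (CFC.sqrt P) :=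
  (isHS_sqrt_iff hP.1).2 hP.2

theorem subset_traceClass {P : H →L[ℂ] H} (hP : P ∈ positiveFiniteTrace H) : P ∈ traceClass H :=
  Submodule.subset_span hP

/-- Cyclicity and basis independence of the trace: `tr (A T B) = tr (T B A)`. -/
theorem exists_hasSum_trace {T : H →L[ℂ] H} (hT : T ∈ traceClass H) (A : H →L[ℂ] K)
    (B : K →L[ℂ] H) (b : HilbertBasis ι ℂ H) (c : HilbertBasis κ ℂ K) :
    ∃ t : ℂ, HasSum (fun j => ⟪c j, A (T (B (c j)))⟫_ℂ) t ∧
      HasSum (fun i => ⟪b i, T (B (A (b i)))⟫_ℂ) t ∧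
      HasSum (fun i => ⟪b i, B (A (T (b i)))⟫_ℂ) t := by
  induction hT using Submodule.span_induction with
  | mem P hP =>
    have hS := isHS_sqrt hP
    set S := CFC.sqrt P with hSdef
    have hSP : ∀ x, P x = S (S x) := fun x => by
      conv_lhs => rw [← sqrt_comp_sqrt hP.1]
      rfl
    -- All three series are compared with the trace of `S B A S`: in each of the products `A S S B`,
    -- `S S B A`, `B A S S` the operator splits into two Hilbert-Schmidt factors that can be
    -- swapped.
    obtain ⟨t, h1, h2⟩ := exists_hasSum_hs (hS.comp_left A) (hS.comp_right B) c b
    obtain ⟨t', h3, h4⟩ := exists_hasSum_hs ((hS.comp_right B).comp_right A) hS b b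
    obtain ⟨t'', h5, h6⟩ := exists_hasSum_hs ((hS.comp_left A).comp_left B) hS b b
    simp only [ContinuousLinearMap.comp_apply] at h1 h2 h3 h4 h5 h6
    obtain rfl := h2.unique h3
    obtain rfl := h6.unique h2
    refine ⟨t'', ?_, ?_, ?_⟩ <;> simp only [hSP] <;> assumption
  | zero => exact ⟨0, by simp [hasSum_zero]⟩
  | add S T _ _ hS hT =>
    obtain ⟨s, h1, h2, h3⟩ := hS
    obtain ⟨t, h4, h5, h6⟩ := hT
    refine ⟨s + t, ?_, ?_, ?_⟩ <;>
      simp only [add_apply, map_add, inner_add_right]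
    exacts [h1.add h4, h2.add h5, h3.add h6]
  | smul a T _ hT =>
    obtain ⟨t, h4, h5, h6⟩ := hT
    refine ⟨a * t, ?_, ?_, ?_⟩ <;>
      simp only [smul_apply, map_smul, inner_smul_right]
    exacts [h4.mul_left a, h5.mul_left a, h6.mul_left a]

theorem hasSum_trace {T : H →L[ℂ] H} (hT : T ∈ traceClass H) (b : HilbertBasis ι ℂ H) :
    HasSum (fun i => ⟪b i, T (b i)⟫_ℂ) (trace T) := by
  obtain ⟨t, h1, h2, h3⟩ := exists_hasSum_trace hT (.id ℂ H) (.id ℂ H) (onb H) b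
  simp only [ContinuousLinearMap.id_apply] at h1 h2
  rwa [trace, h2.tsum_eq]

theorem comp_mem_traceClass {T : H →L[ℂ] H} (hT : T ∈ traceClass H) (A : H →L[ℂ] K)
    (B : K →L[ℂ] H) : A ∘L T ∘L B ∈ traceClass K := by
  simpa using traceClass_compress hT A.adjoint B

theorem comp_left_mem_traceClass {T : H →L[ℂ] H} (hT : T ∈ traceClass H) (A : H →L[ℂ] H) :
    A ∘L T ∈ traceClass H := by
  simpa using comp_mem_traceClass hT A (.id ℂ H)

theorem comp_right_mem_traceClass {T : H →L[ℂ] H} (hT : T ∈ traceClass H) (A : H →L[ℂ] H) :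
    T ∘L A ∈ traceClass H := by
  simpa using comp_mem_traceClass hT (.id ℂ H) A

theorem trace_conj {T : H →L[ℂ] H} (hT : T ∈ traceClass H) (A : H →L[ℂ] K) (B : K →L[ℂ] H) :
    trace (A ∘L T ∘L B) = trace (B ∘L A ∘L T) := by
  obtain ⟨t, h1, h2, h3⟩ := exists_hasSum_trace hT A B (onb H) (onb K)
  exact h1.tsum_eq.trans h3.tsum_eq.symm

theorem trace_comm {T : H →L[ℂ] H} (hT : T ∈ traceClass H) (A : H →L[ℂ] H) :
    trace (T ∘L A) = trace (A ∘L T) := by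
  simpa using trace_conj hT (.id ℂ H) A

@[simp]
theorem trace_zero : trace (0 : H →L[ℂ] H) = 0 := by simp [trace]

theorem trace_add {S T : H →L[ℂ] H} (hS : S ∈ traceClass H) (hT : T ∈ traceClass H) :
    trace (S + T) = trace S + trace T := by
  simpa [inner_add_right, trace] using ((hasSum_trace hS (onb H)).add (hasSum_trace hT (onb H))).tsum_eq

theorem trace_smul (a : ℂ) (T : H →L[ℂ] H) : trace (a • T) = a * trace T := by
  simp [trace, tsum_mul_left]

theorem trace_neg (T : H →L[ℂ] H) : trace (-T) = -trace T := by
  simpa using trace_smul (-1) T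

theorem trace_sub {S T : H →L[ℂ] H} (hS : S ∈ traceClass H) (hT : T ∈ traceClass H) :
    trace (S - T) = trace S - trace T := by
  rw [sub_eq_add_neg, trace_add hS (neg_mem hT), trace_neg, sub_eq_add_neg]

theorem trace_sum (s : Finset ι) {T : ι → H →L[ℂ] H} (hT : ∀ i ∈ s, T i ∈ traceClass H) :
    trace (∑ i ∈ s, T i) = ∑ i ∈ s, trace (T i) := by
  classical
  induction s using Finset.induction_on with
  | empty => simp
  | insert a s ha ih =>
    rw [Finset.sum_insert ha, Finset.sum_insert ha, trace_add (hT _ (Finset.mem_insert_self _ _))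
      (sum_mem fun i hi => hT i (Finset.mem_insert_of_mem hi)),
      ih fun i hi => hT i (Finset.mem_insert_of_mem hi)]

theorem trace_nonneg {P : H →L[ℂ] H} (hP : 0 ≤ P) : 0 ≤ trace P :=
  tsum_nonneg fun _ => nonneg_iff_inner.1 hP _

theorem trace_eq_re {P : H →L[ℂ] H} (hP : 0 ≤ P) : trace P = ((trace P).re : ℂ) :=
  (Complex.eq_re_of_ofReal_le (r := 0) (by simpa using trace_nonneg hP))

theorem trace_re_nonneg {P : H →L[ℂ] H} (hP : 0 ≤ P) : 0 ≤ (trace P).re :=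
  (Complex.nonneg_iff.1 (trace_nonneg hP)).1

theorem hasSum_norm_sqrt_sq {P : H →L[ℂ] H} (hP : P ∈ positiveFiniteTrace H)
    (b : HilbertBasis ι ℂ H) : HasSum (fun i => ‖CFC.sqrt P (b i)‖ ^ 2) (trace P).re := by
  have := Complex.hasSum_re (hasSum_trace (subset_traceClass hP) b)
  simpa only [inner_eq_norm_sqrt_sq hP.1, Complex.ofReal_re] using this

/-- Cyclicity turns the trace into `∑ ⟪√P eᵢ, M √P eᵢ⟫`, which is bounded term by term by `‖M‖ ‖√P
eᵢ‖²`. -/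
theorem norm_trace_comp_le {P : H →L[ℂ] H} (hP : P ∈ positiveFiniteTrace H) (M : H →L[ℂ] H) :
    ‖trace (M ∘L P)‖ ≤ ‖M‖ * (trace P).re := by
  have hT := subset_traceClass hP
  set S := CFC.sqrt P with hS
  obtain ⟨t, h1, h2⟩ := exists_hasSum_hs ((isHS_sqrt hP).comp_left M) (isHS_sqrt hP)
    (onb H) (onb H)
  have e : trace (M ∘L P) = t := by
    rw [← h1.tsum_eq, trace]
    congr! 3 with i
    conv_lhs => rw [← sqrt_comp_sqrt hP.1]
    rfl
  have h3 := (hasSum_norm_sqrt_sq hP (onb H)).mul_left ‖M‖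
  rw [e, ← h2.tsum_eq]
  refine tsum_of_norm_bounded h3 fun i => ?_
  rw [← ContinuousLinearMap.adjoint_inner_left, adjoint_sqrt]
  refine (norm_inner_le_norm _ _).trans ?_
  have := M.le_opNorm (S (onb H i))
  simp only [ContinuousLinearMap.comp_apply]
  nlinarith [norm_nonneg (S (onb H i))]

theorem trace_comp_rankOne (T : H →L[ℂ] H) (x y : H) :
    trace (T ∘L InnerProductSpace.rankOne ℂ y x) = ⟪x, T y⟫_ℂ := by
  rw [trace, ← (onb H).tsum_inner_mul_inner x (T y)]
  simp

/-- Taking `M = |x⟩⟨P x|` in `norm_trace_comp_le` gives `‖P x‖² ≤ ‖x‖ ‖P x‖ tr P`. -/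
theorem norm_le_trace {P : H →L[ℂ] H} (hP : P ∈ positiveFiniteTrace H) : ‖P‖ ≤ (trace P).re := by
  refine ContinuousLinearMap.opNorm_le_bound _ (trace_re_nonneg hP.1) fun x => ?_
  have h := norm_trace_comp_le hP (InnerProductSpace.rankOne ℂ x (P x))
  rw [← trace_comm (subset_traceClass hP), trace_comp_rankOne, InnerProductSpace.norm_rankOne,
    inner_self_eq_norm_sq_to_K] at h
  rcases eq_or_ne (P x) 0 with h0 | h0
  · rw [h0, norm_zero]
    exact mul_nonneg (trace_re_nonneg hP.1) (norm_nonneg _)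
  · have h1 : 0 < ‖P x‖ := norm_pos_iff.2 h0
    simp only [norm_pow, RCLike.norm_ofReal, abs_norm] at h
    nlinarith

theorem eq_zero_of_trace_eq_zero {P : H →L[ℂ] H} (hP : P ∈ positiveFiniteTrace H)
    (h : (trace P).re = 0) : P = 0 :=
  norm_le_zero_iff.1 (h ▸ norm_le_trace hP)

theorem comp_left_eq_of_trace {S T : H →L[ℂ] H}
    (h : ∀ M : H →L[ℂ] H, trace (S ∘L M) = trace (T ∘L M)) : S = T := by
  ext y
  refine ext_inner_left ℂ fun x => ?_
  simpa only [trace_comp_rankOne] using h (InnerProductSpace.rankOne ℂ y x)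

theorem mem_positiveFiniteTrace_iff {P : H →L[ℂ] H} :
    P ∈ positiveFiniteTrace H ↔ 0 ≤ P ∧ P ∈ traceClass H :=
  ⟨fun h => ⟨h.1, subset_traceClass h⟩, fun h => ⟨h.1, (hasSum_trace h.2 _).summable⟩⟩

theorem positiveFiniteTrace_add {P Q : H →L[ℂ] H} (hP : P ∈ positiveFiniteTrace H)
    (hQ : Q ∈ positiveFiniteTrace H) : P + Q ∈ positiveFiniteTrace H :=
  mem_positiveFiniteTrace_iff.2
    ⟨add_nonneg hP.1 hQ.1, add_mem (subset_traceClass hP) (subset_traceClass hQ)⟩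

theorem positiveFiniteTrace_smul {P : H →L[ℂ] H} (hP : P ∈ positiveFiniteTrace H) {a : ℝ}
    (ha : 0 ≤ a) : (a : ℂ) • P ∈ positiveFiniteTrace H := by
  refine mem_positiveFiniteTrace_iff.2 ⟨?_, Submodule.smul_mem _ _ (subset_traceClass hP)⟩
  rw [nonneg_iff_inner]
  intro x
  rw [smul_apply, inner_smul_right]
  exact mul_nonneg (by simpa using ha) (nonneg_iff_inner.1 hP.1 x)

theorem positiveFiniteTrace_sum (s : Finset ι) {P : ι → H →L[ℂ] H}
    (hP : ∀ i ∈ s, P i ∈ positiveFiniteTrace H) : ∑ i ∈ s, P i ∈ positiveFiniteTrace H :=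
  mem_positiveFiniteTrace_iff.2 ⟨Finset.sum_nonneg fun i hi => (hP i hi).1,
    sum_mem fun i hi => subset_traceClass (hP i hi)⟩

/-- A family of positive trace class operators with summable traces is summable, to a positive
trace class operator, and the trace may be interchanged with the sum. -/
theorem exists_hasSum_positive {P : ι → H →L[ℂ] H} (hP : ∀ i, P i ∈ positiveFiniteTrace H)
    (hs : Summable fun i => (trace (P i)).re) :
    ∃ S ∈ positiveFiniteTrace H, HasSum P S ∧
      ∀ M : H →L[ℂ] H, HasSum (fun i => trace (M ∘L P i)) (trace (M ∘L S)) := by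
  have hsum : Summable P := Summable.of_norm
    (Summable.of_nonneg_of_le (fun i => norm_nonneg _) (fun i => norm_le_trace (hP i)) hs)
  obtain ⟨S, hS⟩ := hsum
  have hin : ∀ x y, HasSum (fun i => ⟪x, P i y⟫_ℂ) ⟪x, S y⟫_ℂ := fun x y =>
    (hS.mapL ((ContinuousLinearMap.apply ℂ H y))).mapL (innerSL ℂ x)
  have hS0 : 0 ≤ S := nonneg_iff_inner.2 fun x =>
    (hin x x).nonneg fun i => nonneg_iff_inner.1 (hP i).1 x
  have hle : ∀ s : Finset ι, 0 ≤ S - ∑ i ∈ s, P i := fun s => sub_nonneg.2 <| by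
    rw [← sub_nonneg, nonneg_iff_inner]
    intro x
    rw [sub_apply, inner_sub_right, sub_nonneg, sum_apply, inner_sum]
    exact sum_le_hasSum s (fun i _ => nonneg_iff_inner.1 (hP i).1 x) (hin x x)
  -- The nonnegative family `‖√Pᵢ eⱼ‖²` is summed in both orders: over `i` first it gives the
  -- diagonal of `S`, over `j` first the traces of the `P i`.
  have hpair : Summable fun p : ι × basisIndex H => ‖CFC.sqrt (P p.1) (onb H p.2)‖ ^ 2 := by
    rw [summable_prod_of_nonneg (fun p => by positivity)]
    refine ⟨fun i => (hasSum_norm_sqrt_sq (hP i) _).summable, ?_⟩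
    simpa only [(hasSum_norm_sqrt_sq (hP _) _).tsum_eq] using hs
  have hpair' := (Equiv.prodComm _ _).hasSum_iff.2 hpair.hasSum
  have htr : HasSum (fun j => (⟪onb H j, S (onb H j)⟫_ℂ).re)
      (∑' p : ι × basisIndex H, ‖CFC.sqrt (P p.1) (onb H p.2)‖ ^ 2) := by
    refine hpair'.prod_fiberwise fun j => ?_
    have := Complex.hasSum_re (hin (onb H j) (onb H j))
    simp only [inner_eq_norm_sqrt_sq (hP _).1, Complex.ofReal_re] at this
    exact this
  have hSm : S ∈ positiveFiniteTrace H := by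
    refine ⟨hS0, ?_⟩
    refine (Complex.summable_ofReal.2 htr.summable).congr fun j => ?_
    exact (Complex.eq_re_of_ofReal_le (r := 0) (by simpa using nonneg_iff_inner.1 hS0 _)).symm
  have htrS : HasSum (fun i => (trace (P i)).re) (trace S).re := by
    have h1 := (Complex.hasSum_re (hasSum_trace (subset_traceClass hSm) (onb H))).unique htr
    rw [h1]
    exact hpair.hasSum.prod_fiberwise fun i => hasSum_norm_sqrt_sq (hP i) (onb H)
  refine ⟨S, hSm, hS, fun M => ?_⟩
  have hmem : ∀ s : Finset ι, ∑ i ∈ s, P i ∈ traceClass H := fun s =>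
    sum_mem fun i _ => subset_traceClass (hP i)
  rw [HasSum, tendsto_iff_norm_sub_tendsto_zero]
  have hlim : Tendsto (fun s : Finset ι => ‖M‖ * ((trace S).re - ∑ i ∈ s, (trace (P i)).re))
      atTop (𝓝 0) := by
    have : Tendsto (fun s : Finset ι => ∑ i ∈ s, (trace (P i)).re) atTop (𝓝 (trace S).re) := htrS
    simpa using (tendsto_const_nhds (x := (trace S).re)).sub this |>.const_mul ‖M‖
  refine squeeze_zero (fun _ => norm_nonneg _) (fun s => ?_) hlim
  -- The tail is positive, so its pairing with `M` is at most `‖M‖` times the trace of the tail.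
  have hd : S - ∑ i ∈ s, P i ∈ positiveFiniteTrace H :=
    mem_positiveFiniteTrace_iff.2 ⟨hle s, sub_mem (subset_traceClass hSm) (hmem s)⟩
  have h2 := norm_trace_comp_le hd M
  rw [trace_sub (subset_traceClass hSm) (hmem s), trace_sum _ fun i _ => subset_traceClass (hP i),
    ContinuousLinearMap.comp_sub, trace_sub (comp_left_mem_traceClass (subset_traceClass hSm) _)
    (comp_left_mem_traceClass (hmem s) _)] at h2
  have h3 : M ∘L ∑ i ∈ s, P i = ∑ i ∈ s, M ∘L P i := by
    ext x; simp
  rw [h3, trace_sum _ fun i _ => comp_left_mem_traceClass (subset_traceClass (hP i)) _,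
    norm_sub_rev] at h2
  simpa using h2

end TraceClass

/-! ### The trace norm of self-adjoint trace class operators. -/

section TraceNorm

variable {H : Type u} [NormedAddCommGroup H] [InnerProductSpace ℂ H] [CompleteSpace H]

/-- Because `T⁺ T⁻ = 0`, the projection onto the orthogonal complement of `ker T⁺` keeps `T⁺` and
kills `T⁻`. As `traceClass` is defined as a span, without reference to `|T|`, this factorization is
what shows that `T⁺` is trace class. -/
theorem exists_posPart_eq_comp {T : H →L[ℂ] H} (hT : IsSelfAdjoint T) :
    ∃ Q : H →L[ℂ] H, ‖Q‖ ≤ 1 ∧ T⁺ = Q ∘L T := by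
  refine ⟨(T⁺.ker)ᗮ.starProjection, Submodule.starProjection_norm_le _, ?_⟩
  have hsa : (T⁺).adjoint = T⁺ := adjoint_eq_of_nonneg (CFC.posPart_nonneg T)
  have h1 : ∀ x, (T⁺.ker)ᗮ.starProjection (T⁺ x) = T⁺ x := fun x => by
    rw [Submodule.starProjection_eq_self_iff, Submodule.mem_orthogonal]
    intro u hu
    rw [← ContinuousLinearMap.adjoint_inner_left, hsa,
      show T⁺ u = 0 from hu, inner_zero_left]
  have h2 : ∀ x, (T⁺.ker)ᗮ.starProjection (T⁻ x) = 0 := fun x => by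
    rw [Submodule.starProjection_apply_eq_zero_iff, Submodule.mem_orthogonal]
    intro u hu
    refine inner_eq_zero_symm.1 (hu _ ?_)
    rw [LinearMap.mem_ker]
    exact congr($(CFC.posPart_mul_negPart T) x)
  ext x
  have h3 : T x = T⁺ x - T⁻ x := congr($((CFC.posPart_sub_negPart T hT).symm) x)
  rw [ContinuousLinearMap.comp_apply, h3, map_sub, h1, h2, sub_zero]

theorem posPart_mem {T : H →L[ℂ] H} (hT : T ∈ traceClass H) (hsa : IsSelfAdjoint T) :
    T⁺ ∈ positiveFiniteTrace H := by
  obtain ⟨Q, -, hQ⟩ := exists_posPart_eq_comp hsa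
  refine mem_positiveFiniteTrace_iff.2 ⟨CFC.posPart_nonneg T, ?_⟩
  rw [hQ]
  exact comp_left_mem_traceClass hT Q

theorem negPart_mem {T : H →L[ℂ] H} (hT : T ∈ traceClass H) (hsa : IsSelfAdjoint T) :
    T⁻ ∈ positiveFiniteTrace H := by
  refine mem_positiveFiniteTrace_iff.2 ⟨CFC.negPart_nonneg T, ?_⟩
  have : T⁻ = T⁺ - T := by
    nth_rw 3 [← CFC.posPart_sub_negPart T hsa]
    abel
  rw [this]
  exact sub_mem (subset_traceClass (posPart_mem hT hsa)) hT

theorem traceNorm_eq {T : H →L[ℂ] H} (hT : T ∈ traceClass H) (hsa : IsSelfAdjoint T) :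
    traceNorm T = (trace T⁺).re + (trace T⁻).re := by
  rw [traceNorm, ← CFC.posPart_add_negPart T hsa,
    trace_add (subset_traceClass (posPart_mem hT hsa)) (subset_traceClass (negPart_mem hT hsa)),
    Complex.add_re]

/-- Hölder's inequality for the trace norm and the operator norm. -/
theorem norm_trace_comp_le_traceNorm {T : H →L[ℂ] H} (hT : T ∈ traceClass H)
    (hsa : IsSelfAdjoint T) (M : H →L[ℂ] H) : ‖trace (M ∘L T)‖ ≤ ‖M‖ * traceNorm T := by
  have hp := posPart_mem hT hsa
  have hn := negPart_mem hT hsa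
  rw [traceNorm_eq hT hsa]
  conv_lhs => rw [← CFC.posPart_sub_negPart T hsa]
  rw [ContinuousLinearMap.comp_sub, trace_sub (comp_left_mem_traceClass (subset_traceClass hp) M)
    (comp_left_mem_traceClass (subset_traceClass hn) M), mul_add]
  exact (norm_sub_le _ _).trans
    (add_le_add (norm_trace_comp_le hp M) (norm_trace_comp_le hn M))

/-- The trace norm of `T = P - Q` is `2 tr T⁺ - tr T`, and `tr T⁺ = tr (E T)` is at most `tr P + tr
Q`. The constant 3 is not sharp; `State.separable_of_hasSum` needs only that small traces give a
small norm. -/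
theorem traceNorm_sub_le {P Q : H →L[ℂ] H} (hP : P ∈ positiveFiniteTrace H)
    (hQ : Q ∈ positiveFiniteTrace H) :
    traceNorm (P - Q) ≤ 3 * ((trace P).re + (trace Q).re) := by
  have hT : P - Q ∈ traceClass H := sub_mem (subset_traceClass hP) (subset_traceClass hQ)
  have hsa : IsSelfAdjoint (P - Q) :=
    (IsSelfAdjoint.of_nonneg hP.1).sub (IsSelfAdjoint.of_nonneg hQ.1)
  obtain ⟨E, hE, hE'⟩ := exists_posPart_eq_comp hsa
  set T := P - Q with hTdef
  have h1 : (trace T⁺).re + (trace T⁻).re = 2 * (trace (E ∘L T)).re - (trace T).re := by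
    have : trace T = trace T⁺ - trace T⁻ := by
      rw [← trace_sub (subset_traceClass (posPart_mem hT hsa))
        (subset_traceClass (negPart_mem hT hsa)), CFC.posPart_sub_negPart T hsa]
    rw [this, ← hE', Complex.sub_re]
    ring
  have h2 : trace (E ∘L T) = trace (E ∘L P) - trace (E ∘L Q) := by
    rw [hTdef, ContinuousLinearMap.comp_sub,
      trace_sub (comp_left_mem_traceClass (subset_traceClass hP) E)
      (comp_left_mem_traceClass (subset_traceClass hQ) E)]
  have h3 : trace T = trace P - trace Q := trace_sub (subset_traceClass hP) (subset_traceClass hQ)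
  have hp0 := trace_re_nonneg hP.1
  have hq0 := trace_re_nonneg hQ.1
  have hEP := (norm_trace_comp_le hP E).trans (mul_le_of_le_one_left hp0 hE)
  have hEQ := (norm_trace_comp_le hQ E).trans (mul_le_of_le_one_left hq0 hE)
  have h4 := (Complex.abs_re_le_norm _).trans hEP
  have h5 := (Complex.abs_re_le_norm _).trans hEQ
  rw [traceNorm_eq hT hsa, h1, h2, h3, Complex.sub_re, Complex.sub_re]
  linarith [le_abs_self (trace (E ∘L P)).re, neg_abs_le (trace (E ∘L Q)).re]

end TraceNorm

/-! ### Hilbert space tensor products, the operators `X ⊗ 1` and `1 ⊗ Y`, partial traces. -/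

section Tensor

variable {H : Type u} [NormedAddCommGroup H] [InnerProductSpace ℂ H] [CompleteSpace H]
variable {K : Type v} [NormedAddCommGroup K] [InnerProductSpace ℂ K] [CompleteSpace K]
variable {ι κ : Type*}

@[simp]
theorem inner_tmul_tmul (x x' : H) (y y' : K) :
    ⟪tmul x y, tmul x' y'⟫_ℂ = ⟪x, x'⟫_ℂ * ⟪y, y'⟫_ℂ := by
  simp [tmul, UniformSpace.Completion.inner_coe]

@[simp]
theorem tensorLeft_apply (x : H) (y : K) : tensorLeft K x y = tmul x y := rfl

@[simp]
theorem tensorRight_apply (x : H) (y : K) : tensorRight H y x = tmul x y := rfl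

@[simp]
theorem adjoint_tensorLeft_tmul (x x' : H) (y : K) :
    (tensorLeft K x).adjoint (tmul x' y) = ⟪x, x'⟫_ℂ • y := by
  refine ext_inner_left ℂ fun z => ?_
  rw [ContinuousLinearMap.adjoint_inner_right, tensorLeft_apply, inner_tmul_tmul, inner_smul_right]

@[simp]
theorem adjoint_tensorRight_tmul (x : H) (y y' : K) :
    (tensorRight H y).adjoint (tmul x y') = ⟪y, y'⟫_ℂ • x := by
  refine ext_inner_left ℂ fun z => ?_
  rw [ContinuousLinearMap.adjoint_inner_right, tensorRight_apply, inner_tmul_tmul,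
    inner_smul_right, mul_comm]

theorem dense_span_tmul :
    (Submodule.span ℂ (Set.range fun p : H × K => tmul p.1 p.2)).topologicalClosure = ⊤ := by
  rw [← Submodule.dense_iff_topologicalClosure_eq_top]
  have hd : DenseRange ((↑) : H ⊗[ℂ] K → HTensor H K) := UniformSpace.Completion.denseRange_coe
  refine hd.mono ?_
  rintro _ ⟨z, rfl⟩
  induction z using TensorProduct.induction_on with
  | zero => exact zero_mem (Submodule.span ℂ _)
  | tmul x y => exact Submodule.subset_span ⟨(x, y), rfl⟩
  | add a b ha hb =>
    rw [UniformSpace.Completion.coe_add]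
    exact add_mem (S := Submodule ℂ (HTensor H K)) ha hb

theorem tensor_clm_ext {E : Type*} [NormedAddCommGroup E] [NormedSpace ℂ E]
    {A B : HTensor H K →L[ℂ] E} (h : ∀ x y, A (tmul x y) = B (tmul x y)) : A = B := by
  refine ContinuousLinearMap.ext_on (s := Set.range fun p : H × K => tmul p.1 p.2) ?_ ?_
  · rw [Submodule.dense_iff_topologicalClosure_eq_top]
    exact dense_span_tmul
  · rintro _ ⟨p, rfl⟩
    exact h _ _

theorem eq_zero_of_inner_tmul {z : HTensor H K} (h : ∀ x y, ⟪z, tmul x y⟫_ℂ = 0) : z = 0 := by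
  have : innerSL ℂ z = 0 := tensor_clm_ext fun x y => by simpa using h x y
  simpa using congr($this z)

/-- The product of two Hilbert bases. -/
noncomputable def tensorBasis (b : HilbertBasis ι ℂ H) (c : HilbertBasis κ ℂ K) :
    HilbertBasis (ι × κ) ℂ (HTensor H K) :=
  HilbertBasis.mkOfOrthogonalEqBot (v := fun p : ι × κ => tmul (b p.1) (c p.2))
    (by
      classical
      rw [orthonormal_iff_ite]
      intro p q
      rw [inner_tmul_tmul, orthonormal_iff_ite.1 b.orthonormal, orthonormal_iff_ite.1 c.orthonormal]
      simp only [Prod.ext_iff]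
      split_ifs <;> simp_all)
    (by
      rw [Submodule.eq_bot_iff]
      intro z hz
      rw [Submodule.mem_orthogonal'] at hz
      -- Orthogonality to every `b i ⊗ c j` extends to every `b i ⊗ y` by density of the span of
      -- `c`, then to every `x ⊗ y` by density of the span of `b`.
      have h1 : ∀ i, (innerSL ℂ z) ∘L tensorLeft K (b i) = 0 := fun i => by
        refine ContinuousLinearMap.ext_on (s := Set.range c) ?_ ?_
        · rw [Submodule.dense_iff_topologicalClosure_eq_top]
          exact c.dense_span
        · rintro _ ⟨j, rfl⟩
          exact hz _ (Submodule.subset_span ⟨(i, j), rfl⟩)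
      have h2 : ∀ y, (innerSL ℂ z) ∘L tensorRight H y = 0 := fun y => by
        refine ContinuousLinearMap.ext_on (s := Set.range b) ?_ ?_
        · rw [Submodule.dense_iff_topologicalClosure_eq_top]
          exact b.dense_span
        · rintro _ ⟨i, rfl⟩
          exact congr($(h1 i) y)
      exact eq_zero_of_inner_tmul fun x y => congr($(h2 y) x))

@[simp]
theorem tensorBasis_apply (b : HilbertBasis ι ℂ H) (c : HilbertBasis κ ℂ K) (p : ι × κ) :
    tensorBasis b c p = tmul (b p.1) (c p.2) := by
  simp [tensorBasis]

/-- Bounded operators are linear combinations of unitaries, and a unitary acts isometrically on the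
algebraic tensor product. This gives the boundedness of `X ⊗ 1` needed to extend it to the
completion. -/
theorem exists_bound_map {E : Type*} [NormedAddCommGroup E] [NormedSpace ℂ E]
    (f : (H →L[ℂ] H) →ₗ[ℂ] E →ₗ[ℂ] E)
    (hf : ∀ U ∈ unitary (H →L[ℂ] H), ∀ z, ‖f U z‖ = ‖z‖) (X : H →L[ℂ] H) :
    ∃ C, ∀ z, ‖f X z‖ ≤ C * ‖z‖ := by
  have hX : X ∈ Submodule.span ℂ (unitary (H →L[ℂ] H) : Set (H →L[ℂ] H)) := by
    rw [CStarAlgebra.span_unitary]; trivial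
  induction hX using Submodule.span_induction with
  | mem U hU => exact ⟨1, fun z => by rw [hf U hU, one_mul]⟩
  | zero => exact ⟨0, by simp⟩
  | add X Y _ _ hX hY =>
    obtain ⟨C, hC⟩ := hX
    obtain ⟨D, hD⟩ := hY
    refine ⟨C + D, fun z => ?_⟩
    rw [map_add, LinearMap.add_apply, add_mul]
    exact (norm_add_le _ _).trans (add_le_add (hC z) (hD z))
  | smul a X _ hX =>
    obtain ⟨C, hC⟩ := hX
    refine ⟨‖a‖ * C, fun z => ?_⟩
    rw [map_smul, LinearMap.smul_apply, norm_smul, mul_assoc]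
    gcongr
    exact hC z

theorem norm_rTensor_unitary {U : H →L[ℂ] H} (hU : U ∈ unitary (H →L[ℂ] H)) (z : H ⊗[ℂ] K) :
    ‖LinearMap.rTensor K (U : H →ₗ[ℂ] H) z‖ = ‖z‖ :=
  LinearIsometry.norm_map (LinearIsometry.rTensor K
    (⟨(U : H →ₗ[ℂ] H), fun x => ContinuousLinearMap.norm_map_of_mem_unitary hU x⟩ :
      H →ₗᵢ[ℂ] H)) z

theorem norm_lTensor_unitary {U : K →L[ℂ] K} (hU : U ∈ unitary (K →L[ℂ] K)) (z : H ⊗[ℂ] K) :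
    ‖LinearMap.lTensor H (U : K →ₗ[ℂ] K) z‖ = ‖z‖ :=
  LinearIsometry.norm_map (LinearIsometry.lTensor H
    (⟨(U : K →ₗ[ℂ] K), fun x => ContinuousLinearMap.norm_map_of_mem_unitary hU x⟩ :
      K →ₗᵢ[ℂ] K)) z

theorem exists_extension (f : (H ⊗[ℂ] K) →ₗ[ℂ] (H ⊗[ℂ] K)) (hf : ∃ C, ∀ z, ‖f z‖ ≤ C * ‖z‖) :
    ∃ A : HTensor H K →L[ℂ] HTensor H K, ∀ z : H ⊗[ℂ] K, A (z : HTensor H K) = f z := by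
  refine ⟨(UniformSpace.Completion.toComplL ∘L f.mkContinuousOfExistsBound hf).extend
    (UniformSpace.Completion.toComplL (𝕜 := ℂ) (E := H ⊗[ℂ] K)), fun z => ?_⟩
  exact ContinuousLinearMap.extend_eq _ UniformSpace.Completion.denseRange_coe
    (UniformSpace.Completion.isUniformInducing_coe _) z

variable (K) in
theorem exists_ampLeft (X : H →L[ℂ] H) :
    ∃ A : HTensor H K →L[ℂ] HTensor H K, ∀ x y, A (tmul x y) = tmul (X x) y := by
  have hf : ∀ U ∈ unitary (H →L[ℂ] H), ∀ z : H ⊗[ℂ] K,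
      ‖((LinearMap.rTensorHom K).comp (ContinuousLinearMap.coeLM ℂ)) U z‖ = ‖z‖ := by
    intro U hU z
    rw [LinearMap.comp_apply]
    exact norm_rTensor_unitary hU z
  obtain ⟨A, hA⟩ := exists_extension _ (exists_bound_map _ hf X)
  exact ⟨A, fun x y => by simpa [tmul] using hA (x ⊗ₜ[ℂ] y)⟩

variable (H) in
theorem exists_ampRight (Y : K →L[ℂ] K) :
    ∃ A : HTensor H K →L[ℂ] HTensor H K, ∀ x y, A (tmul x y) = tmul x (Y y) := by
  have hf : ∀ U ∈ unitary (K →L[ℂ] K), ∀ z : H ⊗[ℂ] K,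
      ‖((LinearMap.lTensorHom H).comp (ContinuousLinearMap.coeLM ℂ)) U z‖ = ‖z‖ := by
    intro U hU z
    rw [LinearMap.comp_apply]
    exact norm_lTensor_unitary hU z
  obtain ⟨A, hA⟩ := exists_extension _ (exists_bound_map _ hf Y)
  exact ⟨A, fun x y => by simpa [tmul] using hA (x ⊗ₜ[ℂ] y)⟩

variable (K) in
/-- The operator `X ⊗ 1`. -/
noncomputable def ampLeft (X : H →L[ℂ] H) : HTensor H K →L[ℂ] HTensor H K :=
  (exists_ampLeft K X).choose

variable (H) in
/-- The operator `1 ⊗ Y`. -/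
noncomputable def ampRight (Y : K →L[ℂ] K) : HTensor H K →L[ℂ] HTensor H K :=
  (exists_ampRight H Y).choose

@[simp]
theorem ampLeft_tmul (X : H →L[ℂ] H) (x : H) (y : K) :
    ampLeft K X (tmul x y) = tmul (X x) y :=
  (exists_ampLeft K X).choose_spec x y

@[simp]
theorem ampRight_tmul (Y : K →L[ℂ] K) (x : H) (y : K) :
    ampRight H Y (tmul x y) = tmul x (Y y) :=
  (exists_ampRight H Y).choose_spec x y

theorem ampLeft_comp (X Y : H →L[ℂ] H) : ampLeft K (X ∘L Y) = ampLeft K X ∘L ampLeft K Y :=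
  tensor_clm_ext fun x y => by simp

theorem ampRight_comp (X Y : K →L[ℂ] K) : ampRight H (X ∘L Y) = ampRight H X ∘L ampRight H Y :=
  tensor_clm_ext fun x y => by simp

theorem ampLeft_comp_ampRight (X : H →L[ℂ] H) (Y : K →L[ℂ] K) :
    ampLeft K X ∘L ampRight H Y = ampRight H Y ∘L ampLeft K X :=
  tensor_clm_ext fun x y => by simp

theorem tensor_ext_inner {A B : HTensor H K →L[ℂ] HTensor H K}
    (h : ∀ x y x' y', ⟪A (tmul x y), tmul x' y'⟫_ℂ = ⟪B (tmul x y), tmul x' y'⟫_ℂ) : A = B :=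
  tensor_clm_ext fun x y => sub_eq_zero.1 <| eq_zero_of_inner_tmul fun x' y' => by
    rw [inner_sub_left, h, sub_self]

theorem adjoint_ampLeft (X : H →L[ℂ] H) : (ampLeft K X).adjoint = ampLeft K X.adjoint :=
  tensor_ext_inner fun x y x' y' => by
    simp [ContinuousLinearMap.adjoint_inner_left]

theorem adjoint_ampRight (Y : K →L[ℂ] K) : (ampRight H Y).adjoint = ampRight H Y.adjoint :=
  tensor_ext_inner fun x y x' y' => by
    simp [ContinuousLinearMap.adjoint_inner_left]

theorem comp_adjoint_tensorRight (M : H →L[ℂ] H) (y : K) :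
    M ∘L (tensorRight H y).adjoint = (tensorRight H y).adjoint ∘L ampLeft K M :=
  tensor_clm_ext fun x y' => by simp

theorem comp_adjoint_tensorLeft (M : K →L[ℂ] K) (x : H) :
    M ∘L (tensorLeft K x).adjoint = (tensorLeft K x).adjoint ∘L ampRight H M :=
  tensor_clm_ext fun x y' => by simp

theorem hasSum_trace_tensor {T : HTensor H K →L[ℂ] HTensor H K} (hT : T ∈ traceClass (HTensor H K))
    (b : HilbertBasis ι ℂ H) (c : HilbertBasis κ ℂ K) :
    HasSum (fun p : ι × κ => ⟪tmul (b p.1) (c p.2), T (tmul (b p.1) (c p.2))⟫_ℂ) (trace T) := by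
  simpa using hasSum_trace hT (tensorBasis b c)

theorem hasSum_trace_tensorRight {T : HTensor H K →L[ℂ] HTensor H K}
    (hT : T ∈ traceClass (HTensor H K)) (c : HilbertBasis κ ℂ K) :
    HasSum (fun j => trace ((tensorRight H (c j)).adjoint ∘L T ∘L tensorRight H (c j)))
      (trace T) := by
  have h := (Equiv.prodComm _ _).hasSum_iff.2 (hasSum_trace_tensor hT (onb H) c)
  refine h.prod_fiberwise fun j => ?_
  have := hasSum_trace (traceClass_compress hT (tensorRight H (c j)) (tensorRight H (c j))) (onb H)
  simpa [ContinuousLinearMap.adjoint_inner_right] using this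

theorem hasSum_trace_tensorLeft {T : HTensor H K →L[ℂ] HTensor H K}
    (hT : T ∈ traceClass (HTensor H K)) (b : HilbertBasis ι ℂ H) :
    HasSum (fun i => trace ((tensorLeft K (b i)).adjoint ∘L T ∘L tensorLeft K (b i)))
      (trace T) := by
  refine (hasSum_trace_tensor hT b (onb K)).prod_fiberwise fun i => ?_
  have := hasSum_trace (traceClass_compress hT (tensorLeft K (b i)) (tensorLeft K (b i))) (onb K)
  simpa [ContinuousLinearMap.adjoint_inner_right] using this

/-- The partial trace over the second factor is dual to `M ↦ M ⊗ 1`. -/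
theorem partialTrace₂_spec {T : HTensor H K →L[ℂ] HTensor H K}
    (hT : T ∈ positiveFiniteTrace (HTensor H K)) :
    partialTrace₂ T ∈ positiveFiniteTrace H ∧
      ∀ M : H →L[ℂ] H, trace (M ∘L partialTrace₂ T) = trace (ampLeft K M ∘L T) := by
  have hTt := subset_traceClass hT
  obtain ⟨S, hS, hsum, htr⟩ := exists_hasSum_positive
    (fun j => positiveFiniteTrace_compress hT (tensorRight H (onb K j)))
    (Complex.hasSum_re (hasSum_trace_tensorRight hTt (onb K))).summable
  have e : partialTrace₂ T = S := hsum.tsum_eq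
  refine ⟨e ▸ hS, fun M => ?_⟩
  have h := hasSum_trace_tensorRight (comp_left_mem_traceClass hTt (ampLeft K M)) (onb K)
  rw [e]
  refine (htr M).unique ?_
  convert h using 3 with j
  simp only [← ContinuousLinearMap.comp_assoc, comp_adjoint_tensorRight]

/-- The partial trace over the first factor is dual to `M ↦ 1 ⊗ M`. -/
theorem partialTrace₁_spec {T : HTensor H K →L[ℂ] HTensor H K}
    (hT : T ∈ positiveFiniteTrace (HTensor H K)) :
    partialTrace₁ T ∈ positiveFiniteTrace K ∧
      ∀ M : K →L[ℂ] K, trace (M ∘L partialTrace₁ T) = trace (ampRight H M ∘L T) := by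
  have hTt := subset_traceClass hT
  obtain ⟨S, hS, hsum, htr⟩ := exists_hasSum_positive
    (fun j => positiveFiniteTrace_compress hT (tensorLeft K (onb H j)))
    (Complex.hasSum_re (hasSum_trace_tensorLeft hTt (onb H))).summable
  have e : partialTrace₁ T = S := hsum.tsum_eq
  refine ⟨e ▸ hS, fun M => ?_⟩
  have h := hasSum_trace_tensorLeft (comp_left_mem_traceClass hTt (ampRight H M)) (onb H)
  rw [e]
  refine (htr M).unique ?_
  convert h using 3 with j
  simp only [← ContinuousLinearMap.comp_assoc, comp_adjoint_tensorLeft]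

end Tensor

/-! ### Joint diagonalization of commuting compact self-adjoint operators. -/

section Spectral

variable {H : Type u} [NormedAddCommGroup H] [InnerProductSpace ℂ H] [CompleteSpace H]

theorem isCompactOperator_rankOne (x y : H) :
    IsCompactOperator (InnerProductSpace.rankOne ℂ x y : H →L[ℂ] H) := by
  rw [InnerProductSpace.rankOne_def']
  have h : IsCompactOperator (innerSL ℂ y) := isCompactOperator_of_locallyCompactSpace_dom _
  exact h.clm_comp (ContinuousLinearMap.toSpanSingleton ℂ x)

theorem rankOne_mem (x : H) : InnerProductSpace.rankOne ℂ x x ∈ positiveFiniteTrace H := by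
  refine ⟨(ContinuousLinearMap.nonneg_iff_isPositive _).2
    (InnerProductSpace.isPositive_rankOne_self x), ?_⟩
  have := (onb H).hasSum_inner_mul_inner x x
  refine this.summable.congr fun i => ?_
  simp

theorem trace_rankOne (x y : H) : trace (InnerProductSpace.rankOne ℂ x y) = ⟪y, x⟫_ℂ := by
  simpa using trace_comp_rankOne (.id ℂ H) y x

/-- `P` is the norm convergent sum of the rank-one operators `|√P eᵢ⟩⟨√P eᵢ|`. -/
theorem isCompactOperator_of_positiveFiniteTrace {P : H →L[ℂ] H}
    (hP : P ∈ positiveFiniteTrace H) : IsCompactOperator P := by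
  set u := fun i => CFC.sqrt P (onb H i)
  obtain ⟨S, hS, hsum, -⟩ := exists_hasSum_positive (fun i => rankOne_mem (u i)) (by
    simp only [trace_rankOne, inner_self_eq_norm_sq_to_K]
    simpa [u, ← Complex.ofReal_pow] using (hasSum_norm_sqrt_sq hP (onb H)).summable)
  have e : S = P := by
    ext y
    refine ext_inner_left ℂ fun x => ?_
    have h1 : HasSum (fun i => ⟪x, InnerProductSpace.rankOne ℂ (u i) (u i) y⟫_ℂ) ⟪x, S y⟫_ℂ :=
      (hsum.mapL ((ContinuousLinearMap.apply ℂ H y))).mapL (innerSL ℂ x)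
    have h2 := (onb H).hasSum_inner_mul_inner (CFC.sqrt P x) (CFC.sqrt P y)
    have h3 : ∀ x y, ⟪CFC.sqrt P x, y⟫_ℂ = ⟪x, CFC.sqrt P y⟫_ℂ := fun x y => by
      rw [← ContinuousLinearMap.adjoint_inner_right, adjoint_sqrt]
    rw [h3, ← ContinuousLinearMap.comp_apply, sqrt_comp_sqrt hP.1] at h2
    simp only [h3] at h2
    simp only [InnerProductSpace.rankOne_apply, inner_smul_right] at h1
    refine h1.unique ?_
    simp only [u, h3, mul_comm ⟪onb H _, CFC.sqrt P y⟫_ℂ]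
    exact h2
  rw [← e]
  refine isCompactOperator_of_tendsto (hsum : Tendsto _ _ _) (Eventually.of_forall fun s => ?_)
  exact Submodule.sum_mem (compactOperator (RingHom.id ℂ) H H)
    fun i _ => isCompactOperator_rankOne (u i) (u i)

/-- If some `T₀` in the family is nonzero on `W`, its restriction has a nonzero eigenvalue, whose
eigenspace is finite-dimensional and invariant under the whole family; simultaneous diagonalization
there gives the vector. Otherwise any nonzero vector of `W` works, with all eigenvalues zero. -/
theorem exists_joint_eigenvector {S : Set (H →L[ℂ] H)} (hc : ∀ T ∈ S, IsCompactOperator T)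
    (hs : ∀ T ∈ S, T.IsSymmetric) (hcomm : ∀ T ∈ S, ∀ T' ∈ S, T ∘L T' = T' ∘L T)
    {W : Submodule ℂ H} (hW : IsClosed (W : Set H)) (hW0 : W ≠ ⊥)
    (hinv : ∀ T ∈ S, ∀ x ∈ W, T x ∈ W) :
    ∃ v ∈ W, v ≠ 0 ∧ ∀ T ∈ S, ∃ c : ℂ, T v = c • v := by
  by_cases h0 : ∀ T ∈ S, ∀ x ∈ W, T x = 0
  · obtain ⟨v, hv, hv0⟩ := W.ne_bot_iff.1 hW0
    exact ⟨v, hv, hv0, fun T hT => ⟨0, by simp [h0 T hT v hv]⟩⟩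
  push Not at h0
  obtain ⟨T₀, hT₀, x₀, hx₀, hne⟩ := h0
  have : CompleteSpace W := hW.completeSpace_coe
  set R : W →L[ℂ] W := T₀.restrict (hinv T₀ hT₀) with hR
  have hRc : IsCompactOperator R := (hc T₀ hT₀).restrict' (hinv T₀ hT₀)
  have hRs : R.IsSymmetric := (hs T₀ hT₀).restrict_invariant (hinv T₀ hT₀)
  have hR0 : R ≠ 0 := fun h => hne (congrArg Subtype.val congr($h ⟨x₀, hx₀⟩))
  obtain ⟨μ, hμ, hμ0⟩ : ∃ μ, Module.End.HasEigenvalue (R : Module.End ℂ W) μ ∧ μ ≠ 0 := by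
    by_contra! hcon
    exact hR0 ((ContinuousLinearMap.eq_zero_of_forall_hasEigenvalue_eq_zero hRc hRs).1 hcon)
  obtain ⟨⟨z, hzW⟩, hz, hz0⟩ := hμ.exists_hasEigenvector
  rw [Module.End.mem_eigenspace_iff] at hz
  set V : Submodule ℂ H := Module.End.eigenspace (T₀ : Module.End ℂ H) μ ⊓ W with hV
  have : FiniteDimensional ℂ (Module.End.eigenspace (T₀ : Module.End ℂ H) μ) :=
    ContinuousLinearMap.finite_dimensional_eigenspace (hc T₀ hT₀) μ hμ0
  have : FiniteDimensional ℂ V := Submodule.finiteDimensional_of_le inf_le_left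
  have hzV : z ∈ V := ⟨Module.End.mem_eigenspace_iff.2 (congrArg Subtype.val hz), hzW⟩
  have hz0' : z ≠ 0 := fun h => hz0 (Subtype.ext h)
  have hVinv : ∀ T ∈ S, ∀ x ∈ V, T x ∈ V := fun T hT x hx => by
    refine ⟨Module.End.mem_eigenspace_iff.2 ?_, hinv T hT x hx.2⟩
    have h1 : T₀ x = μ • x := Module.End.mem_eigenspace_iff.1 hx.1
    have h2 : T₀ (T x) = T (T₀ x) := congr($(hcomm T₀ hT₀ T hT) x)
    simpa [h1] using h2
  let F : S → V →ₗ[ℂ] V := fun T => (T.1 : H →ₗ[ℂ] H).restrict (hVinv T.1 T.2)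
  have hF := LinearMap.IsSymmetric.iSup_iInf_eq_top_of_commute (T := F)
    (fun T => (hs T.1 T.2).restrict_invariant (hVinv T.1 T.2))
    (fun T T' _ => LinearMap.ext fun x => Subtype.ext congr($(hcomm T.1 T.2 T'.1 T'.2) x))
  obtain ⟨χ, hχ⟩ : ∃ χ : S → ℂ, (⨅ i, Module.End.eigenspace (F i) (χ i)) ≠ ⊥ := by
    by_contra! hcon
    simp only [hcon, iSup_bot] at hF
    have : (⟨z, hzV⟩ : V) ∈ (⊥ : Submodule ℂ V) := hF ▸ Submodule.mem_top
    exact hz0' (congrArg Subtype.val ((Submodule.mem_bot ℂ).1 this))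
  obtain ⟨v, hv, hv0⟩ := (Submodule.ne_bot_iff _).1 hχ
  refine ⟨v, v.2.2, fun h => hv0 (Subtype.ext h), fun T hT => ⟨χ ⟨T, hT⟩, ?_⟩⟩
  have := Module.End.mem_eigenspace_iff.1 ((Submodule.mem_iInf _).1 hv ⟨T, hT⟩)
  exact congrArg Subtype.val this

/-- Orthonormal vectors are at distance `√2`, so the balls of radius `1/2` around them are disjoint
open sets. -/
theorem countable_of_orthonormal [TopologicalSpace.SeparableSpace H] {A : Set H}
    (hA : Orthonormal ℂ ((↑) : A → H)) : A.Countable := by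
  refine Set.PairwiseDisjoint.countable_of_isOpen (s := fun v : H => Metric.ball v 2⁻¹) ?_
    (fun _ _ => Metric.isOpen_ball) (fun v _ => ⟨v, Metric.mem_ball_self (by norm_num)⟩)
  intro v hv w hw hne
  refine Metric.ball_disjoint_ball ?_
  have h0 : ⟪v, w⟫_ℂ = 0 := hA.2 (i := ⟨v, hv⟩) (j := ⟨w, hw⟩) fun h => hne (congrArg Subtype.val h)
  have h1 : ‖v - w‖ ^ 2 = 2 := by
    have := norm_sub_sq (𝕜 := ℂ) v w
    have hv1 : ‖v‖ = 1 := hA.1 ⟨v, hv⟩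
    have hw1 : ‖w‖ = 1 := hA.1 ⟨w, hw⟩
    rw [h0, hv1, hw1] at this
    norm_num at this
    exact this
  rw [dist_eq_norm]
  nlinarith [norm_nonneg (v - w)]

/-- Commuting compact self-adjoint operators on a separable space have a joint eigenbasis. -/
theorem exists_joint_eigenbasis [TopologicalSpace.SeparableSpace H] {S : Set (H →L[ℂ] H)}
    (hc : ∀ T ∈ S, IsCompactOperator T) (hs : ∀ T ∈ S, T.IsSymmetric)
    (hcomm : ∀ T ∈ S, ∀ T' ∈ S, T ∘L T' = T' ∘L T) :
    ∃ (ι : Type) (_ : Countable ι) (b : HilbertBasis ι ℂ H), ∀ T ∈ S, ∀ i, ∃ c : ℂ,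
      T (b i) = c • b i := by
  -- A maximal orthonormal set of joint eigenvectors spans a dense subspace: its orthogonal
  -- complement is invariant, and a joint eigenvector in it could be added to the set.
  obtain ⟨A, -, hA⟩ := zorn_subset_nonempty
    {A : Set H | (∀ v ∈ A, ‖v‖ = 1 ∧ ∀ T ∈ S, ∃ c : ℂ, T v = c • v) ∧
      A.Pairwise fun v w => ⟪v, w⟫_ℂ = 0}
    (by
      refine fun c hc cc _ => ⟨⋃₀ c, ⟨?_, ?_⟩, fun _ => Set.subset_sUnion_of_mem⟩
      · rintro v ⟨B, hB, hv⟩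
        exact (hc hB).1 v hv
      · exact (Set.pairwise_sUnion cc.directedOn).2 fun B hB => (hc hB).2)
    ∅ ⟨by simp, by simp⟩
  obtain ⟨⟨hA1, hA2⟩, hmax⟩ := hA
  have hort : Orthonormal ℂ ((↑) : A → H) :=
    ⟨fun v => (hA1 v v.2).1, fun v w hvw => hA2 v.2 w.2 fun h => hvw (Subtype.ext h)⟩
  have hbot : (Submodule.span ℂ A)ᗮ = ⊥ := by
    by_contra hne
    obtain ⟨v, hv, hv0, hvS⟩ := exists_joint_eigenvector hc hs hcomm
      (Submodule.isClosed_orthogonal _) hne (fun T hT x hx => by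
        rw [Submodule.mem_orthogonal] at hx ⊢
        intro y hy
        induction hy using Submodule.span_induction with
        | mem y hy =>
          obtain ⟨c, hcy⟩ := (hA1 y hy).2 T hT
          refine (hs T hT y x).symm.trans ?_
          change ⟪T y, x⟫_ℂ = 0
          rw [hcy, inner_smul_left, hx y (Submodule.subset_span hy), mul_zero]
        | zero => simp
        | add y z _ _ hy hz => rw [inner_add_left, hy, hz, add_zero]
        | smul a y _ hy => rw [inner_smul_left, hy, mul_zero])
    have hn : ‖v‖ ≠ 0 := norm_ne_zero_iff.2 hv0
    set w : H := ((‖v‖⁻¹ : ℝ) : ℂ) • v with hw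
    have hw1 : ‖w‖ = 1 := by
      rw [hw, norm_smul]
      simp [hn]
    have hort : ∀ y ∈ A, ⟪y, w⟫_ℂ = 0 := fun y hy => by
      rw [hw, inner_smul_right, (Submodule.mem_orthogonal _ _).1 hv y (Submodule.subset_span hy),
        mul_zero]
    have hwA : w ∈ A := by
      refine hmax (y := insert w A) ⟨?_, ?_⟩ (Set.subset_insert _ _) (Set.mem_insert _ _)
      · rintro y (rfl | hy)
        · refine ⟨hw1, fun T hT => ?_⟩
          obtain ⟨c, hcv⟩ := hvS T hT
          exact ⟨c, by rw [hw, map_smul, hcv, smul_comm]⟩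
        · exact hA1 y hy
      · refine Set.pairwise_insert.2
          ⟨hA2, fun y hy _ => ⟨inner_eq_zero_symm.1 (hort y hy), hort y hy⟩⟩
    have h3 := hort w hwA
    rw [inner_self_eq_norm_sq_to_K, hw1] at h3
    norm_num at h3
  have : Countable A := (countable_of_orthonormal hort).to_subtype
  -- Countability lets the index set be moved to `Type`, where outcome spaces are required to live.
  let e := (equivShrink.{0} A).symm
  have hbot' : (Submodule.span ℂ (Set.range fun i => (e i : H)))ᗮ = ⊥ := by
    rw [← hbot]
    congr 2
    ext x
    constructor
    · rintro ⟨i, rfl⟩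
      exact (e i).2
    · exact fun hx => ⟨e.symm ⟨x, hx⟩, by simp⟩
  refine ⟨Shrink.{0} A, e.injective.countable,
    HilbertBasis.mkOfOrthogonalEqBot (hort.comp e e.injective) hbot', fun T hT i => ?_⟩
  rw [HilbertBasis.coe_mkOfOrthogonalEqBot]
  exact (hA1 _ (e i).2).2 T hT

end Spectral

/-! ### The symmetric logarithmic derivative as a bounded operator. -/

section Lyapunov

variable {H : Type u} [NormedAddCommGroup H] [InnerProductSpace ℂ H] [CompleteSpace H]
variable {ι : Type*}

/-- A bounded net of operators has a weak cluster point. -/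
theorem exists_weak_limit (l : Filter ι) [l.NeBot] (X : ι → H →L[ℂ] H) {C : ℝ}
    (hX : ∀ i, ‖X i‖ ≤ C) : ∃ (U : Ultrafilter ι) (Y : H →L[ℂ] H), (U : Filter ι) ≤ l ∧
      ∀ x y, Tendsto (fun i => ⟪X i x, y⟫_ℂ) U (𝓝 ⟪Y x, y⟫_ℂ) := by
  let U := Ultrafilter.of l
  have hb : ∀ i x y, ‖⟪X i x, y⟫_ℂ‖ ≤ C * ‖x‖ * ‖y‖ := fun i x y => by
    refine (norm_inner_le_norm _ _).trans ?_
    gcongr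
    exact ((X i).le_opNorm x).trans (by gcongr; exact hX i)
  -- Each matrix element stays in a compact disc, hence converges along the ultrafilter; the limits
  -- form a bounded sesquilinear form, which defines `Y`.
  have hlim : ∀ x y, ∃ z : ℂ, ‖z‖ ≤ C * ‖x‖ * ‖y‖ ∧
      Tendsto (fun i => ⟪X i x, y⟫_ℂ) U (𝓝 z) := fun x y => by
    obtain ⟨z, hz, hz'⟩ := (isCompact_closedBall (0 : ℂ) (C * ‖x‖ * ‖y‖)).ultrafilter_le_nhds'
      (U.map fun i => ⟪X i x, y⟫_ℂ)
      (Ultrafilter.mem_map.2 (univ_mem' fun i => by simpa using hb i x y))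
    exact ⟨z, by simpa using hz, hz'⟩
  choose B hB hBlim using hlim
  let L : H →L⋆[ℂ] H →L[ℂ] ℂ := LinearMap.mkContinuous₂ (LinearMap.mk₂'ₛₗ _ _ B
    (fun x x' y => tendsto_nhds_unique (hBlim _ _) <| by
      simpa only [map_add, inner_add_left] using (hBlim x y).add (hBlim x' y))
    (fun c x y => tendsto_nhds_unique (hBlim _ _) <| by
      simpa only [map_smul, inner_smul_left] using! (hBlim x y).const_mul (starRingEnd ℂ c))
    (fun x y y' => tendsto_nhds_unique (hBlim _ _) <| by
      simpa only [inner_add_right] using (hBlim x y).add (hBlim x y'))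
    (fun c x y => tendsto_nhds_unique (hBlim _ _) <| by
      simpa only [inner_smul_right] using! (hBlim x y).const_mul c)) C hB
  refine ⟨U, InnerProductSpace.continuousLinearMapOfBilin L, Ultrafilter.of_le l, fun x y => ?_⟩
  rw [InnerProductSpace.continuousLinearMapOfBilin_apply]
  exact hBlim x y

theorem clm_ext_basis (b : HilbertBasis ι ℂ H) {A B : H →L[ℂ] H}
    (h : ∀ i j, ⟪A (b i), b j⟫_ℂ = ⟪B (b i), b j⟫_ℂ) : A = B := by
  refine ContinuousLinearMap.ext_on (s := Set.range b) ?_ ?_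
  · rw [Submodule.dense_iff_topologicalClosure_eq_top]
    exact b.dense_span
  · rintro _ ⟨i, rfl⟩
    refine b.repr.injective (lp.ext (funext fun j => ?_))
    rw [b.repr_apply_apply, b.repr_apply_apply, ← inner_conj_symm, h, inner_conj_symm]

theorem integral_exp_add {a b : ℝ} (ha : 0 < a) (hb : 0 < b) (z : ℂ) :
    IntegrableOn (fun t : ℝ => (Real.exp (-a * t) * Real.exp (-b * t) : ℂ) * z) (Set.Ioi 0) ∧
    ∫ t in Set.Ioi (0 : ℝ), (Real.exp (-a * t) * Real.exp (-b * t) : ℂ) * z =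
      ((a + b : ℝ) : ℂ)⁻¹ * z := by
  have h : (-((a + b : ℝ) : ℂ)).re < 0 := by simp; linarith
  have e : ∀ t : ℝ, (Real.exp (-a * t) * Real.exp (-b * t) : ℂ) =
      Complex.exp (-((a + b : ℝ) : ℂ) * t) := fun t => by
    rw [← Complex.ofReal_mul, ← Real.exp_add, Complex.ofReal_exp]
    push_cast
    ring_nf
  simp only [e]
  refine ⟨(integrableOn_exp_mul_complex_Ioi h 0).mul_const z, ?_⟩
  rw [integral_mul_const, integral_exp_mul_complex_Ioi h]
  congr 1
  rw [Complex.ofReal_zero, mul_zero, Complex.exp_zero, neg_div_neg_eq, one_div]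

/-- The Cauchy kernel `1 / (aᵢ + aⱼ)` is positive semidefinite as a Schur multiplier. -/
theorem cauchy_schur_nonneg (b : ι → H) {a : ι → ℝ} (ha : ∀ i, 0 ≤ a i) {T : H →L[ℂ] H}
    (hT : 0 ≤ T) (h0 : ∀ i, a i = 0 → T (b i) = 0) (F : Finset ι) (c : ι → ℂ) :
    0 ≤ ∑ i ∈ F, ∑ j ∈ F, ((a i + a j : ℝ) : ℂ)⁻¹ *
      (starRingEnd ℂ (c i) * c j * ⟪b i, T (b j)⟫_ℂ) := by
  classical
  -- Indices with `a i = 0` contribute nothing because `T` kills `b i`. They are removed since the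
  -- integral representation below needs positive exponents.
  have hfilter : ∑ i ∈ F, ∑ j ∈ F, ((a i + a j : ℝ) : ℂ)⁻¹ *
      (starRingEnd ℂ (c i) * c j * ⟪b i, T (b j)⟫_ℂ) =
      ∑ i ∈ F with a i ≠ 0, ∑ j ∈ F with a j ≠ 0, ((a i + a j : ℝ) : ℂ)⁻¹ *
      (starRingEnd ℂ (c i) * c j * ⟪b i, T (b j)⟫_ℂ) := by
    rw [Finset.sum_filter]
    refine Finset.sum_congr rfl fun i _ => ?_
    split_ifs with hi
    · rw [Finset.sum_filter]
      refine Finset.sum_congr rfl fun j _ => ?_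
      split_ifs with hj
      · rfl
      · rw [h0 j (not_not.1 hj), inner_zero_right, mul_zero, mul_zero]
    · refine Finset.sum_eq_zero fun j _ => ?_
      rw [← ContinuousLinearMap.adjoint_inner_left, adjoint_eq_of_nonneg hT, h0 i (not_not.1 hi),
        inner_zero_left, mul_zero, mul_zero]
  rw [hfilter]
  set G := F.filter fun i => a i ≠ 0
  have hpos : ∀ i ∈ G, 0 < a i := fun i hi =>
    lt_of_le_of_ne (ha i) (Ne.symm (Finset.mem_filter.1 hi).2)
  -- As `1 / (a + b)` is the integral of `exp (-a t) exp (-b t)` over `t > 0`, the double sum is the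
  -- integral of `⟪v t, T (v t)⟫`, which is nonnegative.
  let v : ℝ → H := fun t => ∑ i ∈ G, ((Real.exp (-a i * t) : ℂ) * c i) • b i
  have hv : ∀ t, ((‖CFC.sqrt T (v t)‖ ^ 2 : ℝ) : ℂ) = ∑ i ∈ G, ∑ j ∈ G,
      (Real.exp (-a i * t) * Real.exp (-a j * t) : ℂ) *
      (starRingEnd ℂ (c i) * c j * ⟪b i, T (b j)⟫_ℂ) := fun t => by
    rw [← inner_eq_norm_sqrt_sq hT]
    simp only [v, map_sum, map_smul, sum_inner, inner_sum, inner_smul_left, inner_smul_right,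
      map_mul, Complex.conj_ofReal, Finset.mul_sum]
    rw [Finset.sum_comm]
    refine Finset.sum_congr rfl fun i _ => Finset.sum_congr rfl fun j _ => ?_
    ring
  have hint : ∑ i ∈ G, ∑ j ∈ G, ((a i + a j : ℝ) : ℂ)⁻¹ *
      (starRingEnd ℂ (c i) * c j * ⟪b i, T (b j)⟫_ℂ) =
      ∫ t in Set.Ioi (0 : ℝ), ((‖CFC.sqrt T (v t)‖ ^ 2 : ℝ) : ℂ) := by
    simp only [hv]
    rw [integral_finsetSum _ fun i hi => integrable_finsetSum _ fun j hj =>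
      (integral_exp_add (hpos i hi) (hpos j hj) _).1]
    refine Finset.sum_congr rfl fun i hi => ?_
    rw [integral_finsetSum _ fun j hj => (integral_exp_add (hpos i hi) (hpos j hj) _).1]
    exact Finset.sum_congr rfl fun j hj => (integral_exp_add (hpos i hi) (hpos j hj) _).2.symm
  rw [hint, integral_complex_ofReal]
  exact Complex.zero_le_real.2 (integral_nonneg fun t => by positivity)

/-- The operator equation `ω X + X ω = 2 ρ` has a bounded self-adjoint solution
if `0 ≤ ρ ≤ 2 ω`. -/
theorem exists_symmetric_logarithmic_derivative [TopologicalSpace.SeparableSpace H]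
    {ω ρ : H →L[ℂ] H} (hω : ω ∈ positiveFiniteTrace H) (hρ : 0 ≤ ρ) (hle : ρ ≤ ω + ω) :
    ∃ X : H →L[ℂ] H, X.adjoint = X ∧ ω ∘L X + X ∘L ω = ρ + ρ := by
  have hωsa := adjoint_eq_of_nonneg hω.1
  obtain ⟨ι, -, b, hb⟩ := exists_joint_eigenbasis (S := {ω})
    (by rintro T rfl; exact isCompactOperator_of_positiveFiniteTrace hω)
    (by rintro T rfl; exact ((ContinuousLinearMap.nonneg_iff_isPositive _).1 hω.1).isSymmetric)
    (by rintro T rfl T' rfl; rfl)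
  have hb' : ∀ i, ∃ a : ℝ, 0 ≤ a ∧ ω (b i) = (a : ℂ) • b i := fun i => by
    obtain ⟨c, hc⟩ := hb ω rfl i
    have h1 := nonneg_iff_inner.1 hω.1 (b i)
    rw [hc, inner_smul_right, inner_self_eq_norm_sq_to_K, b.orthonormal.1 i] at h1
    simp only [RCLike.ofReal_one, one_pow, mul_one] at h1
    refine ⟨c.re, (Complex.nonneg_iff.1 h1).1, ?_⟩
    rw [hc]
    congr 1
    exact Complex.eq_re_of_ofReal_le (r := 0) (by simpa using h1)
  choose a ha hab using hb'
  have hbb : ∀ i, ⟪b i, b i⟫_ℂ = 1 := fun i => by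
    rw [inner_self_eq_norm_sq_to_K, b.orthonormal.1 i]; simp
  have hρ0 : ∀ i, a i = 0 → ρ (b i) = 0 := fun i hi => by
    have h1 := nonneg_iff_inner.1 (sub_nonneg.2 hle) (b i)
    rw [sub_apply, add_apply, hab, hi, Complex.ofReal_zero, zero_smul, add_zero, zero_sub,
      inner_neg_right, inner_eq_norm_sqrt_sq hρ, ← Complex.ofReal_neg, Complex.zero_le_real] at h1
    have h2 : CFC.sqrt ρ (b i) = 0 := by
      rw [← norm_eq_zero]
      nlinarith [norm_nonneg (CFC.sqrt ρ (b i))]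
    conv_lhs => rw [← sqrt_comp_sqrt hρ]
    rw [ContinuousLinearMap.comp_apply, h2, map_zero]
  -- In the eigenbasis of `ω` the equation reads `(aᵢ + aⱼ) Xᵢⱼ = 2 ρᵢⱼ`. These are finite
  -- truncations of its solution; where `aᵢ + aⱼ = 0` the convention `0⁻¹ = 0` is harmless because
  -- `ρ (b i) = 0`.
  let X : Finset ι → H →L[ℂ] H := fun F => ∑ i ∈ F, ∑ j ∈ F,
    (2 * ((a i + a j : ℝ) : ℂ)⁻¹ * ⟪b i, ρ (b j)⟫_ℂ) • InnerProductSpace.rankOne ℂ (b i) (b j)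
  have hXin : ∀ F x, ⟪x, X F x⟫_ℂ = 2 * ∑ i ∈ F, ∑ j ∈ F, ((a i + a j : ℝ) : ℂ)⁻¹ *
      (starRingEnd ℂ ⟪b i, x⟫_ℂ * ⟪b j, x⟫_ℂ * ⟪b i, ρ (b j)⟫_ℂ) := fun F x => by
    simp only [X, sum_apply, inner_sum, smul_apply, inner_smul_right,
      InnerProductSpace.rankOne_apply, Finset.mul_sum, inner_conj_symm]
    refine Finset.sum_congr rfl fun i _ => Finset.sum_congr rfl fun j _ => ?_
    ring
  have hX0 : ∀ F, 0 ≤ X F := fun F => nonneg_iff_inner.2 fun x => by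
    rw [hXin]
    exact mul_nonneg (by norm_num) (cauchy_schur_nonneg b ha hρ hρ0 F _)
  have hX2 : ∀ F, X F ≤ (2 : ℂ) • 1 := fun F => by
    rw [← sub_nonneg, nonneg_iff_inner]
    intro x
    -- The upper bound comes from positivity of the multiplier on `2ω - ρ`: it sends the diagonal
    -- operator `2ω` to the projection onto the `b i` with `a i ≠ 0`, truncated to `F`. Thus `0 ≤ X
    -- F ≤ 2` uniformly in `F`.
    have h1 := cauchy_schur_nonneg b ha (sub_nonneg.2 hle)
      (fun i hi => by simp [hab, hi, hρ0 i hi]) F fun i => ⟪b i, x⟫_ℂ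
    have h2 : ∑ i ∈ F, ∑ j ∈ F, ((a i + a j : ℝ) : ℂ)⁻¹ *
      (starRingEnd ℂ ⟪b i, x⟫_ℂ * ⟪b j, x⟫_ℂ * ⟪b i, (ω + ω - ρ) (b j)⟫_ℂ) =
      ∑ i ∈ F, (if a i = 0 then 0 else ((‖⟪b i, x⟫_ℂ‖ ^ 2 : ℝ) : ℂ)) -
      ∑ i ∈ F, ∑ j ∈ F, ((a i + a j : ℝ) : ℂ)⁻¹ *
      (starRingEnd ℂ ⟪b i, x⟫_ℂ * ⟪b j, x⟫_ℂ * ⟪b i, ρ (b j)⟫_ℂ) := by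
      rw [← Finset.sum_sub_distrib]
      refine Finset.sum_congr rfl fun i hi => ?_
      simp only [sub_apply, inner_sub_right, mul_sub, Finset.sum_sub_distrib]
      congr 1
      rw [Finset.sum_eq_single i]
      · rw [add_apply, hab, inner_add_right, inner_smul_right, hbb, mul_one, RCLike.conj_mul]
        split_ifs with h
        · simp [h]
        · have : ((a i : ℂ)) ≠ 0 := by simpa using h
          push_cast
          field_simp
          simp
      · intro j _ hj
        rw [add_apply, hab, inner_add_right, inner_smul_right, b.orthonormal.2 hj.symm]
        simp
      · exact fun h => absurd hi h
    rw [h2] at h1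
    have h3 : (∑ i ∈ F, (if a i = 0 then 0 else ((‖⟪b i, x⟫_ℂ‖ ^ 2 : ℝ) : ℂ))) ≤
        ((‖x‖ ^ 2 : ℝ) : ℂ) := by
      have h4 : (∑ i ∈ F, (if a i = 0 then 0 else ‖⟪b i, x⟫_ℂ‖ ^ 2)) ≤ ‖x‖ ^ 2 :=
        (Finset.sum_le_sum fun i _ => by split_ifs <;> simp).trans
          (sum_le_hasSum F (fun i _ => by positivity) (hasSum_norm_inner_sq b x))
      have h5 := Complex.real_le_real.2 h4
      push_cast at h5 ⊢
      convert h5 using 3 with i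
      split_ifs <;> simp
    rw [sub_apply, inner_sub_right, hXin, smul_apply, inner_smul_right,
      one_apply_eq_self, inner_self_eq_norm_sq_to_K, ← mul_sub]
    refine mul_nonneg (by norm_num) ?_
    rw [sub_nonneg] at h1 ⊢
    simpa using h1.trans h3
  have hXn : ∀ F, ‖X F‖ ≤ ‖(2 : ℂ) • (1 : H →L[ℂ] H)‖ := fun F =>
    CStarAlgebra.norm_le_norm_of_nonneg_of_le (hX0 F) (hX2 F)
  obtain ⟨U, Y, hU, hY⟩ := exists_weak_limit (atTop : Filter (Finset ι)) X hXn
  have hYsa : Y.adjoint = Y := by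
    ext x
    refine ext_inner_right ℂ fun y => ?_
    rw [ContinuousLinearMap.adjoint_inner_left, ← inner_conj_symm]
    refine tendsto_nhds_unique ((Complex.continuous_conj.tendsto _).comp (hY y x)) ?_
    refine (hY x y).congr fun F => ?_
    rw [Function.comp_apply, inner_conj_symm, ← ContinuousLinearMap.adjoint_inner_left,
      adjoint_eq_of_nonneg (hX0 F)]
  refine ⟨Y, hYsa, ?_⟩
  have hYe : ∀ i j, ⟪Y (b i), b j⟫_ℂ = 2 * ((a i + a j : ℝ) : ℂ)⁻¹ * ⟪ρ (b i), b j⟫_ℂ := by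
    classical
    intro i j
    refine tendsto_nhds_unique (hY (b i) (b j)) (tendsto_nhds_of_eventually_eq ?_)
    -- A matrix entry is constant once the truncation contains both of its indices.
    filter_upwards [hU (Ici_mem_atTop {i, j})] with F hF
    have hi : i ∈ F := hF (by simp)
    have hj : j ∈ F := hF (by simp)
    simp only [X, sum_apply, smul_apply, sum_inner, inner_smul_left,
      InnerProductSpace.rankOne_apply, orthonormal_iff_ite.1 b.orthonormal, map_mul]
    rw [Finset.sum_eq_single j (fun k _ hk => by simp [hk]) (fun h => absurd hj h),
      Finset.sum_eq_single i (fun k _ hk => by simp [hk]) (fun h => absurd hi h)]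
    simp [inner_conj_symm, add_comm, Complex.conj_ofNat]
  refine clm_ext_basis b fun i j => ?_
  rw [add_apply, add_apply, inner_add_left, inner_add_left, ContinuousLinearMap.comp_apply,
    ContinuousLinearMap.comp_apply, hab, map_smul, inner_smul_left, ← hωsa,
    ContinuousLinearMap.adjoint_inner_left, hab, inner_smul_right, Complex.conj_ofReal, hYe]
  by_cases h : a i + a j = 0
  · have hi : a i = 0 := by linarith [ha i, ha j]
    rw [hρ0 i hi]
    simp
  · have h' : ((a i : ℂ) + a j) ≠ 0 := by exact_mod_cast h
    push_cast
    field_simp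
    ring

end Lyapunov

/-! ### Effects, mixtures of states, and variance bounds for commutators. -/

section States

variable {H : Type u} [NormedAddCommGroup H] [InnerProductSpace ℂ H] [CompleteSpace H]
variable {K : Type v} [NormedAddCommGroup K] [InnerProductSpace ℂ K] [CompleteSpace K]
variable {ι : Type*}

theorem State.mem (ρ : State H) : ρ.val ∈ positiveFiniteTrace H :=
  mem_positiveFiniteTrace_iff.2 ⟨ρ.nonneg, ρ.op.2⟩

theorem inner_sqrt_left (P : H →L[ℂ] H) (x y : H) :
    ⟪CFC.sqrt P x, y⟫_ℂ = ⟪x, CFC.sqrt P y⟫_ℂ := by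
  rw [← ContinuousLinearMap.adjoint_inner_right, adjoint_sqrt]

theorem hasSum_trace_sqrt {P : H →L[ℂ] H} (hP : P ∈ positiveFiniteTrace H) (N : H →L[ℂ] H)
    (b : HilbertBasis ι ℂ H) :
    HasSum (fun i => ⟪CFC.sqrt P (b i), N (CFC.sqrt P (b i))⟫_ℂ) (trace (N ∘L P)) := by
  obtain ⟨t, h1, h2⟩ := exists_hasSum_hs ((isHS_sqrt hP).comp_left N) (isHS_sqrt hP) (onb H) b
  have e : trace (N ∘L P) = t := by
    rw [← h1.tsum_eq, trace]
    congr! 3 with i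
    conv_lhs => rw [← sqrt_comp_sqrt hP.1]
    rfl
  rw [e]
  simpa only [inner_sqrt_left, ContinuousLinearMap.comp_apply] using h2

theorem trace_comp_nonneg {P N : H →L[ℂ] H} (hP : P ∈ positiveFiniteTrace H) (hN : 0 ≤ N) :
    0 ≤ trace (N ∘L P) :=
  (hasSum_trace_sqrt hP N (onb H)).nonneg fun _ => nonneg_iff_inner.1 hN _

/-- `M ↦ tr (M T)` as a linear functional. -/
noncomputable def traceComp (T : traceClass H) : (H →L[ℂ] H) →ₗ[ℂ] ℂ where
  toFun M := trace (M ∘L T.1)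
  map_add' M N := by
    rw [ContinuousLinearMap.add_comp, trace_add (comp_left_mem_traceClass T.2 M)
      (comp_left_mem_traceClass T.2 N)]
  map_smul' c M := by
    rw [ContinuousLinearMap.smul_comp, trace_smul]; rfl

/-- Positive operators span all bounded operators, and a nonzero positive `M` becomes an effect
after division by `‖M‖`. With `binaryPOVM` this turns equal statistics for all observables into
equal trace functionals. -/
theorem linear_eq_of_effects {f g : (H →L[ℂ] H) →ₗ[ℂ] ℂ}
    (h : ∀ M : H →L[ℂ] H, 0 ≤ M → M ≤ 1 → f M = g M) : f = g := by
  have hpos : ∀ M : H →L[ℂ] H, 0 ≤ M → f M = g M := fun M hM => by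
    rcases eq_or_ne ‖M‖ 0 with h0 | h0
    · rw [norm_eq_zero.1 h0, map_zero, map_zero]
    · have h1 : M ≤ ((‖M‖ : ℝ) : ℂ) • (1 : H →L[ℂ] H) := by
        rw [← sub_nonneg, nonneg_iff_inner]
        intro x
        rw [sub_apply, inner_sub_right, smul_apply, one_apply_eq_self,
          inner_smul_right, inner_self_eq_norm_sq_to_K, inner_eq_norm_sqrt_sq hM, sub_nonneg]
        have h2 := norm_inner_le_norm (𝕜 := ℂ) x (M x)
        rw [inner_eq_norm_sqrt_sq hM, Complex.norm_real, norm_pow, norm_norm] at h2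
        have h3 := M.le_opNorm x
        have h4 : ‖CFC.sqrt M x‖ ^ 2 ≤ ‖M‖ * ‖x‖ ^ 2 := by
          nlinarith [norm_nonneg x]
        have := Complex.real_le_real.2 h4
        simpa using this
      have hn : (0 : ℂ) ≤ ((‖M‖⁻¹ : ℝ) : ℂ) := Complex.zero_le_real.2 (by positivity)
      have hne : ((‖M‖⁻¹ : ℝ) : ℂ) ≠ 0 := by simpa using h0
      refine smul_right_injective _ hne ?_
      simp only [← map_smul]
      refine h (((‖M‖⁻¹ : ℝ) : ℂ) • M) ?_ ?_
      · rw [nonneg_iff_inner]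
        intro x
        rw [smul_apply, inner_smul_right]
        exact mul_nonneg hn (nonneg_iff_inner.1 hM x)
      · rw [← sub_nonneg] at h1 ⊢
        have e2 : 1 - ((‖M‖⁻¹ : ℝ) : ℂ) • M =
            ((‖M‖⁻¹ : ℝ) : ℂ) • (((‖M‖ : ℝ) : ℂ) • (1 : H →L[ℂ] H) - M) := by
          rw [smul_sub, smul_smul, ← Complex.ofReal_mul, inv_mul_cancel₀ h0]
          simp
        rw [e2, nonneg_iff_inner]
        intro x
        rw [smul_apply, inner_smul_right]
        exact mul_nonneg hn (nonneg_iff_inner.1 h1 x)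
  ext M
  have hM : M ∈ Submodule.span ℂ {a : H →L[ℂ] H | 0 ≤ a} := by
    rw [CStarAlgebra.span_nonneg]; trivial
  induction hM using Submodule.span_induction with
  | mem M hM => exact hpos M hM
  | zero => simp
  | add M N _ _ hM hN => rw [map_add, map_add, hM, hN]
  | smul c M _ hM => rw [map_smul, map_smul, hM]

open Classical in
/-- The two-outcome observable with effects `M` and `1 - M`. -/
noncomputable def binaryPOVM {M : H →L[ℂ] H} (h0 : 0 ≤ M) (h1 : M ≤ 1) : POVM H Bool where
  effect X := (if true ∈ X then M else 0) + (if false ∈ X then 1 - M else 0)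
  nonneg X _ := add_nonneg (by split_ifs <;> simp [h0]) (by split_ifs <;> simp [h1])
  exists_prob ρ := by
    have hρ := ρ.mem
    have ht := subset_traceClass hρ
    have hp := trace_comp_nonneg hρ h0
    have hq := trace_comp_nonneg hρ (sub_nonneg.2 h1)
    rw [← trace_comm ht] at hp hq
    have hpe := Complex.eq_re_of_ofReal_le (r := 0) (by simpa using hp)
    have hqe : trace (ρ.val ∘L (1 - M)) = ((trace (ρ.val ∘L (1 - M))).re : ℂ) :=
      Complex.eq_re_of_ofReal_le (r := 0) (by simpa only [Complex.ofReal_zero] using hq)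
    have hp0 := (Complex.nonneg_iff.1 hp).1
    have hq0 := (Complex.nonneg_iff.1 hq).1
    have hsum : trace (ρ.val ∘L M) + trace (ρ.val ∘L (1 - M)) = 1 := by
      rw [← trace_add (comp_right_mem_traceClass ht _) (comp_right_mem_traceClass ht _),
        ← ContinuousLinearMap.comp_add, add_sub_cancel]
      exact ρ.trace_eq_one
    refine ⟨ENNReal.ofReal (trace (ρ.val ∘L M)).re • Measure.dirac true +
      ENNReal.ofReal (trace (ρ.val ∘L (1 - M))).re • Measure.dirac false, ⟨?_⟩, fun X hX => ?_⟩
    · simp only [Measure.coe_add, Measure.coe_smul, Pi.add_apply, Pi.smul_apply, measure_univ,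
        smul_eq_mul, mul_one]
      rw [← ENNReal.ofReal_add hp0 hq0, ← Complex.add_re, hsum]
      simp
    · rw [ContinuousLinearMap.comp_add, trace_add (comp_right_mem_traceClass ht _)
        (comp_right_mem_traceClass ht _)]
      simp only [Measure.coe_add, Measure.coe_smul, Pi.add_apply, Pi.smul_apply, smul_eq_mul,
        Measure.dirac_apply]
      rw [ENNReal.toReal_add (by by_cases h : true ∈ X <;> simp [h])
        (by by_cases h : false ∈ X <;> simp [h])]
      by_cases h : true ∈ X <;> by_cases h' : false ∈ X <;>
        simp [h, h', ENNReal.toReal_ofReal hp0, ENNReal.toReal_ofReal hq0, ← hpe, ← hqe,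
          -ContinuousLinearMap.comp_sub]

@[simp]
theorem binaryPOVM_effect {M : H →L[ℂ] H} (h0 : 0 ≤ M) (h1 : M ≤ 1) :
    (binaryPOVM h0 h1).effect {true} = M := by
  simp [binaryPOVM]

/-- The equal mixture of two states. -/
noncomputable def State.mix (ρ τ : State H) : State H where
  op := ((1 / 2 : ℝ) : ℂ) • (ρ.op + τ.op)
  nonneg := (positiveFiniteTrace_smul (positiveFiniteTrace_add ρ.mem τ.mem) (by norm_num)).1
  trace_eq_one := by
    rw [Submodule.coe_smul, Submodule.coe_add, trace_smul, trace_add ρ.op.2 τ.op.2,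
      ρ.trace_eq_one, τ.trace_eq_one]
    norm_num

theorem State.mix_val (ρ τ : State H) : (ρ.mix τ).val = (1 / 2 : ℂ) • (ρ.val + τ.val) := by
  simp [State.mix, State.val]

theorem State.mix_add (ρ τ : State H) : (ρ.mix τ).val + (ρ.mix τ).val = ρ.val + τ.val := by
  rw [State.mix_val, ← two_smul ℂ, smul_smul]
  norm_num

theorem exists_sld [TopologicalSpace.SeparableSpace H] (ρ τ : State H) :
    ∃ X : H →L[ℂ] H, X.adjoint = X ∧ (ρ.mix τ).val ∘L X + X ∘L (ρ.mix τ).val = ρ.val + ρ.val := by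
  refine exists_symmetric_logarithmic_derivative (ρ.mix τ).mem ρ.nonneg ?_
  rw [State.mix_add]
  exact le_add_of_nonneg_right τ.nonneg

theorem commute_of_sld {ρ τ : State H} {X : H →L[ℂ] H}
    (hX : (ρ.mix τ).val ∘L X + X ∘L (ρ.mix τ).val = ρ.val + ρ.val)
    (h : X ∘L (ρ.mix τ).val = (ρ.mix τ).val ∘L X) : ρ.val ∘L τ.val = τ.val ∘L ρ.val := by
  have h0 := State.mix_add ρ τ
  set ω := (ρ.mix τ).val
  have h1 : ρ.val = X * ω := by
    have : (2 : ℂ) • ρ.val = (2 : ℂ) • (X * ω) := by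
      rw [two_smul, two_smul, ← hX, ← h]; rfl
    exact smul_right_injective _ (two_ne_zero) this
  have h2 : τ.val = ω + ω - ρ.val := by rw [h0]; abel
  have h' : X * ω = ω * X := h
  have h3 : ρ.val * ω = ω * ρ.val := by
    rw [h1, ← mul_assoc, ← h']
  change ρ.val * τ.val = τ.val * ρ.val
  rw [h2, mul_sub, mul_add, sub_mul, add_mul, h3]

/-- Multiplying the equation by `X` and taking traces leaves `tr (X ω X) + tr (X² ω)` on one side,
and these two terms agree by cyclicity. -/
theorem trace_sld {ω ρ X : H →L[ℂ] H} (hω : ω ∈ traceClass H) (hρ : ρ ∈ traceClass H)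
    (hX : ω ∘L X + X ∘L ω = ρ + ρ) : trace (X ∘L ρ) = trace (X ∘L X ∘L ω) := by
  have h1 : trace (X ∘L (ω ∘L X + X ∘L ω)) = trace (X ∘L (ρ + ρ)) := by rw [hX]
  have hXω := comp_left_mem_traceClass hω X
  rw [ContinuousLinearMap.comp_add, ContinuousLinearMap.comp_add,
    trace_add (comp_left_mem_traceClass (comp_right_mem_traceClass hω X) X)
      (comp_left_mem_traceClass hXω X),
    trace_add (comp_left_mem_traceClass hρ X) (comp_left_mem_traceClass hρ X),
    trace_conj hω X X] at h1
  linear_combination (-1 / 2 : ℂ) * h1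

/-- The variance of `X` in `P` bounds the expectation of commutators with `X`. -/
theorem norm_trace_commutator_le {P : H →L[ℂ] H} (hP : P ∈ positiveFiniteTrace H)
    {X : H →L[ℂ] H} (hX : X.adjoint = X) (q : ℝ) (M : H →L[ℂ] H) {t : ℝ} (ht : 0 < t) :
    ‖trace ((X ∘L M - M ∘L X) ∘L P)‖ ≤ ‖M‖ * (t * (trace P).re +
      ((trace (X ∘L X ∘L P)).re - 2 * q * (trace (X ∘L P)).re + q ^ 2 * (trace P).re) / t) := by
  -- Subtracting a scalar leaves the commutator unchanged and replaces the second moment of `X` by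
  -- its spread about `q`.
  set Y : H →L[ℂ] H := X - (q : ℂ) • ContinuousLinearMap.id ℂ H with hY
  have hYsa : Y.adjoint = Y := by
    ext x
    refine ext_inner_right ℂ fun y => ?_
    rw [ContinuousLinearMap.adjoint_inner_left, hY]
    simp only [sub_apply, smul_apply, ContinuousLinearMap.id_apply, inner_sub_left,
      inner_sub_right, inner_smul_left, inner_smul_right, Complex.conj_ofReal]
    nth_rw 1 [← hX]
    rw [ContinuousLinearMap.adjoint_inner_right]
  have hc : X ∘L M - M ∘L X = Y ∘L M - M ∘L Y := by
    ext x; simp [hY]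
  have hT := subset_traceClass hP
  have hYY : trace (Y ∘L Y ∘L P) =
      trace (X ∘L X ∘L P) - 2 * q * trace (X ∘L P) + q ^ 2 * trace P := by
    have e : Y ∘L Y ∘L P = X ∘L X ∘L P - (2 * q : ℂ) • (X ∘L P) + ((q : ℂ) ^ 2) • P := by
      ext x
      simp only [hY, ContinuousLinearMap.comp_apply, sub_apply, add_apply, smul_apply,
        ContinuousLinearMap.id_apply, map_sub, map_smul, smul_sub, smul_smul]
      module
    have hXP := comp_left_mem_traceClass hT X
    rw [e, trace_add (sub_mem (comp_left_mem_traceClass hXP X) (Submodule.smul_mem _ _ hXP))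
      (Submodule.smul_mem _ _ hT), trace_sub (comp_left_mem_traceClass hXP X)
      (Submodule.smul_mem _ _ hXP), trace_smul, trace_smul]
  have hre : (trace (Y ∘L Y ∘L P)).re =
      (trace (X ∘L X ∘L P)).re - 2 * q * (trace (X ∘L P)).re + q ^ 2 * (trace P).re := by
    rw [hYY, Complex.add_re, Complex.sub_re, mul_assoc, ← Complex.ofReal_pow,
      Complex.re_ofReal_mul, ← Complex.ofReal_ofNat, Complex.re_ofReal_mul, Complex.re_ofReal_mul,
      mul_assoc]
  rw [hc, ← hre, ContinuousLinearMap.sub_comp,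
    trace_sub (comp_left_mem_traceClass hT _) (comp_left_mem_traceClass hT _)]
  set s := CFC.sqrt P
  have hV : HasSum (fun i => ‖Y (s (onb H i))‖ ^ 2) (trace (Y ∘L Y ∘L P)).re := by
    have h := Complex.hasSum_re (hasSum_trace_sqrt hP (Y ∘L Y) (onb H))
    rw [ContinuousLinearMap.comp_assoc] at h
    convert h using 2 with i
    rw [ContinuousLinearMap.comp_apply, ← ContinuousLinearMap.adjoint_inner_left, hYsa,
      inner_self_eq_norm_sq_to_K, ← RCLike.ofReal_pow]
    rfl
  have hN := hasSum_norm_sqrt_sq hP (onb H)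
  have hS := ((hN.mul_left t).add (hV.div_const t)).mul_left (‖M‖ / 2)
  -- The weighted arithmetic-geometric mean inequality replaces Cauchy-Schwarz: for fixed `q` and
  -- `t` the resulting bound is linear in `P`, so it can be averaged over mixtures.
  have key : ∀ i, ‖s (onb H i)‖ * ‖Y (s (onb H i))‖ ≤
      2⁻¹ * (t * ‖s (onb H i)‖ ^ 2 + ‖Y (s (onb H i))‖ ^ 2 / t) := fun i => by
    have h1 : t * ‖s (onb H i)‖ ^ 2 + ‖Y (s (onb H i))‖ ^ 2 / t -
        2 * (‖s (onb H i)‖ * ‖Y (s (onb H i))‖) =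
        (t * ‖s (onb H i)‖ - ‖Y (s (onb H i))‖) ^ 2 / t := by
      field_simp
      ring
    have h2 : 0 ≤ (t * ‖s (onb H i)‖ - ‖Y (s (onb H i))‖) ^ 2 / t := by positivity
    linarith
  have hA : ‖trace ((Y ∘L M) ∘L P)‖ ≤ ‖M‖ / 2 * (t * (trace P).re +
      (trace (Y ∘L Y ∘L P)).re / t) := by
    rw [← (hasSum_trace_sqrt hP (Y ∘L M) (onb H)).tsum_eq]
    refine tsum_of_norm_bounded hS fun i => ?_
    rw [ContinuousLinearMap.comp_apply, ← ContinuousLinearMap.adjoint_inner_left, hYsa]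
    calc _ ≤ ‖Y (s (onb H i))‖ * (‖M‖ * ‖s (onb H i)‖) :=
          (norm_inner_le_norm _ _).trans (by gcongr; exact M.le_opNorm _)
      _ = ‖M‖ * (‖s (onb H i)‖ * ‖Y (s (onb H i))‖) := by ring
      _ ≤ ‖M‖ * (2⁻¹ * (t * ‖s (onb H i)‖ ^ 2 + ‖Y (s (onb H i))‖ ^ 2 / t)) := by
          exact mul_le_mul_of_nonneg_left (key i) (norm_nonneg _)
      _ = _ := by ring
  have hB : ‖trace ((M ∘L Y) ∘L P)‖ ≤ ‖M‖ / 2 * (t * (trace P).re +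
      (trace (Y ∘L Y ∘L P)).re / t) := by
    rw [← (hasSum_trace_sqrt hP (M ∘L Y) (onb H)).tsum_eq]
    refine tsum_of_norm_bounded hS fun i => ?_
    rw [ContinuousLinearMap.comp_apply]
    calc _ ≤ ‖s (onb H i)‖ * (‖M‖ * ‖Y (s (onb H i))‖) :=
          (norm_inner_le_norm _ _).trans (by gcongr; exact M.le_opNorm _)
      _ = ‖M‖ * (‖s (onb H i)‖ * ‖Y (s (onb H i))‖) := by ring
      _ ≤ ‖M‖ * (2⁻¹ * (t * ‖s (onb H i)‖ ^ 2 + ‖Y (s (onb H i))‖ ^ 2 / t)) := by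
          exact mul_le_mul_of_nonneg_left (key i) (norm_nonneg _)
      _ = _ := by ring
  refine (norm_sub_le _ _).trans ((add_le_add hA hB).trans (le_of_eq ?_))
  ring

/-- By cyclicity the hypothesis says `tr (M (ω X - X ω)) = 0`, and traces against all `M` separate
operators. -/
theorem comm_of_trace {X ω : H →L[ℂ] H} (hω : ω ∈ traceClass H)
    (h : ∀ M : H →L[ℂ] H, trace ((X ∘L M - M ∘L X) ∘L ω) = 0) : X ∘L ω = ω ∘L X := by
  refine comp_left_eq_of_trace fun M => ?_
  have h1 := h M
  rw [ContinuousLinearMap.sub_comp,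
    trace_sub (comp_left_mem_traceClass hω _) (comp_left_mem_traceClass hω _), sub_eq_zero] at h1
  rw [trace_comm (comp_left_mem_traceClass hω X), ← ContinuousLinearMap.comp_assoc, ← h1,
    ContinuousLinearMap.comp_assoc, ContinuousLinearMap.comp_assoc,
    ← trace_comm (comp_left_mem_traceClass hω M), ContinuousLinearMap.comp_assoc,
    ← trace_comm (comp_right_mem_traceClass hω X), ← ContinuousLinearMap.comp_assoc]

theorem comm_of_trace_bound {X ω : H →L[ℂ] H} (hω : ω ∈ traceClass H)
    (h : ∀ M : H →L[ℂ] H, ∀ t : ℝ, 0 < t → ‖trace ((X ∘L M - M ∘L X) ∘L ω)‖ ≤ ‖M‖ * t) :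
    X ∘L ω = ω ∘L X := by
  refine comm_of_trace hω fun M => norm_le_zero_iff.1 (le_of_forall_pos_le_add fun ε hε => ?_)
  have h1 := h M (ε / (‖M‖ + 1)) (by positivity)
  refine h1.trans ?_
  rw [zero_add, mul_div_assoc', div_le_iff₀ (by positivity)]
  nlinarith [norm_nonneg M]

end States

/-! ### Monotonicity of Fisher information under channels. -/

section ChannelInequality

variable {H : Type u} [NormedAddCommGroup H] [InnerProductSpace ℂ H] [CompleteSpace H]
variable {K : Type v} [NormedAddCommGroup K] [InnerProductSpace ℂ K] [CompleteSpace K]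

theorem Channel.map_nonneg (Λ : Channel H K) {T : traceClass H} (hT : 0 ≤ T.1) :
    0 ≤ (Λ.map T).1 := by
  rw [nonneg_iff_inner]
  intro y
  simpa using Λ.completelyPositive 1 (fun _ _ => T)
    (fun x => by simpa using nonneg_iff_inner.1 hT (x 0)) fun _ => y

theorem Channel.map_mem (Λ : Channel H K) {T : traceClass H} (hT : T.1 ∈ positiveFiniteTrace H) :
    (Λ.map T).1 ∈ positiveFiniteTrace K :=
  mem_positiveFiniteTrace_iff.2 ⟨Λ.map_nonneg hT.1, (Λ.map T).2⟩

/-- Monotonicity of the symmetric logarithmic derivative metric under channels. -/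
theorem Channel.sld_inequality (Λ : Channel H K) {ω ρ : traceClass H}
    (hω : ω.1 ∈ positiveFiniteTrace H) {X : H →L[ℂ] H} (hX : X.adjoint = X)
    (hXω : ω.1 ∘L X + X ∘L ω.1 = ρ.1 + ρ.1) {Z : K →L[ℂ] K} (hZ : Z.adjoint = Z) :
    2 * (trace (Z ∘L (Λ.map ρ).1)).re ≤
      (trace (Z ∘L Z ∘L (Λ.map ω).1)).re + (trace (X ∘L X ∘L ω.1)).re := by
  let ωX : traceClass H := ⟨ω.1 ∘L X, comp_right_mem_traceClass ω.2 X⟩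
  let Xω : traceClass H := ⟨X ∘L ω.1, comp_left_mem_traceClass ω.2 X⟩
  let XωX : traceClass H := ⟨X ∘L ω.1 ∘L X, comp_mem_traceClass ω.2 X X⟩
  have hadj : ∀ x y, ⟪X x, y⟫_ℂ = ⟪x, X y⟫_ℂ := fun x y => by
    rw [← ContinuousLinearMap.adjoint_inner_right, hX]
  have hZadj : ∀ x y, ⟪Z x, y⟫_ℂ = ⟪x, Z y⟫_ℂ := fun x y => by
    rw [← ContinuousLinearMap.adjoint_inner_right, hZ]
  -- The block matrix has value `⟪x₀ + X x₁, ω (x₀ + X x₁)⟫` at `(x₀, x₁)`, so it is positive.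
  have hcp := Λ.completelyPositive 2 ![![ω, ωX], ![Xω, XωX]] (fun x => by
    have h := nonneg_iff_inner.1 hω.1 (x 0 + X (x 1))
    simp only [Fin.sum_univ_two, Matrix.cons_val_zero, Matrix.cons_val_one, ωX, Xω, XωX,
      ContinuousLinearMap.comp_apply, ← hadj]
    simp only [map_add, inner_add_left, inner_add_right] at h
    convert h using 1
    ring)
  have h1 := hasSum_trace (comp_mem_traceClass (Λ.map ω).2 Z Z) (onb K)
  have h2 := hasSum_trace (comp_left_mem_traceClass (Λ.map ωX).2 Z) (onb K)
  have h3 := hasSum_trace (comp_right_mem_traceClass (Λ.map Xω).2 Z) (onb K)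
  have h4 := hasSum_trace (Λ.map XωX).2 (onb K)
  -- Testing the image blocks on `(-Z eᵢ, eᵢ)` and summing over the basis gives `tr (Z Λ(ω) Z) - tr
  -- (Z Λ(ωX)) - tr (Λ(Xω) Z) + tr Λ(XωX) ≥ 0`; the cross terms combine through `ωX + Xω = 2ρ`.
  have hpos := (((h1.sub h2).sub h3).add h4).nonneg (fun i => by
    have h := hcp ![-Z (onb K i), onb K i]
    simp only [Fin.sum_univ_two, Matrix.cons_val_zero, Matrix.cons_val_one, inner_neg_left,
      inner_neg_right, map_neg, hZadj] at h
    simp only [ContinuousLinearMap.comp_apply]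
    convert h using 1
    ring)
  rw [trace_comm (Λ.map Xω).2 Z, trace_conj (Λ.map ω).2, Λ.trace_map, trace_conj ω.2,
    sub_sub, ← trace_add (comp_left_mem_traceClass (Λ.map ωX).2 Z)
      (comp_left_mem_traceClass (Λ.map Xω).2 Z), ← ContinuousLinearMap.comp_add] at hpos
  have hsum : (Λ.map ωX).1 + (Λ.map Xω).1 = (Λ.map ρ).1 + (Λ.map ρ).1 := by
    rw [← Submodule.coe_add, ← Submodule.coe_add, ← map_add, ← map_add]
    congr 2
    exact Subtype.ext hXω
  rw [hsum, ContinuousLinearMap.comp_add, trace_add (comp_left_mem_traceClass (Λ.map ρ).2 Z)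
      (comp_left_mem_traceClass (Λ.map ρ).2 Z)] at hpos
  have := (Complex.nonneg_iff.1 hpos).1
  simp only [Complex.add_re, Complex.sub_re] at this
  linarith

end ChannelInequality

/-! ### Broadcastable sets are commutative. -/

section Broadcast

variable {H : Type u} [NormedAddCommGroup H] [InnerProductSpace ℂ H] [CompleteSpace H]

/-- The trace equals `tr (A P A)`, so the positive operator `A P A` vanishes. Hence `√P A = 0`, then
`P A = 0`, and the adjoint gives the claim. -/
theorem comp_eq_zero_of_trace {P A : H →L[ℂ] H} (hP : P ∈ positiveFiniteTrace H)
    (hA : A.adjoint = A) (h : (trace (A ∘L A ∘L P)).re ≤ 0) : A ∘L P = 0 := by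
  have h1 : A ∘L P ∘L A ∈ positiveFiniteTrace H := by
    have := positiveFiniteTrace_compress hP A
    rwa [hA] at this
  rw [← trace_conj (subset_traceClass hP)] at h
  have h2 := eq_zero_of_trace_eq_zero h1 (le_antisymm h (trace_re_nonneg h1.1))
  have h3 : CFC.sqrt P ∘L A = 0 := by
    ext x
    have : ⟪x, (A ∘L P ∘L A) x⟫_ℂ = 0 := by simp [h2]
    rw [ContinuousLinearMap.comp_apply, ← ContinuousLinearMap.adjoint_inner_left, hA,
      ContinuousLinearMap.comp_apply, inner_eq_norm_sqrt_sq hP.1] at this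
    simpa using this
  have h4 : P ∘L A = 0 := by
    rw [← sqrt_comp_sqrt hP.1, ContinuousLinearMap.comp_assoc, h3, ContinuousLinearMap.comp_zero]
  have h5 := congrArg ContinuousLinearMap.adjoint h4
  rwa [ContinuousLinearMap.adjoint_comp, hA, adjoint_eq_of_nonneg hP.1, map_zero] at h5

theorem marginal_of_broadcast {S : Set (State H)} {Λ : Channel H (HTensor H H)}
    (hΛ : ∀ ρ ∈ S, ∀ (Ω₁ : Type) (_ : MeasurableSpace Ω₁) (_ : StandardBorelSpace Ω₁)
      (A : POVM H Ω₁) (Ω₂ : Type) (_ : MeasurableSpace Ω₂) (_ : StandardBorelSpace Ω₂)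
      (B : POVM H Ω₂) (X : Set Ω₁) (Y : Set Ω₂), MeasurableSet X → MeasurableSet Y →
      trace (A.effect X ∘L partialTrace₂ (Λ.map ρ.op).1) = trace (A.effect X ∘L ρ.val) ∧
      trace (B.effect Y ∘L partialTrace₁ (Λ.map ρ.op).1) = trace (B.effect Y ∘L ρ.val))
    (σ : State H) (hσ : σ ∈ S) (M : H →L[ℂ] H) :
    trace (ampLeft H M ∘L (Λ.map σ.op).1) = trace (M ∘L σ.val) ∧
      trace (ampRight H M ∘L (Λ.map σ.op).1) = trace (M ∘L σ.val) := by
  have hpos : (Λ.map σ.op).1 ∈ positiveFiniteTrace (HTensor H H) := Λ.map_mem σ.mem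
  obtain ⟨p1, e1⟩ := partialTrace₁_spec hpos
  obtain ⟨p2, e2⟩ := partialTrace₂_spec hpos
  have h2 := linear_eq_of_effects (f := traceComp ⟨_, subset_traceClass p2⟩)
    (g := traceComp σ.op) fun M h0 h1 => by
      have := (hΛ σ hσ Bool _ inferInstance (binaryPOVM h0 h1) Bool _ inferInstance
        (binaryPOVM h0 h1) {true} {true} (.singleton _) (.singleton _)).1
      rwa [binaryPOVM_effect] at this
  have h1 := linear_eq_of_effects (f := traceComp ⟨_, subset_traceClass p1⟩)
    (g := traceComp σ.op) fun M h0 h1 => by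
      have := (hΛ σ hσ Bool _ inferInstance (binaryPOVM h0 h1) Bool _ inferInstance
        (binaryPOVM h0 h1) {true} {true} (.singleton _) (.singleton _)).2
      rwa [binaryPOVM_effect] at this
  refine ⟨?_, ?_⟩
  · rw [← e2]; exact congr($h2 M)
  · rw [← e1]; exact congr($h1 M)

/-- Next to `Ω`, on either side, `X ⊗ 1` may be exchanged for `1 ⊗ X`, which commutes with `M ⊗ 1`.
So inside the trace `X` slides past `M`. -/
theorem comm_of_marginals {X ω : H →L[ℂ] H} {Ω : HTensor H H →L[ℂ] HTensor H H}
    (hX : X.adjoint = X) (hω : ω ∈ traceClass H) (hΩ : Ω ∈ positiveFiniteTrace (HTensor H H))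
    (hm : ∀ M : H →L[ℂ] H, trace (ampLeft H M ∘L Ω) = trace (M ∘L ω) ∧
      trace (ampRight H M ∘L Ω) = trace (M ∘L ω))
    (h : ampLeft H X ∘L Ω = ampRight H X ∘L Ω) : X ∘L ω = ω ∘L X := by
  have hΩt := subset_traceClass hΩ
  have h' : Ω ∘L ampLeft H X = Ω ∘L ampRight H X := by
    have := congrArg ContinuousLinearMap.adjoint h
    rwa [ContinuousLinearMap.adjoint_comp, ContinuousLinearMap.adjoint_comp, adjoint_ampLeft,
      adjoint_ampRight, hX, adjoint_eq_of_nonneg hΩ.1] at this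
  refine comm_of_trace hω fun M => ?_
  have h1 : trace ((X ∘L M) ∘L ω) = trace ((M ∘L X) ∘L ω) :=
    calc trace ((X ∘L M) ∘L ω) = trace (ampLeft H X ∘L (ampLeft H M ∘L Ω)) := by
          rw [← (hm (X ∘L M)).1, ampLeft_comp, ContinuousLinearMap.comp_assoc]
      _ = trace (ampLeft H M ∘L (Ω ∘L ampLeft H X)) := by
          rw [← trace_comm (comp_left_mem_traceClass hΩt _), ContinuousLinearMap.comp_assoc]
      _ = trace ((ampLeft H M ∘L Ω) ∘L ampRight H X) := by
          rw [h', ContinuousLinearMap.comp_assoc]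
      _ = trace ((ampRight H X ∘L ampLeft H M) ∘L Ω) := by
          rw [trace_comm (comp_left_mem_traceClass hΩt _), ContinuousLinearMap.comp_assoc]
      _ = trace ((M ∘L X) ∘L ω) := by
          rw [← ampLeft_comp_ampRight M X, ContinuousLinearMap.comp_assoc, ← h,
            ← ContinuousLinearMap.comp_assoc, ← ampLeft_comp, (hm (M ∘L X)).1]
  rw [ContinuousLinearMap.sub_comp, trace_sub (comp_left_mem_traceClass hω _)
    (comp_left_mem_traceClass hω _), h1, sub_self]

theorem commutative_of_broadcastable [TopologicalSpace.SeparableSpace H] {S : Set (State H)}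
    (hS : Broadcastable S) : Commutative S := by
  obtain ⟨Λ, hΛ⟩ := hS
  intro ρ hρ τ hτ
  obtain ⟨X, hX, hXω⟩ := exists_sld ρ τ
  refine commute_of_sld hXω ?_
  have hm := marginal_of_broadcast hΛ
  set ω := ρ.mix τ with hω
  set Ω := (Λ.map ω.op).1 with hΩ
  have hΩm : Ω ∈ positiveFiniteTrace (HTensor H H) := Λ.map_mem ω.mem
  have hΩt := subset_traceClass hΩm
  have hΩe : Ω = ((1 / 2 : ℝ) : ℂ) • ((Λ.map ρ.op).1 + (Λ.map τ.op).1) := by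
    rw [hΩ, hω, State.mix, map_smul, map_add]; rfl
  have hωm : ∀ M : H →L[ℂ] H, trace (ampLeft H M ∘L Ω) = trace (M ∘L ω.val) ∧
      trace (ampRight H M ∘L Ω) = trace (M ∘L ω.val) := fun M => by
    have hω' : ω.val = ((1 / 2 : ℝ) : ℂ) • (ρ.val + τ.val) := rfl
    rw [hΩe, hω']
    simp only [ContinuousLinearMap.comp_smul, ContinuousLinearMap.comp_add, trace_smul]
    rw [trace_add (comp_left_mem_traceClass (Λ.map ρ.op).2 _)
      (comp_left_mem_traceClass (Λ.map τ.op).2 _), trace_add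
      (comp_left_mem_traceClass (Λ.map ρ.op).2 _) (comp_left_mem_traceClass (Λ.map τ.op).2 _),
      trace_add (comp_left_mem_traceClass ρ.op.2 _) (comp_left_mem_traceClass τ.op.2 _),
      (hm ρ hρ M).1, (hm τ hτ M).1, (hm ρ hρ M).2, (hm τ hτ M).2]
    exact ⟨rfl, rfl⟩
  set A := ampLeft H X with hA
  set B := ampRight H X with hB
  have hAsa : A.adjoint = A := by rw [hA, adjoint_ampLeft, hX]
  have hBsa : B.adjoint = B := by rw [hB, adjoint_ampRight, hX]
  have hineq := Λ.sld_inequality (ω := ω.op) (ρ := ρ.op) ω.mem hX hXω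
    (Z := (1 / 2 : ℂ) • (A + B)) (by
      rw [map_smulₛₗ, map_add, hAsa, hBsa]; simp [Complex.conj_ofNat])
  have hρX := trace_sld ω.op.2 ρ.op.2 hXω
  have hAρ := (hm ρ hρ X).1
  have hBρ := (hm ρ hρ X).2
  have hAA : trace (A ∘L A ∘L Ω) = trace (X ∘L X ∘L ω.val) := by
    have := (hωm (X ∘L X)).1
    rwa [ampLeft_comp, ContinuousLinearMap.comp_assoc, ContinuousLinearMap.comp_assoc] at this
  have hBB : trace (B ∘L B ∘L Ω) = trace (X ∘L X ∘L ω.val) := by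
    have := (hωm (X ∘L X)).2
    rwa [ampRight_comp, ContinuousLinearMap.comp_assoc, ContinuousLinearMap.comp_assoc] at this
  have hmem : ∀ C D : HTensor H H →L[ℂ] HTensor H H, C ∘L D ∘L Ω ∈ traceClass (HTensor H H) :=
    fun C D => comp_left_mem_traceClass (comp_left_mem_traceClass hΩt D) C
  -- With `J = tr (X² ω)` and `c = tr (A B Ω) + tr (B A Ω)`, the real part of `hineq` reads `2J ≤
  -- (2J + c)/4 + J`, that is `c ≥ 2J`. Hence `tr ((A - B)² Ω) = 2J - c ≤ 0`.
  have hdiff : (A - B) ∘L Ω = 0 := by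
    refine comp_eq_zero_of_trace hΩm (by rw [map_sub, hAsa, hBsa]) ?_
    have e1 : trace ((A - B) ∘L (A - B) ∘L Ω) = trace (A ∘L A ∘L Ω) + trace (B ∘L B ∘L Ω) -
        (trace (A ∘L B ∘L Ω) + trace (B ∘L A ∘L Ω)) := by
      rw [← trace_add (hmem _ _) (hmem _ _), ← trace_add (hmem _ _) (hmem _ _),
        ← trace_sub (add_mem (hmem _ _) (hmem _ _)) (add_mem (hmem _ _) (hmem _ _))]
      congr 1
      ext x
      simp
      abel
    have e2 : trace (((1 / 2 : ℂ) • (A + B)) ∘L ((1 / 2 : ℂ) • (A + B)) ∘L Ω) =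
        ((1 / 4 : ℝ) : ℂ) * (trace (A ∘L A ∘L Ω) + trace (B ∘L B ∘L Ω) +
        (trace (A ∘L B ∘L Ω) + trace (B ∘L A ∘L Ω))) := by
      rw [← trace_add (hmem _ _) (hmem _ _), ← trace_add (hmem _ _) (hmem _ _),
        ← trace_add (add_mem (hmem _ _) (hmem _ _)) (add_mem (hmem _ _) (hmem _ _)), ← trace_smul]
      congr 1
      ext x
      simp
      module
    have e3 : trace (((1 / 2 : ℂ) • (A + B)) ∘L (Λ.map ρ.op).1) =
        ((1 / 2 : ℝ) : ℂ) * (trace (X ∘L ρ.val) + trace (X ∘L ρ.val)) := by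
      rw [ContinuousLinearMap.smul_comp, ContinuousLinearMap.add_comp, trace_smul,
        trace_add (comp_left_mem_traceClass (Λ.map ρ.op).2 _)
        (comp_left_mem_traceClass (Λ.map ρ.op).2 _), hAρ, hBρ]
      simp
    rw [e3, e2, hAA, hBB, hρX, Complex.re_ofReal_mul, Complex.re_ofReal_mul] at hineq
    rw [e1, hAA, hBB]
    simp only [Complex.add_re, Complex.sub_re] at hineq ⊢
    linarith
  have hAΩ : A ∘L Ω = B ∘L Ω := by
    rwa [ContinuousLinearMap.sub_comp, sub_eq_zero] at hdiff
  exact comm_of_marginals hX ω.op.2 hΩm hωm hAΩ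

end Broadcast

/-! ### Product operators are positive and trace class. -/

section ProductStates

variable {H : Type u} [NormedAddCommGroup H] [InnerProductSpace ℂ H] [CompleteSpace H]
variable {K : Type v} [NormedAddCommGroup K] [InnerProductSpace ℂ K] [CompleteSpace K]
variable {ι : Type*}

theorem positiveFiniteTrace_conj {P : H →L[ℂ] H} (hP : P ∈ positiveFiniteTrace H)
    (V : H →L[ℂ] K) : V ∘L P ∘L V.adjoint ∈ positiveFiniteTrace K := by
  simpa using positiveFiniteTrace_compress hP V.adjoint

theorem adjoint_tensorRight_comp_tensorRight (y y' : K) :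
    (tensorRight H y).adjoint ∘L tensorRight H y' = ⟪y, y'⟫_ℂ • ContinuousLinearMap.id ℂ H := by
  ext x
  simp

theorem trace_tensorRight_conj {P : H →L[ℂ] H} (hP : P ∈ positiveFiniteTrace H) (y : K) :
    trace (tensorRight H y ∘L P ∘L (tensorRight H y).adjoint) = ⟪y, y⟫_ℂ * trace P := by
  rw [trace_conj (subset_traceClass hP), ← ContinuousLinearMap.comp_assoc,
    adjoint_tensorRight_comp_tensorRight, ContinuousLinearMap.smul_comp, trace_smul,
    ContinuousLinearMap.id_comp]

/-- Writing `β = ∑ |vᵢ⟩⟨vᵢ|` with `vᵢ = √β eᵢ` exhibits `α ⊗ β` as a sum of positive operators with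
summable traces `‖vᵢ‖²`. -/
theorem productStates_subset : productStates H K ⊆ positiveFiniteTrace (HTensor H K) := by
  rintro τ ⟨α, β, h⟩
  have hβ := β.mem
  set v := fun i => CFC.sqrt β.val (onb K i)
  obtain ⟨S, hS, hsum, -⟩ := exists_hasSum_positive
    (fun i => positiveFiniteTrace_conj α.mem (tensorRight H (v i))) (by
      simp only [trace_tensorRight_conj α.mem, α.trace_eq_one, mul_one,
        inner_self_eq_norm_sq_to_K]
      simpa [v, ← Complex.ofReal_pow] using (hasSum_norm_sqrt_sq hβ (onb K)).summable)
  have e : τ = S := by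
    refine tensor_clm_ext fun x y => ?_
    have h1 : HasSum (fun i => (tensorRight H (v i) ∘L α.val ∘L (tensorRight H (v i)).adjoint)
        (tmul x y)) (S (tmul x y)) :=
      hsum.mapL (ContinuousLinearMap.apply ℂ _ (tmul x y))
    have h2 := (((onb K).hasSum_repr (CFC.sqrt β.val y)).mapL (CFC.sqrt β.val)).mapL
      (tensorLeft K (α.val x))
    rw [← ContinuousLinearMap.comp_apply (CFC.sqrt β.val), sqrt_comp_sqrt hβ.1,
      tensorLeft_apply] at h2
    rw [h]
    refine h2.unique ?_
    convert h1 using 2 with i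
    simp only [ContinuousLinearMap.comp_apply, adjoint_tensorRight_tmul, map_smul,
      (onb K).repr_apply_apply, v, inner_sqrt_left]
    rfl
  exact e ▸ hS

end ProductStates

/-! ### The variance operator on product states and on separable states. -/

section EB

variable {H : Type u} [NormedAddCommGroup H] [InnerProductSpace ℂ H] [CompleteSpace H]
variable {K : Type v} [NormedAddCommGroup K] [InnerProductSpace ℂ K] [CompleteSpace K]

/-- The operator with block matrix `!![X², -X; -X, 1]`. -/
noncomputable def varianceOp (X : H →L[ℂ] H) (k l : K) : HTensor K H →L[ℂ] HTensor K H :=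
  tensorLeft H k ∘L (X ∘L X) ∘L (tensorLeft H k).adjoint -
    tensorLeft H l ∘L X ∘L (tensorLeft H k).adjoint -
    tensorLeft H k ∘L X ∘L (tensorLeft H l).adjoint +
    tensorLeft H l ∘L (tensorLeft H l).adjoint

theorem trace_tensorLeft_comp {T : HTensor K H →L[ℂ] HTensor K H}
    (hT : T ∈ traceClass (HTensor K H)) (N : H →L[ℂ] H) (k l : K) :
    trace ((tensorLeft H k ∘L N ∘L (tensorLeft H l).adjoint) ∘L T) =
      trace (N ∘L (tensorLeft H l).adjoint ∘L T ∘L tensorLeft H k) := by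
  have := trace_conj hT (N ∘L (tensorLeft H l).adjoint) (tensorLeft H k)
  simp only [ContinuousLinearMap.comp_assoc] at this ⊢
  exact this.symm

theorem trace_varianceOp {T : HTensor K H →L[ℂ] HTensor K H}
    (hT : T ∈ traceClass (HTensor K H)) (X : H →L[ℂ] H) (k l : K) :
    trace (varianceOp X k l ∘L T) =
      trace ((X ∘L X) ∘L (tensorLeft H k).adjoint ∘L T ∘L tensorLeft H k) -
      trace (X ∘L (tensorLeft H k).adjoint ∘L T ∘L tensorLeft H l) -
      trace (X ∘L (tensorLeft H l).adjoint ∘L T ∘L tensorLeft H k) +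
      trace ((tensorLeft H l).adjoint ∘L T ∘L tensorLeft H l) := by
  have h4 := trace_tensorLeft_comp hT (.id ℂ H) l l
  simp only [ContinuousLinearMap.id_comp] at h4
  have hm := fun A => comp_left_mem_traceClass hT A
  rw [varianceOp, ContinuousLinearMap.add_comp, ContinuousLinearMap.sub_comp,
    ContinuousLinearMap.sub_comp, trace_add (sub_mem (sub_mem (hm _) (hm _)) (hm _)) (hm _),
    trace_sub (sub_mem (hm _) (hm _)) (hm _), trace_sub (hm _) (hm _),
    trace_tensorLeft_comp hT, trace_tensorLeft_comp hT, trace_tensorLeft_comp hT, h4]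

theorem trace_comp_eq_re {P : H →L[ℂ] H} (hP : P ∈ positiveFiniteTrace H) {X : H →L[ℂ] H}
    (hX : X.adjoint = X) : trace (X ∘L P) = ((trace (X ∘L P)).re : ℂ) := by
  have h := hasSum_trace_sqrt hP X (onb H)
  refine (Complex.conj_eq_iff_re.1 ?_).symm
  have h2 := h.map (starRingEnd ℂ) Complex.continuous_conj
  refine h2.unique ?_
  convert h using 2 with i
  simp only [Function.comp_apply]
  rw [inner_conj_symm]
  conv_rhs => rw [← hX, ContinuousLinearMap.adjoint_inner_right]

theorem State.inner_eq_re (α : State H) (k : H) :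
    ⟪k, α.val k⟫_ℂ = ((⟪k, α.val k⟫_ℂ).re : ℂ) :=
  Complex.eq_re_of_ofReal_le (r := 0) (by simpa using nonneg_iff_inner.1 α.nonneg k)

theorem State.re_inner_nonneg (α : State H) (k : H) : 0 ≤ (⟪k, α.val k⟫_ℂ).re :=
  (Complex.nonneg_iff.1 (nonneg_iff_inner.1 α.nonneg k)).1

theorem State.re_inner_le_one (α : State H) {k : H} (hk : ‖k‖ = 1) :
    (⟪k, α.val k⟫_ℂ).re ≤ 1 := by
  have h1 := (Complex.re_le_norm _).trans (norm_inner_le_norm (𝕜 := ℂ) k (α.val k))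
  have h2 := α.val.le_opNorm k
  have h3 := norm_le_trace α.mem
  rw [α.trace_eq_one] at h3
  rw [hk, one_mul] at h1
  rw [hk, mul_one] at h2
  exact h1.trans (h2.trans (by simpa using h3))

theorem State.re_inner_sub (α : State H) (k l : H) (q : ℝ) :
    0 ≤ q ^ 2 * (⟪k, α.val k⟫_ℂ).re - q * (⟪k, α.val l⟫_ℂ).re - q * (⟪l, α.val k⟫_ℂ).re +
      (⟪l, α.val l⟫_ℂ).re := by
  have hpos := α.re_inner_nonneg ((q : ℂ) • k - l)
  have e : (⟪(q : ℂ) • k - l, α.val ((q : ℂ) • k - l)⟫_ℂ).re = q ^ 2 * (⟪k, α.val k⟫_ℂ).re -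
      q * (⟪k, α.val l⟫_ℂ).re - q * (⟪l, α.val k⟫_ℂ).re + (⟪l, α.val l⟫_ℂ).re := by
    simp only [map_sub, map_smul, inner_sub_left, inner_sub_right, inner_smul_left,
      inner_smul_right, Complex.conj_ofReal, Complex.sub_re, Complex.re_ofReal_mul]
    ring
  rwa [e] at hpos

theorem productState_slice {τ : HTensor K H →L[ℂ] HTensor K H} {α : State K} {β : State H}
    (h : ∀ x y, τ (tmul x y) = tmul (α.val x) (β.val y)) (x x' : K) :
    (tensorLeft H x).adjoint ∘L τ ∘L tensorLeft H x' = ⟪x, α.val x'⟫_ℂ • β.val := by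
  ext y
  simp only [ContinuousLinearMap.comp_apply, tensorLeft_apply, h, adjoint_tensorLeft_tmul,
    smul_apply]

theorem trace_varianceOp_productState {τ : HTensor K H →L[ℂ] HTensor K H}
    (hT : τ ∈ traceClass (HTensor K H)) {α : State K} {β : State H}
    (h : ∀ x y, τ (tmul x y) = tmul (α.val x) (β.val y))
    {X : H →L[ℂ] H} (hX : X.adjoint = X) (k l : K) :
    (trace (varianceOp X k l ∘L τ)).re = (⟪k, α.val k⟫_ℂ).re * (trace (X ∘L X ∘L β.val)).re -
      (⟪k, α.val l⟫_ℂ).re * (trace (X ∘L β.val)).re -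
      (⟪l, α.val k⟫_ℂ).re * (trace (X ∘L β.val)).re + (⟪l, α.val l⟫_ℂ).re := by
  rw [trace_varianceOp hT, productState_slice h, productState_slice h, productState_slice h,
    productState_slice h]
  simp only [ContinuousLinearMap.comp_smul, trace_smul, β.trace_eq_one,
    ContinuousLinearMap.comp_assoc]
  rw [trace_comp_eq_re β.mem hX, α.inner_eq_re k, α.inner_eq_re l]
  simp only [Complex.sub_re, Complex.add_re, Complex.re_ofReal_mul, Complex.re_mul_ofReal,
    mul_one, Complex.ofReal_re]

/-- In `α ⊗ β`, positivity of `α` at `q k - l` with `q = tr (X β)` shows that `varianceOp` has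
expectation at least `⟪k, α k⟫` times the variance of `X` in `β`. That variance bounds the
commutator. -/
theorem productState_bound {τ : HTensor K H →L[ℂ] HTensor K H} (hτ : τ ∈ productStates K H)
    {X : H →L[ℂ] H} (hX : X.adjoint = X) {k l : K} (hk : ‖k‖ = 1) (M : H →L[ℂ] H) {t : ℝ}
    (ht : 0 < t) :
    ‖trace ((tensorLeft H k ∘L (X ∘L M - M ∘L X) ∘L (tensorLeft H k).adjoint) ∘L τ)‖ ≤
      ‖M‖ * (t + (trace (varianceOp X k l ∘L τ)).re / t) := by
  have hT := subset_traceClass (productStates_subset hτ)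
  obtain ⟨α, β, h⟩ := hτ
  rw [trace_tensorLeft_comp hT, trace_varianceOp_productState hT h hX, productState_slice h,
    ContinuousLinearMap.comp_smul, trace_smul, α.inner_eq_re k, norm_mul, Complex.norm_real,
    Real.norm_of_nonneg (α.re_inner_nonneg k), Complex.ofReal_re]
  have ha0 := α.re_inner_nonneg k
  have ha1 := α.re_inner_le_one hk
  have hvar := norm_trace_commutator_le β.mem hX (trace (X ∘L β.val)).re M ht
  have hpos := α.re_inner_sub k l (trace (X ∘L β.val)).re
  rw [β.trace_eq_one, Complex.one_re, mul_one, mul_one] at hvar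
  generalize (trace (X ∘L β.val)).re = q at *
  generalize (trace (X ∘L X ∘L β.val)).re = V at *
  generalize (⟪k, α.val k⟫_ℂ).re = a at *
  generalize (⟪k, α.val l⟫_ℂ).re = c at *
  generalize (⟪l, α.val k⟫_ℂ).re = d at *
  generalize (⟪l, α.val l⟫_ℂ).re = e at *
  calc _ ≤ a * (‖M‖ * (t + (V - 2 * q * q + q ^ 2) / t)) := by gcongr
    _ = ‖M‖ * (a * t + (a * V - a * q ^ 2) / t) := by field_simp; ring
    _ ≤ _ := by
      gcongr
      · exact mul_le_of_le_one_left ht.le ha1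
      · linarith

/-- The inequality is preserved by convex combinations, and both sides are continuous in trace norm
by Hölder's inequality. -/
theorem State.Separable.norm_trace_le {Θ : State (HTensor K H)} (hΘ : Θ.Separable)
    {E F : HTensor K H →L[ℂ] HTensor K H} {c : ℝ}
    (h : ∀ τ ∈ productStates K H, ‖trace (F ∘L τ)‖ ≤ c + (trace (E ∘L τ)).re) :
    ‖trace (F ∘L Θ.val)‖ ≤ c + (trace (E ∘L Θ.val)).re := by
  have hc : convexHull ℝ (productStates K H) ⊆ {τ | τ ∈ positiveFiniteTrace (HTensor K H) ∧
      ‖trace (F ∘L τ)‖ ≤ c + (trace (E ∘L τ)).re} := by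
    refine convexHull_min (fun τ hτ => ⟨productStates_subset hτ, h τ hτ⟩) ?_
    rintro P ⟨hP, hP'⟩ Q ⟨hQ, hQ'⟩ a b ha hb hab
    rw [← Complex.coe_smul, ← Complex.coe_smul]
    have hPt := subset_traceClass hP
    have hQt := subset_traceClass hQ
    refine ⟨positiveFiniteTrace_add (positiveFiniteTrace_smul hP ha)
      (positiveFiniteTrace_smul hQ hb), ?_⟩
    have e : ∀ A : HTensor K H →L[ℂ] HTensor K H, trace (A ∘L ((a : ℂ) • P + (b : ℂ) • Q)) =
        a * trace (A ∘L P) + b * trace (A ∘L Q) := fun A => by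
      rw [ContinuousLinearMap.comp_add, ContinuousLinearMap.comp_smul,
        ContinuousLinearMap.comp_smul, trace_add
        (Submodule.smul_mem _ _ (comp_left_mem_traceClass hPt A))
        (Submodule.smul_mem _ _ (comp_left_mem_traceClass hQt A)), trace_smul, trace_smul]
    rw [e, e, Complex.add_re, Complex.re_ofReal_mul, Complex.re_ofReal_mul]
    calc _ ≤ a * ‖trace (F ∘L P)‖ + b * ‖trace (F ∘L Q)‖ := by
          refine (norm_add_le _ _).trans_eq ?_
          rw [norm_mul, norm_mul, Complex.norm_real, Complex.norm_real, Real.norm_of_nonneg ha,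
            Real.norm_of_nonneg hb]
      _ ≤ a * (c + (trace (E ∘L P)).re) + b * (c + (trace (E ∘L Q)).re) := by gcongr
      _ = (a + b) * c + (a * (trace (E ∘L P)).re + b * (trace (E ∘L Q)).re) := by ring
      _ = _ := by rw [hab, one_mul]
  refine le_of_forall_pos_le_add fun ε hε => ?_
  obtain ⟨τ, hτ, hd⟩ := hΘ (ε / (‖E‖ + ‖F‖ + 1)) (by positivity)
  obtain ⟨hτp, hb⟩ := hc hτ
  have hτt := subset_traceClass hτp
  have hD : Θ.val - τ ∈ traceClass (HTensor K H) := sub_mem Θ.op.2 hτt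
  have hsa : (Θ.val - τ).adjoint = Θ.val - τ := by
    rw [map_sub, adjoint_eq_of_nonneg Θ.nonneg, adjoint_eq_of_nonneg hτp.1]
  have e : ∀ A : HTensor K H →L[ℂ] HTensor K H,
      trace (A ∘L Θ.val) = trace (A ∘L τ) + trace (A ∘L (Θ.val - τ)) := fun A => by
    rw [← trace_add (comp_left_mem_traceClass hτt A) (comp_left_mem_traceClass hD A),
      ← ContinuousLinearMap.comp_add, add_sub_cancel]
  have hF := norm_trace_comp_le_traceNorm hD hsa F
  have hE := (neg_le_of_abs_le (Complex.abs_re_le_norm _)).trans'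
    (neg_le_neg (norm_trace_comp_le_traceNorm hD hsa E))
  rw [lt_div_iff₀ (by positivity)] at hd
  have h0 : 0 ≤ traceNorm (Θ.val - τ) := by
    rw [traceNorm]
    exact trace_re_nonneg (CFC.abs_nonneg _)
  rw [e F, e E, Complex.add_re]
  refine (norm_add_le _ _).trans ?_
  linarith

/-- A basis of a qubit, lifted to the universe that `Channel.EntanglementBreaking` prescribes for
ancillas. -/
theorem exists_orthonormal_pair : ∃ k l : EuclideanSpace ℂ (ULift.{u} (Fin 2)), ‖k‖ = 1 ∧
    ⟪k, k⟫_ℂ = 1 ∧ ⟪l, l⟫_ℂ = 1 ∧ ⟪k, l⟫_ℂ = 0 ∧ ⟪l, k⟫_ℂ = 0 := by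
  have ho := (EuclideanSpace.basisFun (ULift.{u} (Fin 2)) ℂ).orthonormal
  refine ⟨_, _, ho.1 ⟨0⟩, ?_, ?_, ho.2 (i := ⟨0⟩) (j := ⟨1⟩) (by simp), ho.2 (by simp)⟩
  · rw [inner_self_eq_norm_sq_to_K, ho.1]; simp
  · rw [inner_self_eq_norm_sq_to_K, ho.1]; simp

end EB

/-! ### Fixed states of entanglement breaking channels commute. -/

section EB

theorem commutative_of_entanglementBreaking {H : Type u} [NormedAddCommGroup H]
    [InnerProductSpace ℂ H] [CompleteSpace H] [TopologicalSpace.SeparableSpace H]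
    {S : Set (State H)} {Λ : Channel H H} (hΛ : Λ.EntanglementBreaking)
    (hS : State.op '' S ⊆ Λ.fix) : Commutative S := by
  intro ρ hρ τ hτ
  obtain ⟨X, hX, hXω⟩ := exists_sld ρ τ
  refine commute_of_sld hXω ?_
  set ω := ρ.mix τ with hω
  have hfix : ∀ σ ∈ S, Λ.map σ.op = σ.op := fun σ hσ => hS ⟨σ, hσ, rfl⟩
  have hωfix : Λ.map ω.op = ω.op := by
    rw [hω, State.mix, map_smul, map_add, hfix ρ hρ, hfix τ hτ]
  obtain ⟨k, l, hk, hkk, hll, hkl, hlk⟩ := exists_orthonormal_pair.{u}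
  -- `V = k ⊗ 1 + l ⊗ X`, so `V ω V†` has the blocks `ω`, `ωX`, `Xω`, `XωX`. Its trace is `N = 1 +
  -- tr (X ω X)`.
  set V : H →L[ℂ] HTensor (EuclideanSpace ℂ (ULift.{u} (Fin 2))) H := tensorLeft H k + tensorLeft H l ∘L X with hV
  have hkV : (tensorLeft H k).adjoint ∘L V = .id ℂ H := by
    ext x; simp [V, hkk, hkl, -inner_self_eq_norm_sq_to_K]
  have hlV : (tensorLeft H l).adjoint ∘L V = X := by
    ext x; simp [V, hll, hlk, -inner_self_eq_norm_sq_to_K]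
  have hVk : V.adjoint ∘L tensorLeft H k = .id ℂ H := by
    have := congrArg ContinuousLinearMap.adjoint hkV
    rwa [ContinuousLinearMap.adjoint_comp, ContinuousLinearMap.adjoint_adjoint, ContinuousLinearMap.adjoint_id] at this
  have hVl : V.adjoint ∘L tensorLeft H l = X := by
    have := congrArg ContinuousLinearMap.adjoint hlV
    rwa [ContinuousLinearMap.adjoint_comp, ContinuousLinearMap.adjoint_adjoint, hX] at this
  have hPm := positiveFiniteTrace_conj ω.mem V
  set P := V ∘L ω.val ∘L V.adjoint with hP
  set N := (trace P).re with hN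
  have hVV : V.adjoint ∘L V = .id ℂ H + X ∘L X := by
    conv_lhs => rw [hV, ContinuousLinearMap.comp_add, ← ContinuousLinearMap.comp_assoc]
    rw [hVk, hVl]
  have hNpos : 0 < N := by
    have h1 : trace P = trace (ω.val + X ∘L X ∘L ω.val) := by
      rw [hP, trace_conj ω.op.2, ← ContinuousLinearMap.comp_assoc, hVV,
        ContinuousLinearMap.add_comp, ContinuousLinearMap.id_comp, ContinuousLinearMap.comp_assoc]
    have h2 : X ∘L ω.val ∘L X ∈ positiveFiniteTrace H := by
      simpa [hX] using positiveFiniteTrace_conj ω.mem X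
    have h3 := trace_re_nonneg h2.1
    rw [trace_conj ω.op.2] at h3
    rw [hN, h1, trace_add ω.op.2 (comp_left_mem_traceClass (comp_left_mem_traceClass ω.op.2 X) X),
      ω.trace_eq_one, Complex.add_re, Complex.one_re]
    linarith
  have hNc : (N : ℂ) ≠ 0 := by exact_mod_cast hNpos.ne'
  let Θ₀ : State (HTensor (EuclideanSpace ℂ (ULift.{u} (Fin 2))) H) :=
    { op := ⟨((N⁻¹ : ℝ) : ℂ) • P, Submodule.smul_mem _ _ (subset_traceClass hPm)⟩
      nonneg := (positiveFiniteTrace_smul hPm (by positivity)).1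
      trace_eq_one := by
        change trace (((N⁻¹ : ℝ) : ℂ) • P) = 1
        rw [trace_smul, trace_eq_re hPm.1]
        push_cast
        exact inv_mul_cancel₀ hNc }
  obtain ⟨Θ, hamp, hsep⟩ := hΛ _ Θ₀
  have hsl : ∀ x x' : EuclideanSpace ℂ (ULift.{u} (Fin 2)), (tensorLeft H x).adjoint ∘L Θ.val ∘L tensorLeft H x' =
      (Λ.map (slice Θ₀.op x x')).1 := fun x x' => congrArg Subtype.val (hamp x x')
  let ωX : traceClass H := ⟨ω.val ∘L X, comp_right_mem_traceClass ω.op.2 X⟩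
  let Xω : traceClass H := ⟨X ∘L ω.val, comp_left_mem_traceClass ω.op.2 X⟩
  let XωX : traceClass H := ⟨X ∘L ω.val ∘L X, comp_mem_traceClass ω.op.2 X X⟩
  have hslice : ∀ (x x' : EuclideanSpace ℂ (ULift.{u} (Fin 2))) (A B : H →L[ℂ] H), (tensorLeft H x).adjoint ∘L V = A →
      V.adjoint ∘L tensorLeft H x' = B → (slice Θ₀.op x x').1 =
      ((N⁻¹ : ℝ) : ℂ) • (A ∘L ω.val ∘L B) := fun x x' A B hA hB => by
    change (tensorLeft H x).adjoint ∘L (((N⁻¹ : ℝ) : ℂ) • P) ∘L tensorLeft H x' = _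
    rw [ContinuousLinearMap.smul_comp, ContinuousLinearMap.comp_smul, hP, ← hA, ← hB]
    simp only [ContinuousLinearMap.comp_assoc]
  have h00 : slice Θ₀.op k k = ((N⁻¹ : ℝ) : ℂ) • ω.op :=
    Subtype.ext (by simpa using hslice k k _ _ hkV hVk)
  have h01 : slice Θ₀.op k l = ((N⁻¹ : ℝ) : ℂ) • ωX :=
    Subtype.ext (by simpa using hslice k l _ _ hkV hVl)
  have h10 : slice Θ₀.op l k = ((N⁻¹ : ℝ) : ℂ) • Xω :=
    Subtype.ext (by simpa using hslice l k _ _ hlV hVk)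
  have h11 : slice Θ₀.op l l = ((N⁻¹ : ℝ) : ℂ) • XωX :=
    Subtype.ext (by simpa using hslice l l _ _ hlV hVl)
  -- Up to the factor `1/N` the value is `tr (X² ω) - 2 tr (X ρ) + tr (X ω X)`, using that `Λ` fixes
  -- `ω` and `ρ` and preserves the trace; this vanishes by `trace_sld`.
  have hE : trace (varianceOp X k l ∘L Θ.val) = 0 := by
    rw [trace_varianceOp Θ.op.2, hsl, hsl, hsl, hsl, h00, h01, h10, h11]
    simp only [map_smul, Submodule.coe_smul, ContinuousLinearMap.comp_smul, trace_smul, hωfix]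
    have hsum : (Λ.map ωX).1 + (Λ.map Xω).1 = ρ.val + ρ.val := by
      have : ωX + Xω = ρ.op + ρ.op := Subtype.ext hXω
      rw [← Submodule.coe_add, ← map_add, this, map_add, hfix ρ hρ]
      rfl
    have hsum' : trace (X ∘L (Λ.map ωX).1) + trace (X ∘L (Λ.map Xω).1) =
        trace (X ∘L ρ.val) + trace (X ∘L ρ.val) := by
      rw [← trace_add (comp_left_mem_traceClass (Λ.map ωX).2 X)
        (comp_left_mem_traceClass (Λ.map Xω).2 X), ← ContinuousLinearMap.comp_add, hsum,
        ContinuousLinearMap.comp_add, trace_add (comp_left_mem_traceClass ρ.op.2 X)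
        (comp_left_mem_traceClass ρ.op.2 X)]
    have h5 : trace (Λ.map XωX).1 = trace (X ∘L X ∘L ω.val) := by
      rw [Λ.trace_map, trace_conj ω.op.2]
    have h6 := trace_sld ω.op.2 ρ.op.2 hXω
    rw [h5, ContinuousLinearMap.comp_assoc]
    linear_combination (-((N⁻¹ : ℝ) : ℂ)) * hsum' - 2 * ((N⁻¹ : ℝ) : ℂ) * h6
  refine comm_of_trace_bound ω.op.2 fun M t ht => ?_
  -- The parameter `t / N` absorbs the normalization `1/N` of the `k, k` block `ω / N`.
  have hs : 0 < t / N := by positivity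
  have hb := hsep.norm_trace_le (E := ((‖M‖ / (t / N) : ℝ) : ℂ) • varianceOp X k l)
    (F := tensorLeft H k ∘L (X ∘L M - M ∘L X) ∘L (tensorLeft H k).adjoint) (c := ‖M‖ * (t / N))
    fun τ hτ => by
      refine (productState_bound (l := l) hτ hX hk M hs).trans_eq ?_
      rw [ContinuousLinearMap.smul_comp, trace_smul, Complex.re_ofReal_mul]
      ring
  rw [ContinuousLinearMap.smul_comp, trace_smul, hE, mul_zero, Complex.zero_re, add_zero,
    trace_tensorLeft_comp Θ.op.2, hsl, h00, map_smul, hωfix, Submodule.coe_smul,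
    ContinuousLinearMap.comp_smul, trace_smul, norm_mul, Complex.norm_real,
    Real.norm_of_nonneg (by positivity), ← mul_div_assoc, inv_mul_le_iff₀ hNpos,
    mul_div_cancel₀ _ hNpos.ne'] at hb
  exact hb

end EB

/-! ### A classical variational inequality for Fisher information. -/

section FiniteMeasure

variable {Ω : Type*} [MeasurableSpace Ω]

/-- On each level set of `g` the hypothesis is used with `q` equal to the value of `g` there. -/
theorem two_mul_integral_simpleFunc_le {μ ν κ : Measure Ω} [IsFiniteMeasure μ]
    [IsFiniteMeasure ν] [IsFiniteMeasure κ]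
    (h : ∀ (q : ℝ) (Y : Set Ω), MeasurableSet Y → 2 * q * μ.real Y ≤ q ^ 2 * ν.real Y + κ.real Y)
    (g : SimpleFunc Ω ℝ) : 2 * ∫ x, g x ∂μ ≤ ∫ x, g x ^ 2 ∂ν + κ.real Set.univ := by
  have h1 : ∫ x, g x ∂μ = ∑ x ∈ g.range, μ.real (g ⁻¹' {x}) * x := by
    rw [← SimpleFunc.integral_eq_integral g (g.integrable_of_isFiniteMeasure)]
    rfl
  have h2 : ∫ x, g x ^ 2 ∂ν = ∑ x ∈ g.range, ν.real (g ⁻¹' {x}) * x ^ 2 := by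
    have := SimpleFunc.map_integral (μ := ν) g (fun x => x ^ 2) g.integrable_of_isFiniteMeasure
      (by simp)
    rw [SimpleFunc.integral_eq_integral _ (SimpleFunc.integrable_of_isFiniteMeasure _)] at this
    simpa using this
  have h3 : κ.real Set.univ = ∑ x ∈ g.range, κ.real (g ⁻¹' {x}) := by
    simp only [Measure.real]
    rw [← SimpleFunc.sum_range_measure_preimage_singleton g κ,
      ENNReal.toReal_sum fun _ _ => measure_ne_top _ _]
  rw [h1, h2, h3, ← Finset.sum_add_distrib, Finset.mul_sum]
  refine Finset.sum_le_sum fun x _ => ?_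
  have := h x _ (g.measurableSet_fiber x)
  linarith

theorem two_mul_integral_le {μ ν κ : Measure Ω} [IsFiniteMeasure μ]
    [IsFiniteMeasure ν] [IsFiniteMeasure κ]
    (h : ∀ (q : ℝ) (Y : Set Ω), MeasurableSet Y → 2 * q * μ.real Y ≤ q ^ 2 * ν.real Y + κ.real Y)
    {f : Ω → ℝ} (hf : Measurable f) {C : ℝ} (hC : ∀ x, |f x| ≤ C) :
    2 * ∫ x, f x ∂μ ≤ ∫ x, f x ^ 2 ∂ν + κ.real Set.univ := by
  have hs := hf.stronglyMeasurable
  have hC' : ∀ x, ‖f x‖ ≤ |C| := fun x => (hC x).trans (le_abs_self C)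
  have hb := fun n x => StronglyMeasurable.norm_approxBounded_le hs (abs_nonneg C) n x
  have ht := fun x => StronglyMeasurable.tendsto_approxBounded_of_norm_le hs (hC' x)
  refine le_of_tendsto_of_tendsto' (b := atTop) (f := fun n => 2 * ∫ x, hs.approxBounded |C| n x ∂μ)
    (g := fun n => ∫ x, hs.approxBounded |C| n x ^ 2 ∂ν + κ.real Set.univ)
    ?_ ?_ fun n => two_mul_integral_simpleFunc_le h (hs.approxBounded |C| n)
  · refine Tendsto.const_mul _ (tendsto_integral_of_dominated_convergence (fun _ => |C|)
      (fun n => (SimpleFunc.stronglyMeasurable _).aestronglyMeasurable) (integrable_const _)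
      (fun n => .of_forall (hb n)) (.of_forall ht))
  · refine Tendsto.add_const _ (tendsto_integral_of_dominated_convergence (fun _ => |C| ^ 2)
      (fun n => ((SimpleFunc.stronglyMeasurable _).pow 2).aestronglyMeasurable)
      (integrable_const _) (fun n => .of_forall fun x => ?_)
      (.of_forall fun x => (ht x).pow 2))
    rw [norm_pow]
    exact pow_le_pow_left₀ (norm_nonneg _) (hb n x) 2

end FiniteMeasure

/-! ### Contextuality non-confirming sets are commutative. -/

section NonConfirming

variable {H : Type u} [NormedAddCommGroup H] [InnerProductSpace ℂ H] [CompleteSpace H]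
variable {Ω : Type} [MeasurableSpace Ω]

instance (G : POVM H Ω) (ρ : State H) : IsProbabilityMeasure (G.prob ρ) :=
  (G.exists_prob ρ).choose_spec.1

theorem POVM.trace_effect (G : POVM H Ω) (ρ : State H) {Y : Set Ω} (hY : MeasurableSet Y) :
    trace (ρ.val ∘L G.effect Y) = ((G.prob ρ).real Y : ℂ) :=
  (G.exists_prob ρ).choose_spec.2 Y hY

/-- A positive trace class operator is a multiple of a state. -/
theorem exists_state {P : H →L[ℂ] H} (hP : P ∈ positiveFiniteTrace H) (h : (trace P).re ≠ 0) :
    ∃ α : State H, P = ((trace P).re : ℂ) • α.val := by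
  have h0 := trace_re_nonneg hP.1
  have he := trace_eq_re hP.1
  have hc : (((trace P).re : ℝ) : ℂ) ≠ 0 := by exact_mod_cast h
  refine ⟨{ op := ⟨(((trace P).re⁻¹ : ℝ) : ℂ) • P, Submodule.smul_mem _ _ (subset_traceClass hP)⟩
            nonneg := (positiveFiniteTrace_smul hP (by positivity)).1
            trace_eq_one := ?_ }, ?_⟩
  · change trace ((((trace P).re⁻¹ : ℝ) : ℂ) • P) = 1
    rw [trace_smul, Complex.ofReal_inv]
    nth_rw 2 [he]
    exact inv_mul_cancel₀ hc
  · change P = ((trace P).re : ℂ) • ((((trace P).re⁻¹ : ℝ) : ℂ) • P)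
    rw [smul_smul, Complex.ofReal_inv, mul_inv_cancel₀ hc, one_smul]

theorem POVM.exists_measure (G : POVM H Ω) {P : H →L[ℂ] H} (hP : P ∈ positiveFiniteTrace H) :
    ∃ κ : Measure Ω, IsFiniteMeasure κ ∧ (κ.real Set.univ = (trace P).re) ∧
      ∀ Y, MeasurableSet Y → trace (P ∘L G.effect Y) = (κ.real Y : ℂ) := by
  have h0 := trace_re_nonneg hP.1
  rcases eq_or_ne (trace P).re 0 with h | h
  · have hP0 : P = 0 := eq_zero_of_trace_eq_zero hP h
    refine ⟨0, inferInstance, by simp [h], fun Y _ => ?_⟩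
    rw [hP0, ContinuousLinearMap.zero_comp, trace_zero]
    simp
  · obtain ⟨ρ, hρ⟩ := exists_state hP h
    refine ⟨ENNReal.ofReal (trace P).re • G.prob ρ,
      Measure.smul_finite _ ENNReal.ofReal_ne_top, ?_, fun Y hY => ?_⟩
    · simp [Measure.real, h0]
    · conv_lhs => rw [hρ]
      rw [ContinuousLinearMap.smul_comp, trace_smul, G.trace_effect ρ hY]
      simp [Measure.real, ENNReal.toReal_ofReal h0]

theorem POVM.prob_mix (G : POVM H Ω) (ρ τ : State H) :
    G.prob (ρ.mix τ) + G.prob (ρ.mix τ) = G.prob ρ + G.prob τ := by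
  ext Y hY
  have h := G.trace_effect (ρ.mix τ) hY
  have h2 : trace (((ρ.mix τ).val + (ρ.mix τ).val) ∘L G.effect Y) =
      trace ((ρ.val + τ.val) ∘L G.effect Y) := by rw [State.mix_add]
  have hm := fun σ : State H => comp_right_mem_traceClass σ.op.2 (G.effect Y)
  rw [ContinuousLinearMap.add_comp, ContinuousLinearMap.add_comp, trace_add (hm _) (hm _),
    trace_add (hm _) (hm _), G.trace_effect _ hY, G.trace_effect _ hY, G.trace_effect _ hY] at h2
  have h3 : (G.prob (ρ.mix τ) + G.prob (ρ.mix τ)).real Y = (G.prob ρ + G.prob τ).real Y := by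
    rw [measureReal_add_apply, measureReal_add_apply]
    exact_mod_cast h2
  exact (measureReal_eq_measureReal_iff).1 h3

theorem State.norm_trace_comp_le_opNorm (σ : State H) (A : H →L[ℂ] H) :
    ‖trace (A ∘L σ.val)‖ ≤ ‖A‖ := by
  have h := norm_trace_comp_le σ.mem A
  rwa [σ.trace_eq_one, Complex.one_re, mul_one] at h

theorem measurable_trace_comp {σ : Ω → State H}
    (hσ : ∀ A : H →L[ℂ] H, Measurable fun l => trace ((σ l).val ∘L A)) (A : H →L[ℂ] H) :
    Measurable fun l => trace (A ∘L (σ l).val) := by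
  simpa only [trace_comm (σ _).op.2] using hσ A

theorem integrable_trace_comp {σ : Ω → State H}
    (hσ : ∀ A : H →L[ℂ] H, Measurable fun l => trace ((σ l).val ∘L A))
    (A : H →L[ℂ] H) (μ : Measure Ω) [IsFiniteMeasure μ] :
    Integrable (fun l => trace (A ∘L (σ l).val)) μ :=
  .of_bound (measurable_trace_comp hσ A).aestronglyMeasurable ‖A‖
    (.of_forall fun l => (σ l).norm_trace_comp_le_opNorm A)

theorem trace_eq_integral {σ : Ω → State H}
    (hσ : ∀ A : H →L[ℂ] H, Measurable fun l => trace ((σ l).val ∘L A)) (μ : Measure Ω)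
    [IsFiniteMeasure μ] (T : traceClass H)
    (h : ∀ M : H →L[ℂ] H, 0 ≤ M → M ≤ 1 → trace (M ∘L T.1) = ∫ l, trace (M ∘L (σ l).val) ∂μ)
    (M : H →L[ℂ] H) : trace (M ∘L T.1) = ∫ l, trace (M ∘L (σ l).val) ∂μ := by
  let g : (H →L[ℂ] H) →ₗ[ℂ] ℂ :=
    { toFun := fun M => ∫ l, trace (M ∘L (σ l).val) ∂μ
      map_add' := fun M N => by
        rw [← integral_add (integrable_trace_comp hσ M μ) (integrable_trace_comp hσ N μ)]
        refine integral_congr_ae (.of_forall fun l => ?_)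
        exact (traceComp (σ l).op).map_add M N
      map_smul' := fun c M => by
        rw [RingHom.id_apply, ← integral_smul]
        refine integral_congr_ae (.of_forall fun l => ?_)
        exact (traceComp (σ l).op).map_smul c M }
  exact LinearMap.congr_fun (linear_eq_of_effects (f := traceComp T) (g := g) h) M

/-- The positive operator `(q - X) ω (q - X)` is paired with the effect of `Y`; its cross terms are
`-q (ωX + Xω) = -2qρ`. -/
theorem POVM.sld_inequality (G : POVM H Ω) {ρ ω : State H} {X : H →L[ℂ] H}
    (hX : X.adjoint = X) (hXω : ω.val ∘L X + X ∘L ω.val = ρ.val + ρ.val) {κ : Measure Ω}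
    (hκ : ∀ Y, MeasurableSet Y → trace ((X ∘L ω.val ∘L X) ∘L G.effect Y) = (κ.real Y : ℂ))
    (q : ℝ) {Y : Set Ω} (hY : MeasurableSet Y) :
    2 * q * (G.prob ρ).real Y ≤ q ^ 2 * (G.prob ω).real Y + κ.real Y := by
  set Z : H →L[ℂ] H := (q : ℂ) • ContinuousLinearMap.id ℂ H - X with hZ
  have hZsa : Z.adjoint = Z := by
    rw [hZ, map_sub, hX, LinearIsometryEquiv.map_smulₛₗ, ContinuousLinearMap.adjoint_id,
      Complex.conj_ofReal]
  have hP : Z ∘L ω.val ∘L Z ∈ positiveFiniteTrace H := by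
    simpa only [hZsa] using positiveFiniteTrace_conj ω.mem Z
  have hP0 := trace_comp_nonneg hP (G.nonneg Y hY)
  rw [← trace_comm (subset_traceClass hP)] at hP0
  have e : Z ∘L ω.val ∘L Z =
      ((q : ℂ) ^ 2) • ω.val - (q : ℂ) • (ρ.val + ρ.val) + X ∘L ω.val ∘L X := by
    rw [← hXω]
    ext x
    simp only [hZ, ContinuousLinearMap.comp_apply, sub_apply, add_apply, smul_apply,
      ContinuousLinearMap.id_apply, map_sub, map_smul, smul_sub, smul_smul]
    module
  have hm := fun T : traceClass H => comp_right_mem_traceClass T.2 (G.effect Y)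
  have hm' := comp_right_mem_traceClass (comp_mem_traceClass ω.op.2 X X) (G.effect Y)
  rw [e, ContinuousLinearMap.add_comp, ContinuousLinearMap.sub_comp, ContinuousLinearMap.smul_comp,
    ContinuousLinearMap.smul_comp, ContinuousLinearMap.add_comp,
    trace_add (sub_mem (Submodule.smul_mem _ _ (hm ω.op))
      (Submodule.smul_mem _ _ (add_mem (hm ρ.op) (hm ρ.op)))) hm',
    trace_sub (Submodule.smul_mem _ _ (hm ω.op))
      (Submodule.smul_mem _ _ (add_mem (hm ρ.op) (hm ρ.op))), trace_smul, trace_smul,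
    trace_add (hm ρ.op) (hm ρ.op), hκ Y hY, G.trace_effect _ hY, G.trace_effect _ hY] at hP0
  have h1 : 0 ≤ q ^ 2 * (G.prob ω).real Y -
      q * ((G.prob ρ).real Y + (G.prob ρ).real Y) + κ.real Y := by exact_mod_cast hP0
  linarith

theorem commutative_of_nonConfirming [TopologicalSpace.SeparableSpace H] {S : Set (State H)}
    (h : ContextualityNonConfirming S) : Commutative S := by
  obtain ⟨Ω, _, _, G, σ, hσ, hG⟩ := h
  intro ρ hρ τ hτ
  obtain ⟨X, hX, hXω⟩ := exists_sld ρ τ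
  refine commute_of_sld hXω ?_
  set ω := ρ.mix τ with hω
  have hrep : ∀ s ∈ S, ∀ M : H →L[ℂ] H,
      trace (M ∘L s.val) = ∫ l, trace (M ∘L (σ l).val) ∂(G.prob s) := fun s hs =>
    trace_eq_integral hσ (G.prob s) s.op fun M h0 h1 => by
      have h2 := hG s hs Bool _ inferInstance (binaryPOVM h0 h1) {true} (by measurability)
      rwa [binaryPOVM_effect, trace_comm s.op.2] at h2
  have hrepω : ∀ M : H →L[ℂ] H,
      trace (M ∘L ω.val) = ∫ l, trace (M ∘L (σ l).val) ∂(G.prob ω) := fun M => by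
    have h1 : trace (M ∘L (ω.val + ω.val)) = trace (M ∘L (ρ.val + τ.val)) := by
      rw [State.mix_add]
    have hm := fun σ : State H => comp_left_mem_traceClass σ.op.2 M
    have hi := fun s => integrable_trace_comp hσ M (G.prob s)
    rw [ContinuousLinearMap.comp_add, ContinuousLinearMap.comp_add, trace_add (hm _) (hm _),
      trace_add (hm _) (hm _), hrep ρ hρ, hrep τ hτ, ← integral_add_measure (hi _) (hi _),
      ← G.prob_mix, integral_add_measure (hi _) (hi _), ← two_mul, ← two_mul] at h1
    exact mul_left_cancel₀ two_ne_zero h1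
  have hXωX : X ∘L ω.val ∘L X ∈ positiveFiniteTrace H := by
    simpa only [hX] using positiveFiniteTrace_conj ω.mem X
  obtain ⟨κ, _, hκ, hκY⟩ := G.exists_measure hXωX
  set f : Ω → ℝ := fun l => (trace (X ∘L (σ l).val)).re with hf
  have hfm : Measurable f := Complex.measurable_re.comp (measurable_trace_comp hσ X)
  have hfb : ∀ l, |f l| ≤ ‖X‖ := fun l =>
    (Complex.abs_re_le_norm _).trans ((σ l).norm_trace_comp_le_opNorm X)
  have hre : ∀ (s : State H) (M : H →L[ℂ] H),
      ∫ l, (trace (M ∘L (σ l).val)).re ∂(G.prob s) =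
        (∫ l, trace (M ∘L (σ l).val) ∂(G.prob s)).re := fun s M =>
    integral_re (integrable_trace_comp hσ M _)
  -- Since `∫ f` for `ρ` and the total mass of `κ` both equal `J = tr (X² ω)`, this says `J ≤ ∫ f²`
  -- for `ω`.
  have hineq := two_mul_integral_le (fun q Y hY => G.sld_inequality hX hXω hκY q hY) hfm hfb
  rw [hκ, trace_conj ω.op.2, hre ρ X, ← hrep ρ hρ, trace_sld ω.op.2 ρ.op.2 hXω] at hineq
  have hXX := hre ω (X ∘L X)
  rw [← hrepω, ContinuousLinearMap.comp_assoc] at hXX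
  have hif : Integrable (fun l => f l ^ 2) (G.prob ω) :=
    .of_bound (hfm.pow_const 2).aestronglyMeasurable (‖X‖ ^ 2) (.of_forall fun l => by
      rw [norm_pow]
      exact pow_le_pow_left₀ (norm_nonneg _) (hfb l) 2)
  have hiX : Integrable (fun l => (trace ((X ∘L X) ∘L (σ l).val)).re) (G.prob ω) :=
    (integrable_trace_comp hσ (X ∘L X) _).re
  refine comm_of_trace_bound ω.op.2 fun M t ht => ?_
  rw [hrepω]
  -- With `q = f l`, the mean of `X` in `σ l`, the bound involves the variance of `X` in `σ l`.
  -- These variances integrate to `J - ∫ f² ≤ 0`, leaving only `‖M‖ t`.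
  have hbd : ∀ l, ‖trace ((X ∘L M - M ∘L X) ∘L (σ l).val)‖ ≤
      ‖M‖ * (t + ((trace ((X ∘L X) ∘L (σ l).val)).re - f l ^ 2) / t) := fun l => by
    refine (norm_trace_commutator_le (σ l).mem hX (f l) M ht).trans_eq ?_
    rw [(σ l).trace_eq_one, Complex.one_re, ContinuousLinearMap.comp_assoc]
    simp only [hf]
    ring
  have hid : Integrable (fun l => ((trace ((X ∘L X) ∘L (σ l).val)).re - f l ^ 2) / t)
      (G.prob ω) := (hiX.sub hif).div_const t
  calc _ ≤ ∫ l, ‖M‖ * (t + ((trace ((X ∘L X) ∘L (σ l).val)).re - f l ^ 2) / t) ∂(G.prob ω) :=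
        norm_integral_le_of_norm_le (((integrable_const t).add hid).const_mul ‖M‖)
          (.of_forall hbd)
    _ = ‖M‖ * (t + ((trace (X ∘L X ∘L ω.val)).re - ∫ l, f l ^ 2 ∂(G.prob ω)) / t) := by
        rw [integral_const_mul, integral_add (integrable_const t) hid, integral_const,
          integral_div, integral_sub hiX hif, hXX]
        simp
    _ ≤ ‖M‖ * t := by
        refine mul_le_mul_of_nonneg_left ?_ (norm_nonneg M)
        have : ((trace (X ∘L X ∘L ω.val)).re - ∫ l, f l ^ 2 ∂(G.prob ω)) / t ≤ 0 :=
          div_nonpos_of_nonpos_of_nonneg (by linarith) ht.le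
        linarith

end NonConfirming

/-! ### Measure-and-prepare channels; commutative sets are broadcastable. -/

section MeasurePrepare

variable {H : Type u} [NormedAddCommGroup H] [InnerProductSpace ℂ H] [CompleteSpace H]
variable {K : Type v} [NormedAddCommGroup K] [InnerProductSpace ℂ K] [CompleteSpace K]
variable {ι : Type*}

/-- The pure state of a unit vector. -/
noncomputable def pureState (x : H) (hx : ‖x‖ = 1) : State H where
  op := ⟨InnerProductSpace.rankOne ℂ x x, subset_traceClass (rankOne_mem x)⟩
  nonneg := (rankOne_mem x).1
  trace_eq_one := by
    change trace (InnerProductSpace.rankOne ℂ x x) = 1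
    rw [trace_rankOne, inner_self_eq_norm_sq_to_K, hx]
    simp

theorem trace_comp_pureState (M : H →L[ℂ] H) (x : H) (hx : ‖x‖ = 1) :
    trace (M ∘L (pureState x hx).val) = ⟪x, M x⟫_ℂ :=
  trace_comp_rankOne M x x

theorem hasSum_trace_comp_of_eigenbasis (b : HilbertBasis ι ℂ H) {T : H →L[ℂ] H}
    (hT : T ∈ traceClass H) (h : ∀ i, ∃ c : ℂ, T (b i) = c • b i) (M : H →L[ℂ] H) :
    HasSum (fun i => ⟪b i, T (b i)⟫_ℂ * ⟪b i, M (b i)⟫_ℂ) (trace (M ∘L T)) := by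
  convert hasSum_trace (comp_left_mem_traceClass hT M) b using 2 with i
  obtain ⟨c, hc⟩ := h i
  rw [ContinuousLinearMap.comp_apply, hc, map_smul, inner_smul_right, inner_smul_right,
    inner_self_eq_norm_sq_to_K, b.orthonormal.1 i]
  simp

theorem exists_hasSum_measurePrepare (b : HilbertBasis ι ℂ H) {v : ι → K} (hv : ∀ i, ‖v i‖ = 1)
    {T : H →L[ℂ] H} (hT : T ∈ traceClass H) :
    ∃ S ∈ traceClass K,
      HasSum (fun i => ⟪b i, T (b i)⟫_ℂ • InnerProductSpace.rankOne ℂ (v i) (v i)) S ∧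
      ∀ M : K →L[ℂ] K, HasSum (fun i => ⟪b i, T (b i)⟫_ℂ * ⟪v i, M (v i)⟫_ℂ)
        (trace (M ∘L S)) := by
  induction hT using Submodule.span_induction with
  | mem T hT =>
    have hre : ∀ i, ⟪b i, T (b i)⟫_ℂ = ((‖CFC.sqrt T (b i)‖ ^ 2 : ℝ) : ℂ) := fun i =>
      inner_eq_norm_sqrt_sq hT.1 _
    simp only [hre]
    obtain ⟨S, hS, h1, h2⟩ := exists_hasSum_positive
      (P := fun i => ((‖CFC.sqrt T (b i)‖ ^ 2 : ℝ) : ℂ) •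
        InnerProductSpace.rankOne ℂ (v i) (v i))
      (fun i => positiveFiniteTrace_smul (rankOne_mem (v i)) (by positivity)) (by
        simp only [trace_smul, trace_rankOne, inner_self_eq_norm_sq_to_K, hv]
        simpa [← Complex.ofReal_pow] using (hasSum_norm_sqrt_sq hT b).summable)
    refine ⟨S, subset_traceClass hS, h1, fun M => ?_⟩
    simpa only [ContinuousLinearMap.comp_smul, trace_smul, trace_comp_rankOne] using h2 M
  | zero => exact ⟨0, zero_mem _, by simp, fun M => by simp⟩
  | add T T' _ _ hT hT' =>
    obtain ⟨S, hS, h1, h2⟩ := hT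
    obtain ⟨S', hS', h1', h2'⟩ := hT'
    refine ⟨S + S', add_mem hS hS', ?_, fun M => ?_⟩
    · simpa only [add_apply, inner_add_right, add_smul] using h1.add h1'
    · rw [ContinuousLinearMap.comp_add, trace_add (comp_left_mem_traceClass hS M)
        (comp_left_mem_traceClass hS' M)]
      simpa only [add_apply, inner_add_right, add_mul] using (h2 M).add (h2' M)
  | smul c T _ hT =>
    obtain ⟨S, hS, h1, h2⟩ := hT
    refine ⟨c • S, Submodule.smul_mem _ c hS, ?_, fun M => ?_⟩
    · simpa only [smul_apply, inner_smul_right, mul_smul] using h1.const_smul c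
    · rw [ContinuousLinearMap.comp_smul, trace_smul]
      simpa only [smul_apply, inner_smul_right, mul_assoc] using (h2 M).mul_left c

/-- The operator `∑ᵢ ⟪bᵢ, T bᵢ⟫ |vᵢ⟩⟨vᵢ|`. -/
noncomputable def prepared (b : HilbertBasis ι ℂ H) {v : ι → K} (hv : ∀ i, ‖v i‖ = 1)
    (T : traceClass H) : traceClass K :=
  ⟨(exists_hasSum_measurePrepare b hv T.2).choose,
    (exists_hasSum_measurePrepare b hv T.2).choose_spec.1⟩

theorem hasSum_prepared (b : HilbertBasis ι ℂ H) {v : ι → K} (hv : ∀ i, ‖v i‖ = 1)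
    (T : traceClass H) :
    HasSum (fun i => ⟪b i, T.1 (b i)⟫_ℂ • InnerProductSpace.rankOne ℂ (v i) (v i))
      (prepared b hv T).1 :=
  (exists_hasSum_measurePrepare b hv T.2).choose_spec.2.1

theorem hasSum_trace_prepared (b : HilbertBasis ι ℂ H) {v : ι → K} (hv : ∀ i, ‖v i‖ = 1)
    (T : traceClass H) (M : K →L[ℂ] K) :
    HasSum (fun i => ⟪b i, T.1 (b i)⟫_ℂ * ⟪v i, M (v i)⟫_ℂ)
      (trace (M ∘L (prepared b hv T).1)) :=
  (exists_hasSum_measurePrepare b hv T.2).choose_spec.2.2 M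

/-- The channel that measures in the basis `b` and prepares the pure state `v i` upon outcome
`i`. -/
noncomputable def measurePrepare (b : HilbertBasis ι ℂ H) {v : ι → K} (hv : ∀ i, ‖v i‖ = 1) :
    Channel H K where
  map :=
    { toFun := prepared b hv
      map_add' := fun S T => Subtype.ext <| (hasSum_prepared b hv (S + T)).unique <| by
        simpa only [Submodule.coe_add, add_apply, inner_add_right, add_smul] using
          (hasSum_prepared b hv S).add (hasSum_prepared b hv T)
      map_smul' := fun c T => Subtype.ext <| (hasSum_prepared b hv (c • T)).unique <| by
        simpa only [Submodule.coe_smul, smul_apply, inner_smul_right, mul_smul, RingHom.id_apply,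
          smul_eq_mul] using (hasSum_prepared b hv T).const_smul c }
  completelyPositive n T hT y := by
    have h : HasSum (fun k => ∑ i, ∑ j, ⟪b k, (T i j).1 (b k)⟫_ℂ * (⟪v k, y j⟫_ℂ * ⟪y i, v k⟫_ℂ))
        (∑ i, ∑ j, ⟪y i, (prepared b hv (T i j)).1 (y j)⟫_ℂ) := by
      refine hasSum_sum fun i _ => hasSum_sum fun j _ => ?_
      have h1 := ((hasSum_prepared b hv (T i j)).mapL
        (ContinuousLinearMap.apply ℂ K (y j))).mapL (innerSL ℂ (y i))
      simpa only [ContinuousLinearMap.apply_apply, innerSL_apply_apply, smul_apply,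
        inner_smul_right, InnerProductSpace.rankOne_apply] using h1
    -- The contribution of outcome `k` is the positive input form at the vectors `⟪v k, y j⟫ • b k`.
    refine h.nonneg fun k => ?_
    have h2 := hT fun j => ⟪v k, y j⟫_ℂ • b k
    convert h2 using 4 with i _ j _
    rw [map_smul, inner_smul_left, inner_smul_right, inner_conj_symm]
    ring
  trace_map T := by
    have h1 := hasSum_trace_prepared b hv T (.id ℂ K)
    simp only [ContinuousLinearMap.id_apply, inner_self_eq_norm_sq_to_K, hv,
      ContinuousLinearMap.id_comp] at h1
    refine h1.unique ?_
    simpa using hasSum_trace T.2 b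

theorem hasSum_measurePrepare (b : HilbertBasis ι ℂ H) {v : ι → K} (hv : ∀ i, ‖v i‖ = 1)
    (T : traceClass H) :
    HasSum (fun i => ⟪b i, T.1 (b i)⟫_ℂ • InnerProductSpace.rankOne ℂ (v i) (v i))
      ((measurePrepare b hv).map T).1 :=
  hasSum_prepared b hv T

theorem hasSum_trace_measurePrepare (b : HilbertBasis ι ℂ H) {v : ι → K} (hv : ∀ i, ‖v i‖ = 1)
    (T : traceClass H) (M : K →L[ℂ] K) :
    HasSum (fun i => ⟪b i, T.1 (b i)⟫_ℂ * ⟪v i, M (v i)⟫_ℂ)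
      (trace (M ∘L ((measurePrepare b hv).map T).1)) :=
  hasSum_trace_prepared b hv T M

/-- An operator diagonal in `b` is determined by the diagonal entries that the measurement reads
out. -/
theorem measurePrepare_fix (b : HilbertBasis ι ℂ H) (T : traceClass H)
    (h : ∀ i, ∃ c : ℂ, T.1 (b i) = c • b i) : (measurePrepare b b.orthonormal.1).map T = T := by
  refine Subtype.ext (comp_left_eq_of_trace fun M => ?_)
  rw [trace_comm (Subtype.property _), trace_comm T.2]
  exact (hasSum_trace_measurePrepare b _ T M).unique (hasSum_trace_comp_of_eigenbasis b T.2 h M)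

theorem exists_eigenbasis_of_commutative [TopologicalSpace.SeparableSpace H] {S : Set (State H)}
    (hS : Commutative S) : ∃ (ι : Type) (_ : Countable ι) (b : HilbertBasis ι ℂ H),
      ∀ ρ ∈ S, ∀ i, ∃ c : ℂ, ρ.val (b i) = c • b i := by
  obtain ⟨ι, hι, b, hb⟩ := exists_joint_eigenbasis (S := State.val '' S)
    (by rintro _ ⟨ρ, -, rfl⟩; exact isCompactOperator_of_positiveFiniteTrace ρ.mem)
    (by
      rintro _ ⟨ρ, -, rfl⟩ x y
      exact (ContinuousLinearMap.nonneg_iff_isPositive _).1 ρ.nonneg |>.isSymmetric x y)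
    (by rintro _ ⟨ρ, hρ, rfl⟩ _ ⟨τ, hτ, rfl⟩; exact hS ρ hρ τ hτ)
  exact ⟨ι, hι, b, fun ρ hρ => hb _ ⟨ρ, hρ, rfl⟩⟩

theorem broadcastable_of_commutative [TopologicalSpace.SeparableSpace H] {S : Set (State H)}
    (hS : Commutative S) : Broadcastable S := by
  obtain ⟨ι, -, b, hb⟩ := exists_eigenbasis_of_commutative hS
  have hv : ∀ i, ‖(tmul (b i) (b i) : HTensor H H)‖ = 1 := fun i => by
    rw [← sq_eq_sq₀ (norm_nonneg _) zero_le_one, ← Complex.ofReal_inj, Complex.ofReal_pow]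
    refine (inner_self_eq_norm_sq_to_K (𝕜 := ℂ)
      (tmul (b i) (b i) : HTensor H H)).symm.trans ?_
    rw [inner_tmul_tmul, inner_self_eq_norm_sq_to_K, b.orthonormal.1 i]
    simp
  refine ⟨measurePrepare b hv, fun ρ hρ Ω₁ _ _ A Ω₂ _ _ B X Y hX hY => ?_⟩
  have hm := (measurePrepare b hv).map_mem (T := ρ.op) ρ.mem
  have hbb : ∀ i, ⟪b i, b i⟫_ℂ = 1 := fun i => by
    rw [inner_self_eq_norm_sq_to_K, b.orthonormal.1 i]; simp
  constructor
  · rw [(partialTrace₂_spec hm).2]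
    have h1 := hasSum_trace_measurePrepare b hv ρ.op (ampLeft H (A.effect X))
    simp only [ampLeft_tmul, inner_tmul_tmul, hbb, mul_one] at h1
    exact h1.unique (hasSum_trace_comp_of_eigenbasis b ρ.op.2 (hb ρ hρ) _)
  · rw [(partialTrace₁_spec hm).2]
    have h1 := hasSum_trace_measurePrepare b hv ρ.op (ampRight H (B.effect Y))
    simp only [ampRight_tmul, inner_tmul_tmul, hbb, one_mul] at h1
    exact h1.unique (hasSum_trace_comp_of_eigenbasis b ρ.op.2 (hb ρ hρ) _)

end MeasurePrepare

/-! ### The sharp observable of a basis; commutative sets are contextuality non-confirming. -/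

section BasisPOVM

variable {H : Type u} [NormedAddCommGroup H] [InnerProductSpace ℂ H] [CompleteSpace H]
variable {ι : Type} [MeasurableSpace ι] [DiscreteMeasurableSpace ι]

/-- The projection onto the closed span of the basis vectors with index in `X`. -/
noncomputable def basisProjection (b : HilbertBasis ι ℂ H) (X : Set ι) : H →L[ℂ] H :=
  ((Submodule.span ℂ (b '' X)).topologicalClosure).starProjection

theorem basisProjection_nonneg (b : HilbertBasis ι ℂ H) (X : Set ι) : 0 ≤ basisProjection b X :=
  isStarProjection_starProjection.nonneg

open Classical in
theorem basisProjection_apply (b : HilbertBasis ι ℂ H) (X : Set ι) (i : ι) :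
    basisProjection b X (b i) = if i ∈ X then b i else 0 := by
  split_ifs with h
  · exact Submodule.starProjection_eq_self_iff.2
      (Submodule.le_topologicalClosure _ (Submodule.subset_span ⟨i, h, rfl⟩))
  · refine (Submodule.starProjection_apply_eq_zero_iff _).2 ?_
    rw [Submodule.orthogonal_closure, Submodule.mem_orthogonal]
    intro y hy
    induction hy using Submodule.span_induction with
    | mem y hy =>
      obtain ⟨j, hj, rfl⟩ := hy
      exact b.orthonormal.2 fun e => h (e ▸ hj)
    | zero => simp
    | add y z _ _ hy hz => rw [inner_add_left, hy, hz, add_zero]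
    | smul a y _ hy => rw [inner_smul_left, hy, mul_zero]

open Classical in
theorem hasSum_trace_basisProjection (b : HilbertBasis ι ℂ H) (ρ : State H) (X : Set ι) :
    HasSum (fun i => if i ∈ X then ((⟪b i, ρ.val (b i)⟫_ℂ).re : ℂ) else 0)
      (trace (ρ.val ∘L basisProjection b X)) := by
  convert hasSum_trace (comp_right_mem_traceClass ρ.op.2 (basisProjection b X)) b using 2 with i
  rw [ContinuousLinearMap.comp_apply, basisProjection_apply]
  split_ifs with h
  · exact (ρ.inner_eq_re _).symm
  · simp

/-- The sharp observable of an orthonormal basis. -/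
noncomputable def basisPOVM (b : HilbertBasis ι ℂ H) : POVM H ι where
  effect := basisProjection b
  nonneg X _ := basisProjection_nonneg b X
  exists_prob ρ := by
    classical
    have h0 := fun i => ρ.re_inner_nonneg (b i)
    have h1 : HasSum (fun i => (⟪b i, ρ.val (b i)⟫_ℂ).re) 1 := by
      have := Complex.hasSum_re (hasSum_trace ρ.op.2 b)
      rwa [ρ.trace_eq_one] at this
    let p : PMF ι := ⟨fun i => ENNReal.ofReal (⟪b i, ρ.val (b i)⟫_ℂ).re, by
      rw [← ENNReal.summable.hasSum_iff.symm, ← ENNReal.ofReal_tsum_of_nonneg h0 h1.summable,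
        h1.tsum_eq, ENNReal.ofReal_one]⟩
    refine ⟨p.toMeasure, inferInstance, fun X hX => ?_⟩
    have h2 := hasSum_trace_basisProjection b ρ X
    have hnn : ∀ i, 0 ≤ if i ∈ X then (⟪b i, ρ.val (b i)⟫_ℂ).re else 0 := fun i => by
      split_ifs
      exacts [h0 i, le_rfl]
    have h3 := Complex.hasSum_re h2
    have e : (fun i => (if i ∈ X then ((⟪b i, ρ.val (b i)⟫_ℂ).re : ℂ) else 0).re) =
        fun i => if i ∈ X then (⟪b i, ρ.val (b i)⟫_ℂ).re else 0 := by
      funext i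
      split_ifs <;> simp
    rw [e] at h3
    have e2 : ∀ i, X.indicator p i =
        ENNReal.ofReal (if i ∈ X then (⟪b i, ρ.val (b i)⟫_ℂ).re else 0) := fun i => by
      by_cases h : i ∈ X
      · simp [h]; rfl
      · simp [h]
    rw [PMF.toMeasure_apply _ hX, tsum_congr e2, ← ENNReal.ofReal_tsum_of_nonneg hnn h3.summable,
      ENNReal.toReal_ofReal (tsum_nonneg hnn), Complex.ofReal_tsum, ← h2.tsum_eq]
    refine tsum_congr fun i => ?_
    split_ifs <;> simp

theorem basisPOVM_prob (b : HilbertBasis ι ℂ H) (ρ : State H) (i : ι) :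
    ((basisPOVM b).prob ρ).real {i} = (⟪b i, ρ.val (b i)⟫_ℂ).re := by
  classical
  have h1 := (basisPOVM b).trace_effect ρ (MeasurableSet.singleton i)
  have h2 := (hasSum_trace_basisProjection b ρ {i}).unique
    (hasSum_single i fun j hj => by simp [hj])
  rw [if_pos (Set.mem_singleton i)] at h2
  exact Complex.ofReal_injective (h1.symm.trans h2)

theorem nonConfirming_of_commutative [TopologicalSpace.SeparableSpace H] {S : Set (State H)}
    (hS : Commutative S) : ContextualityNonConfirming S := by
  obtain ⟨ι, _, b, hb⟩ := exists_eigenbasis_of_commutative hS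
  -- The countable index set with its discrete σ-algebra is standard Borel, every family on it is
  -- measurable, and integrals over it are sums.
  let _ : MeasurableSpace ι := ⊤
  have hσ : ∀ A : H →L[ℂ] H, Measurable fun i =>
      trace ((pureState (b i) (b.orthonormal.1 i)).val ∘L A) := fun A => measurable_from_top
  refine ⟨ι, ⊤, inferInstance, basisPOVM b, fun i => pureState (b i) (b.orthonormal.1 i), hσ,
    fun ρ hρ Ω' _ _ M X hX => ?_⟩
  rw [integral_countable (integrable_trace_comp hσ _ _), trace_comm ρ.op.2,
    ← (hasSum_trace_comp_of_eigenbasis b ρ.op.2 (hb ρ hρ) (M.effect X)).tsum_eq]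
  refine tsum_congr fun i => ?_
  rw [basisPOVM_prob, trace_comp_pureState, Complex.real_smul, ← ρ.inner_eq_re]

end BasisPOVM

/-! ### Measuring and preparing in one basis breaks entanglement. -/

section EntanglementBreaking

variable {H : Type u} [NormedAddCommGroup H] [InnerProductSpace ℂ H] [CompleteSpace H]
variable {K : Type v} [NormedAddCommGroup K] [InnerProductSpace ℂ K] [CompleteSpace K]
variable {ι : Type*}

theorem trace_productState {τ : HTensor K H →L[ℂ] HTensor K H} (hτ : τ ∈ productStates K H) :
    trace τ = 1 := by
  have hT := subset_traceClass (productStates_subset hτ)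
  obtain ⟨α, β, h⟩ := hτ
  have h1 := hasSum_trace_tensorLeft hT (onb K)
  simp only [productState_slice h, trace_smul, β.trace_eq_one, mul_one] at h1
  rw [← α.trace_eq_one]
  exact h1.unique (hasSum_trace α.op.2 (onb K))

theorem add_sum_smul_mem_convexHull {E : Type*} [AddCommGroup E] [Module ℝ E] {A : Set E}
    {s : Finset ι} {r : ℝ} {p : ι → ℝ} {x : E} {y : ι → E} (hr : 0 ≤ r) (hp : ∀ i, 0 ≤ p i)
    (h1 : r + ∑ i ∈ s, p i = 1) (hx : x ∈ A) (hy : ∀ i, y i ∈ A) :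
    r • x + ∑ i ∈ s, p i • y i ∈ convexHull ℝ A := by
  have h := (convex_convexHull ℝ A).sum_mem (t := Finset.insertNone s)
    (w := fun o => o.elim r p) (z := fun o => o.elim x y)
    (by rintro (_ | i) _; exacts [hr, hp i])
    (by rw [Finset.sum_insertNone]; exact h1)
    (by rintro (_ | i) _; exacts [subset_convexHull ℝ _ hx, subset_convexHull ℝ _ (hy i)])
  rwa [Finset.sum_insertNone] at h

/-- A state that is a convergent series of multiples of product states is separable. -/
theorem State.separable_of_hasSum {Θ : State (HTensor K H)}
    {P : ι → HTensor K H →L[ℂ] HTensor K H} (hP : ∀ i, P i ∈ positiveFiniteTrace (HTensor K H))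
    (hprod : ∀ i, (trace (P i)).re ≠ 0 → ∃ π ∈ productStates K H, P i = ((trace (P i)).re : ℂ) • π)
    (hsum : HasSum P Θ.val) (htr : HasSum (fun i => (trace (P i)).re) 1) : Θ.Separable := by
  obtain ⟨i₀, hi₀⟩ : ∃ i, (trace (P i)).re ≠ 0 := by
    by_contra! h
    simp only [h] at htr
    exact zero_ne_one (hasSum_zero.unique htr)
  obtain ⟨π₀, hπ₀, -⟩ := hprod i₀ hi₀
  have hprod' : ∀ i, ∃ π ∈ productStates K H, P i = ((trace (P i)).re : ℂ) • π := fun i => by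
    by_cases h : (trace (P i)).re = 0
    · exact ⟨π₀, hπ₀, by rw [h, Complex.ofReal_zero, zero_smul]; exact eq_zero_of_trace_eq_zero (hP i) h⟩
    · exact hprod i h
  choose π hπ hPπ using hprod'
  have hnn : ∀ i, 0 ≤ (trace (P i)).re := fun i => trace_re_nonneg (hP i).1
  intro ε hε
  -- The finite sum over `s` misses mass `r < ε / 6`, which is put on the fixed product state `π₀`.
  -- The error is a difference of two positive operators of trace `r`, so `traceNorm_sub_le` bounds
  -- it by `6 r`.
  obtain ⟨s, hs⟩ := (htr.eventually (lt_mem_nhds (show 1 - ε / 6 < 1 by linarith))).exists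
  set r := 1 - ∑ i ∈ s, (trace (P i)).re with hr
  have hr0 : 0 ≤ r := sub_nonneg.2 (sum_le_hasSum s (fun i _ => hnn i) htr)
  refine ⟨(r : ℂ) • π₀ + ∑ i ∈ s, P i, ?_, ?_⟩
  · have h := add_sum_smul_mem_convexHull (s := s) hr0 hnn (sub_add_cancel _ _) hπ₀ hπ
    simp only [← Complex.coe_smul] at h
    simpa only [← hPπ] using h
  · have hs1 := positiveFiniteTrace_sum s fun i _ => hP i
    have hA : Θ.val - ∑ i ∈ s, P i ∈ positiveFiniteTrace (HTensor K H) :=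
      mem_positiveFiniteTrace_iff.2
        ⟨sub_nonneg.2 (sum_le_hasSum s (fun i _ => (hP i).1) hsum),
          sub_mem Θ.op.2 (subset_traceClass hs1)⟩
    have hB : (r : ℂ) • π₀ ∈ positiveFiniteTrace (HTensor K H) :=
      positiveFiniteTrace_smul (productStates_subset hπ₀) hr0
    have htA : (trace (Θ.val - ∑ i ∈ s, P i)).re = r := by
      rw [trace_sub Θ.op.2 (subset_traceClass hs1), Θ.trace_eq_one,
        trace_sum s fun i _ => subset_traceClass (hP i), Complex.sub_re, Complex.re_sum,
        Complex.one_re]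
    have htB : (trace ((r : ℂ) • π₀)).re = r := by
      rw [trace_smul, trace_productState hπ₀, mul_one, Complex.ofReal_re]
    have e : Θ.val - ((r : ℂ) • π₀ + ∑ i ∈ s, P i) = (Θ.val - ∑ i ∈ s, P i) - (r : ℂ) • π₀ := by
      abel
    rw [e]
    refine (traceNorm_sub_le hA hB).trans_lt ?_
    rw [htA, htB]
    linarith

theorem measurePrepare_entanglementBreaking {H : Type u} [NormedAddCommGroup H]
    [InnerProductSpace ℂ H] [CompleteSpace H] (b : HilbertBasis ι ℂ H) :
    (measurePrepare b b.orthonormal.1).EntanglementBreaking := by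
  intro K _ _ _ _ ω
  set R := fun i => tensorRight K (b i) with hR
  have hA : ∀ i, (R i).adjoint ∘L ω.val ∘L R i ∈ positiveFiniteTrace K := fun i =>
    positiveFiniteTrace_compress ω.mem _
  -- `P i` is the unnormalized ancilla operator conditioned on outcome `i`, tensored with `|b i⟩⟨b
  -- i|`. The sum of the `P i` is the image of `ω`.
  set P := fun i => R i ∘L ((R i).adjoint ∘L ω.val ∘L R i) ∘L (R i).adjoint with hPdef
  have hP : ∀ i, P i ∈ positiveFiniteTrace (HTensor K H) := fun i =>
    positiveFiniteTrace_conj (hA i) (R i)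
  have htP : ∀ i, trace (P i) = trace ((R i).adjoint ∘L ω.val ∘L R i) := fun i => by
    rw [hPdef]
    change trace (tensorRight K (b i) ∘L _ ∘L (tensorRight K (b i)).adjoint) = _
    rw [trace_tensorRight_conj (hA i), inner_self_eq_norm_sq_to_K, b.orthonormal.1 i]
    simp
  have hsumtr : HasSum (fun i => trace (P i)) 1 := by
    simp only [htP, ← ω.trace_eq_one]
    exact hasSum_trace_tensorRight ω.op.2 b
  have hre : HasSum (fun i => (trace (P i)).re) 1 := Complex.hasSum_re hsumtr
  obtain ⟨Q, hQ, hQsum, hQtr⟩ := exists_hasSum_positive hP hre.summable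
  let Θ : State (HTensor K H) :=
    { op := ⟨Q, subset_traceClass hQ⟩
      nonneg := hQ.1
      trace_eq_one := by
        have := hQtr (.id ℂ _)
        simp only [ContinuousLinearMap.id_comp] at this
        exact this.unique hsumtr }
  refine ⟨Θ, fun k k' => Subtype.ext ?_, State.separable_of_hasSum hP (fun i hi => ?_) hQsum hre⟩
  · ext y
    have h1 : HasSum _ (((measurePrepare b b.orthonormal.1).map (slice ω.op k k')).1 y) :=
      (hasSum_measurePrepare b b.orthonormal.1 (slice ω.op k k')).mapL
        (ContinuousLinearMap.apply ℂ H y)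
    have h2 := (hQsum.mapL (ContinuousLinearMap.apply ℂ _ (tmul k' y))).mapL
      (tensorLeft H k).adjoint
    refine HasSum.unique h2 ?_
    convert h1 using 2 with i
    simp only [ContinuousLinearMap.apply_apply, hPdef, hR, ContinuousLinearMap.comp_apply,
      InnerProductSpace.rankOne_apply, adjoint_tensorRight_tmul, map_smul, slice,
      tensorRight_apply, tensorLeft_apply, adjoint_tensorLeft_tmul,
      ContinuousLinearMap.adjoint_inner_right]
    rw [smul_comm]
  · rw [htP] at hi
    obtain ⟨α, hα⟩ := exists_state (hA i) hi
    refine ⟨tensorRight K (b i) ∘L α.val ∘L (tensorRight K (b i)).adjoint,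
      ⟨α, pureState (b i) (b.orthonormal.1 i), fun x y => ?_⟩, ?_⟩
    · simp only [ContinuousLinearMap.comp_apply, adjoint_tensorRight_tmul, map_smul,
        tensorRight_apply]
      change _ = tmul (α.val x) (InnerProductSpace.rankOne ℂ (b i) (b i) y)
      rw [InnerProductSpace.rankOne_apply]
      exact ((tensorLeft H (α.val x)).map_smul _ _).symm
    · rw [htP]
      calc P i = R i ∘L (((trace ((R i).adjoint ∘L ω.val ∘L R i)).re : ℂ) • α.val) ∘L
            (R i).adjoint := by rw [← hα]
        _ = _ := by rw [ContinuousLinearMap.smul_comp, ContinuousLinearMap.comp_smul]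

theorem exists_entanglementBreaking_of_commutative {H : Type u} [NormedAddCommGroup H]
    [InnerProductSpace ℂ H] [CompleteSpace H] [TopologicalSpace.SeparableSpace H]
    {S : Set (State H)} (hS : Commutative S) :
    ∃ Λ : Channel H H, Λ.EntanglementBreaking ∧ State.op '' S ⊆ Λ.fix := by
  obtain ⟨ι, -, b, hb⟩ := exists_eigenbasis_of_commutative hS
  refine ⟨measurePrepare b b.orthonormal.1, measurePrepare_entanglementBreaking b, ?_⟩
  rintro _ ⟨ρ, hρ, rfl⟩
  exact measurePrepare_fix b ρ.op (hb ρ hρ)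

end EntanglementBreaking

end QStates

theorem mainTheorem3 {H : Type*} [NormedAddCommGroup H] [InnerProductSpace ℂ H] [CompleteSpace H]
    [TopologicalSpace.SeparableSpace H] (S : Set (QStates.State H)) :
    List.TFAE [
      QStates.ContextualityNonConfirming S,
      ∃ Λ : QStates.Channel H H, Λ.EntanglementBreaking ∧ QStates.State.op '' S ⊆ Λ.fix,
      QStates.Broadcastable S,
      QStates.Commutative S] := by
  tfae_have 1 → 4 := QStates.commutative_of_nonConfirming
  tfae_have 2 → 4 := fun ⟨_, hΛ, hS⟩ => QStates.commutative_of_entanglementBreaking hΛ hS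
  tfae_have 3 → 4 := QStates.commutative_of_broadcastable
  tfae_have 4 → 1 := QStates.nonConfirming_of_commutative
  tfae_have 4 → 2 := QStates.exists_entanglementBreaking_of_commutative
  tfae_have 4 → 3 := QStates.broadcastable_of_commutative
  tfae_finish
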